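/- Let $0<R_1<R_2<\infty$, $\alpha\in\mathbb R\setminus\{0\}$ and $M_1,M_2\in\mathbb R$, and put $\rho(r,\theta)=(r\cos\theta,r\sin\theta)$. Let $\bar C$ be the quotient of $[R_1,R_2]\times\mathbb R$ by $(r,\theta)\sim(r,\theta+2\pi/\alpha)$, with the geodesic distance $d$ of the flat metric $dr^2+r^2d\theta^2$ (the metric making $\rho$ a local isometry); let $C\subset\bar C$ be the part $R_1<r<R_2$ and $\partial C$ the part $r\in\{R_1,R_2\}$. For $V\subseteq\bar C$ and $u:\bar C\to\mathbb R^2$ let $\operatorname{Lip}(u,V)$ be the least Lipschitz constant of $u$ on $V$ with respect to $d$ and the Euclidean norm, and for $x\in C$ let $\mathrm L u(x)=\inf_{\varepsilon>0}\operatorname{Lip}(u,C\cap B_\varepsilon(x))$. If $u,v:\bar C\to\mathbb R^2$ are Lipschitz, then $v$ is tighter than $u$ if $u=v$ on $\partial C$ and $$\sup\{\mathrm L u(x):x\in C,\ \mathrm L v(x)<\mathrm L u(x)\}>\sup\{\mathrm L v(x):x\in C,\ \mathrm L v(x)>\mathrm L u(x)\}$$ (with $\sup\emptyset=0$); a Lipschitz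 function $u$ is tight if there is no tighter $v$. Let $g:\partial C\to\mathbb R^2$ be given by $g(R_1,\theta)=\rho(M_1,\alpha\theta)$ and $g(R_2,\theta)=\rho(M_2,\alpha\theta)$ for all $\theta\in\mathbb R$. Then there is exactly one function $u:\bar C\to\mathbb R^2$ that is tight, agrees with $g$ on $\partial C$, and has the form $u(r,\theta)=\rho(\phi(r),\alpha\theta)$ for some $\phi:[R_1,R_2]\to\mathbb R$. -/

import Mathlib

open scoped ENNReal NNReal

noncomputable section

/-- The polar coordinate map `ρ (r, θ) = (r cos θ, r sin θ)`; the plane `ℝ²` with its Euclidean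
norm is identified with `ℂ`. -/
def polarMap (r θ : ℝ) : ℂ := ⟨r * Real.cos θ, r * Real.sin θ⟩

/-- The closed annular cover `C̄`: polar coordinates `(r, θ)` with `r ∈ [R₁, R₂]` and `θ` a real
number modulo `2π / α`. The set `[R₁, R₂] × ℝ` is the closure of the universal cover of the annulus
`{R₁ < |x| < R₂}`, and `C̄` is its quotient by `(r, θ) ↦ (r, θ + 2π / α)`. -/
@[ext]
structure ClosedCover (α R₁ R₂ : ℝ) where
  radius : ℝ
  angle : AddCircle (2 * Real.pi / α)
  radius_mem : radius ∈ Set.Icc R₁ R₂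

namespace ClosedCover

variable {α R₁ R₂ : ℝ}

/-- The open annular cover `C`. -/
def interiorPart (α R₁ R₂ : ℝ) : Set (ClosedCover α R₁ R₂) :=
  {p | R₁ < p.radius ∧ p.radius < R₂}

/-- The boundary `∂C`, the circles `r = R₁` and `r = R₂`. -/
def boundaryPart (α R₁ R₂ : ℝ) : Set (ClosedCover α R₁ R₂) :=
  {p | p.radius = R₁ ∨ p.radius = R₂}

/-- `γ`, restricted to `[0, 1]`, is the lift to `[R₁, R₂] × ℝ` of a path in `C̄` from `p` to `q`. -/
structure IsLiftedPath (p q : ClosedCover α R₁ R₂) (γ : ℝ → ℝ × ℝ) : Prop where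
  continuousOn : ContinuousOn γ (Set.Icc 0 1)
  radius_mem : ∀ t ∈ Set.Icc (0 : ℝ) 1, (γ t).1 ∈ Set.Icc R₁ R₂
  source_radius : (γ 0).1 = p.radius
  source_angle : ((γ 0).2 : AddCircle (2 * Real.pi / α)) = p.angle
  target_radius : (γ 1).1 = q.radius
  target_angle : ((γ 1).2 : AddCircle (2 * Real.pi / α)) = q.angle

/-- The length of a lifted path, for the flat metric that makes the covering map `ρ` a local
isometry: it is the length (total variation) of its image under `ρ` in the plane. -/
def pathLength (γ : ℝ → ℝ × ℝ) : ℝ≥0∞ :=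
  eVariationOn (fun t => polarMap (γ t).1 (γ t).2) (Set.Icc 0 1)

/-- The geodesic distance of `C̄`: the infimum of the lengths of the paths from `p` to `q`. -/
def geoDist (p q : ClosedCover α R₁ R₂) : ℝ≥0∞ :=
  ⨅ (γ : ℝ → ℝ × ℝ) (_ : IsLiftedPath p q γ), pathLength γ

/-- The least Lipschitz constant `Lip(u, V)` (in `[0, ∞]`) of `u` on `V`. -/
def lipConst (u : ClosedCover α R₁ R₂ → ℂ) (V : Set (ClosedCover α R₁ R₂)) : ℝ≥0∞ :=
  sInf {K : ℝ≥0∞ | ∀ p ∈ V, ∀ q ∈ V, edist (u p) (u q) ≤ K * geoDist p q}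

/-- `u` is Lipschitz on `C̄`. -/
def IsLip (u : ClosedCover α R₁ R₂ → ℂ) : Prop :=
  ∃ K : ℝ≥0, ∀ p q, edist (u p) (u q) ≤ K * geoDist p q

/-- The local Lipschitz constant `L u (p) = inf_{ε > 0} Lip(u, C ∩ B_ε(p))`. -/
def localLip (u : ClosedCover α R₁ R₂ → ℂ) (p : ClosedCover α R₁ R₂) : ℝ≥0∞ :=
  ⨅ (ε : ℝ≥0) (_ : 0 < ε), lipConst u (interiorPart α R₁ R₂ ∩ {q | geoDist p q < ε})

/-- `v` is tighter than `u`: both are Lipschitz on `C̄`, they agree on `∂C`, and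
`sup {L u : L v < L u} > sup {L v : L v > L u}`, the suprema running over points of `C`. -/
structure IsTighter (v u : ClosedCover α R₁ R₂ → ℂ) : Prop where
  lip_left : IsLip v
  lip_right : IsLip u
  eqOn_boundary : Set.EqOn v u (boundaryPart α R₁ R₂)
  sup_lt_sup :
    (⨆ p ∈ {p ∈ interiorPart α R₁ R₂ | localLip u p < localLip v p}, localLip v p) <
      ⨆ p ∈ {p ∈ interiorPart α R₁ R₂ | localLip v p < localLip u p}, localLip u p

/-- `u` is tight: it is Lipschitz on `C̄` and no function is tighter. -/
def IsTight (u : ClosedCover α R₁ R₂ → ℂ) : Prop :=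
  IsLip u ∧ ¬ ∃ v : ClosedCover α R₁ R₂ → ℂ, IsTighter v u

/-- `u` has the radial form `u (r, θ) = ρ (φ r, α θ)` for some real function `φ`. -/
def IsRadial (u : ClosedCover α R₁ R₂ → ℂ) : Prop :=
  ∃ φ : ℝ → ℝ, ∀ (p : ClosedCover α R₁ R₂) (θ : ℝ),
    (θ : AddCircle (2 * Real.pi / α)) = p.angle → u p = polarMap (φ p.radius) (α * θ)

end ClosedCover

end

/-!
For a radial map `u (r, θ) = ρ (φ r, α θ)` with `a = |α|`, the local Lipschitz constant at radius `r`
is the larger of the radial slope `|φ'|` and the angular stretching `a |φ| / r`. Only bounds are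
needed: a bound for both quantities near `r` bounds it from above
(`HasProfile.localLip_le_of_hasSlopeBound`), and each of the two bounds it from below
(`HasProfile.le_localLip`, `HasProfile.lipOn_of_localLip_lt`).

The profile of the solution consists of an arc `M₁ (r / R₁) ^ (-a)` starting at the inner circle, a
segment, and an arc `M₂ (r / R₂) ^ a` ending at the outer circle. On the arcs the radial slope equals
the angular stretching, on the segment it dominates; the arcs meet the segment where its slope is
equal to the angular stretching, and each of the three parts may be degenerate. Such a profile, a
`Transition`, exists by the intermediate value theorem applied to the slope of the segment
(`Transition.nonempty`).

The radial map with this profile is tight (`isTight_of_transition`). Its local Lipschitz constant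
is nonincreasing along the inner arc, constant and least on the segment, and nondecreasing along the
outer arc. A competitor whose constant is not larger between a boundary circle and a point of the
adjacent arc stays, by integration along rays, close to the boundary values; a closed curve that is
so close to the boundary circle and has no more than the speed of the arc is itself the expected
circle (`eq_polarMap_of_circle`). Between the arcs it agrees with the segment by equality in the
triangle inequality (`eq_polarMap_of_norm_le`).

Conversely, let `ψ` be the profile of a tight radial map with the same boundary values. Replacing `ψ`
on an interval cannot make the map tighter (`IsTight.localLip_le_of_replacement`). With a chord as
replacement, `ψ` is affine wherever its chord is steep compared with the angular stretching
(`IsTightProfile.eq_chord`); hence it cannot be touched from below by a uniformly convex function of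
that steepness, and lies above convex functions that are steep in this sense
(`IsTightProfile.le_of_subgradient`). With barriers built from the arcs as replacements, the angular
stretching of `ψ` is at most the local Lipschitz constant of the solution
(`IsTightProfile.angular_le_bound`). That estimate makes the comparison applicable to the solution
itself and determines `ψ` on the arcs; on the segment the chord rule does.
-/

open Set Filter Topology

/-! ### Polar coordinates -/

theorem polarMap_eq (r θ : ℝ) : polarMap r θ = r * Complex.exp (θ * Complex.I) := by
  apply Complex.ext <;>
    simp [polarMap, Complex.exp_ofReal_mul_I_re, Complex.exp_ofReal_mul_I_im]

theorem norm_polarMap (r θ : ℝ) : ‖polarMap r θ‖ = |r| := by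
  rw [polarMap_eq, norm_mul, Complex.norm_exp_ofReal_mul_I, mul_one, Complex.norm_real,
    Real.norm_eq_abs]

theorem polarMap_neg (r θ : ℝ) : polarMap (-r) θ = -polarMap r θ := by
  simp [polarMap_eq]

theorem polarMap_sub (r s θ : ℝ) : polarMap r θ - polarMap s θ = polarMap (r - s) θ := by
  simp [polarMap_eq, sub_mul]

theorem polarMap_left_injective (θ : ℝ) : Function.Injective fun r => polarMap r θ := by
  intro r s h
  have h0 := polarMap_sub r s θ
  rw [sub_eq_zero.mpr h] at h0
  have := norm_polarMap (r - s) θ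
  rw [← h0, norm_zero, eq_comm, abs_eq_zero, sub_eq_zero] at this
  exact this

/-- The law of cosines. -/
theorem norm_polarMap_sub_sq (r s θ η : ℝ) :
    ‖polarMap r θ - polarMap s η‖ ^ 2
      = (r - s) ^ 2 + 2 * (r * s) * (1 - Real.cos (θ - η)) := by
  rw [Complex.sq_norm, Complex.normSq_apply, Real.cos_sub]
  simp only [polarMap, Complex.sub_re, Complex.sub_im]
  linear_combination r ^ 2 * Real.sin_sq_add_cos_sq θ + s ^ 2 * Real.sin_sq_add_cos_sq η

theorem norm_polarMap_sub_le {r s M : ℝ} (hs : 0 ≤ s) (hsM : s ≤ M) (θ η : ℝ) :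
    ‖polarMap r θ - polarMap s η‖ ≤ |r - s| + M * |θ - η| := by
  have h1 : ‖polarMap s θ - polarMap s η‖ ≤ s * |θ - η| := by
    refine abs_le_of_sq_le_sq' ?_ (by positivity) |>.2
    rw [norm_polarMap_sub_sq, mul_pow, sq_abs]
    have := Real.one_sub_sq_div_two_le_cos (x := θ - η)
    nlinarith [mul_nonneg hs hs]
  calc ‖polarMap r θ - polarMap s η‖
      = ‖(polarMap r θ - polarMap s θ) + (polarMap s θ - polarMap s η)‖ := by congr 1; ring
    _ ≤ ‖polarMap r θ - polarMap s θ‖ + ‖polarMap s θ - polarMap s η‖ := norm_add_le _ _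
    _ ≤ |r - s| + M * |θ - η| := by
      rw [polarMap_sub, norm_polarMap]
      gcongr
      exact h1.trans (by gcongr)

theorem exists_sq_le_mul_one_sub_cos {C : ℝ} (hC : 1 < C) :
    ∃ η > 0, ∀ h : ℝ, |h| < η → h ^ 2 / 2 ≤ C * (1 - Real.cos h) := by
  refine ⟨min 1 ((C - 1) / C), by have := sub_pos.2 hC; positivity, fun h hh => ?_⟩
  have h1 : |h| ≤ 1 := (hh.trans_le (min_le_left _ _)).le
  have h2 : |h| * C ≤ C - 1 := by
    have := (hh.trans_le (min_le_right _ _)).le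
    rwa [le_div_iff₀ (by linarith)] at this
  have h4 := (abs_le.1 (Real.cos_bound h1)).2
  have h5 : |h| ^ 4 = h ^ 2 * |h| ^ 2 := by rw [← sq_abs h]; ring
  have h6 : |h| ^ 2 ≤ |h| := by nlinarith [abs_nonneg h]
  have h8 : h ^ 2 * |h| ^ 2 * C ≤ h ^ 2 * (C - 1) := by
    rw [mul_assoc]
    gcongr
    nlinarith
  nlinarith [sq_nonneg h]

theorem exists_one_sub_cos_mul_le (α : ℝ) {C : ℝ} (hC : 1 < C) :
    ∃ η > 0, ∀ h : ℝ, |h| < η →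
      1 - Real.cos (α * h) ≤ C * α ^ 2 * (1 - Real.cos h) := by
  obtain ⟨η, hη, H⟩ := exists_sq_le_mul_one_sub_cos hC
  refine ⟨η, hη, fun h hh => ?_⟩
  have h3 := Real.one_sub_sq_div_two_le_cos (x := α * h)
  nlinarith [mul_le_mul_of_nonneg_left (H h hh) (sq_nonneg α)]

/-- The comparison behind the local Lipschitz constant of a radial map: bounds for the radial slope
and for the angular stretching `|α| |x| / r` combine into one bound by their maximum. -/
theorem norm_polarMap_sub_le_mul {α K C r s x y θ η : ℝ} (hr : 0 ≤ r) (hs : 0 ≤ s)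
    (hK : 0 ≤ K) (hC : 1 ≤ C) (hxy : |x - y| ≤ K * |r - s|) (hx : |α| * |x| ≤ K * r)
    (hy : |α| * |y| ≤ K * s)
    (hcos : 1 - Real.cos (α * (θ - η)) ≤ C ^ 2 * α ^ 2 * (1 - Real.cos (θ - η))) :
    ‖polarMap x (α * θ) - polarMap y (α * η)‖
      ≤ C * K * ‖polarMap r θ - polarMap s η‖ := by
  refine abs_le_of_sq_le_sq' ?_ (by positivity) |>.2
  rw [mul_pow, norm_polarMap_sub_sq, norm_polarMap_sub_sq, ← mul_sub]
  have h1 : (x - y) ^ 2 ≤ K ^ 2 * (r - s) ^ 2 := by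
    rw [← sq_abs (x - y), ← sq_abs (r - s), ← mul_pow]
    gcongr
  have h0 : 0 ≤ 1 - Real.cos (θ - η) := by linarith [Real.cos_le_one (θ - η)]
  have h0' : 0 ≤ 1 - Real.cos (α * (θ - η)) := by linarith [Real.cos_le_one (α * (θ - η))]
  have h2 : α ^ 2 * (x * y) ≤ K ^ 2 * (r * s) := by
    calc α ^ 2 * (x * y) ≤ |α ^ 2 * (x * y)| := le_abs_self _
      _ = (|α| * |x|) * (|α| * |y|) := by rw [abs_mul, abs_mul, abs_pow]; ring
      _ ≤ (K * r) * (K * s) := by gcongr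
      _ = _ := by ring
  have h3 : x * y * (1 - Real.cos (α * (θ - η)))
      ≤ C ^ 2 * (K ^ 2 * (r * s) * (1 - Real.cos (θ - η))) := by
    rcases le_or_gt (x * y) 0 with h | h
    · have : 0 ≤ C ^ 2 * (K ^ 2 * (r * s) * (1 - Real.cos (θ - η))) := by positivity
      nlinarith
    · calc x * y * (1 - Real.cos (α * (θ - η)))
          ≤ x * y * (C ^ 2 * α ^ 2 * (1 - Real.cos (θ - η))) := by gcongr
        _ = C ^ 2 * (α ^ 2 * (x * y) * (1 - Real.cos (θ - η))) := by ring
        _ ≤ _ := by gcongr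
  have h4 : K ^ 2 * (r - s) ^ 2 ≤ C ^ 2 * (K ^ 2 * (r - s) ^ 2) :=
    le_mul_of_one_le_left (by positivity) (by nlinarith)
  nlinarith

namespace ClosedCover

variable {α R₁ R₂ : ℝ}

/-! ### Comparison of the geodesic distance with polar coordinates -/

/-- The point of the cover with polar coordinates `(r, θ)`. -/
noncomputable def ofPolar (α : ℝ) {R₁ R₂ : ℝ} (r θ : ℝ) (hr : r ∈ Icc R₁ R₂) :
    ClosedCover α R₁ R₂ :=
  ⟨r, (θ : AddCircle (2 * Real.pi / α)), hr⟩

theorem exists_angle (p : ClosedCover α R₁ R₂) :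
    ∃ θ : ℝ, (θ : AddCircle (2 * Real.pi / α)) = p.angle :=
  QuotientAddGroup.mk_surjective p.angle

theorem exists_eq_ofPolar (p : ClosedCover α R₁ R₂) : ∃ θ, p = ofPolar α p.radius θ p.radius_mem := by
  obtain ⟨θ, hθ⟩ := exists_angle p
  exact ⟨θ, ClosedCover.ext rfl hθ.symm⟩

/-- The length of the curve which is a segment in the coordinates `(r, θ)`. -/
theorem geoDist_ofPolar_le {r s M θ η : ℝ} (hr : r ∈ Icc R₁ R₂) (hs : s ∈ Icc R₁ R₂)
    (hR₁ : 0 ≤ R₁) (hrM : r ≤ M) (hsM : s ≤ M) :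
    geoDist (ofPolar α r θ hr) (ofPolar α s η hs) ≤ ENNReal.ofReal (|r - s| + M * |θ - η|) := by
  have hM : 0 ≤ M := (hR₁.trans hr.1).trans hrM
  have hmem : ∀ t ∈ Icc (0 : ℝ) 1, r + t * (s - r) ∈ Icc R₁ R₂ ∧ r + t * (s - r) ≤ M := by
    intro t ht
    obtain ⟨h0, h1⟩ := ht
    obtain ⟨h2, h3⟩ := hr
    obtain ⟨h4, h5⟩ := hs
    refine ⟨⟨?_, ?_⟩, ?_⟩ <;> nlinarith
  let γ : ℝ → ℝ × ℝ := fun t => (r + t * (s - r), θ + t * (η - θ))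
  have hγ : IsLiftedPath (ofPolar α r θ hr) (ofPolar α s η hs) γ := by
    refine ⟨by fun_prop, fun t ht => (hmem t ht).1, ?_, ?_, ?_, ?_⟩ <;> simp [γ, ofPolar]
  refine (iInf₂_le γ hγ).trans ?_
  have hnn : 0 ≤ |r - s| + M * |θ - η| := by positivity
  have hlip : LipschitzOnWith (Real.toNNReal (|r - s| + M * |θ - η|))
      (fun t => polarMap (γ t).1 (γ t).2) (Icc 0 1) := by
    refine LipschitzOnWith.of_dist_le_mul fun t ht t' ht' => ?_
    rw [Real.coe_toNNReal _ hnn, dist_eq_norm, Real.dist_eq]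
    refine (norm_polarMap_sub_le (hR₁.trans (hmem t' ht').1.1) (hmem t' ht').2 _ _).trans
      (le_of_eq ?_)
    simp only [γ]
    rw [show r + t * (s - r) - (r + t' * (s - r)) = (t - t') * (s - r) by ring,
      show θ + t * (η - θ) - (θ + t' * (η - θ)) = (t - t') * (η - θ) by ring, abs_mul, abs_mul,
      abs_sub_comm s r, abs_sub_comm η θ]
    ring
  have h1 := hlip.comp_eVariationOn_le (g := id) (s := Icc 0 1) (mapsTo_id _)
  have h2 : eVariationOn (id : ℝ → ℝ) (Icc 0 1) ≤ 1 := by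
    have := MonotoneOn.eVariationOn_eq (f := (id : ℝ → ℝ)) (s := Icc 0 1) (a := 0) (b := 1)
      (monotone_id.monotoneOn _) (by simp) (by simp)
    simp_all
  calc pathLength γ ≤ _ := h1
    _ ≤ (Real.toNNReal (|r - s| + M * |θ - η|) : ℝ≥0∞) * 1 := by gcongr
    _ = _ := by rw [mul_one]; rfl

theorem geoDist_radial_le {r s θ : ℝ} (hr : r ∈ Icc R₁ R₂) (hs : s ∈ Icc R₁ R₂) (hR₁ : 0 ≤ R₁) :
    geoDist (ofPolar α r θ hr) (ofPolar α s θ hs) ≤ ENNReal.ofReal |r - s| := by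
  simpa using geoDist_ofPolar_le (θ := θ) (η := θ) hr hs hR₁ hr.2 hs.2

theorem geoDist_circle_le {r θ η : ℝ} (hr : r ∈ Icc R₁ R₂) (hR₁ : 0 ≤ R₁) :
    geoDist (ofPolar α r θ hr) (ofPolar α r η hr) ≤ ENNReal.ofReal (r * |θ - η|) := by
  simpa using geoDist_ofPolar_le (θ := θ) (η := η) hr hr hR₁ le_rfl le_rfl

theorem IsLiftedPath.abs_radius_sub_le {p q : ClosedCover α R₁ R₂} {γ : ℝ → ℝ × ℝ}
    (hγ : IsLiftedPath p q γ) (hR₁ : 0 ≤ R₁) {t : ℝ} (ht : t ∈ Icc (0 : ℝ) 1) :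
    ENNReal.ofReal |(γ t).1 - p.radius| ≤ pathLength γ := by
  refine le_trans ?_ (eVariationOn.edist_le (fun t => polarMap (γ t).1 (γ t).2) ht
    (show (0 : ℝ) ∈ Icc (0 : ℝ) 1 by simp))
  rw [edist_dist, dist_eq_norm, ← hγ.source_radius]
  apply ENNReal.ofReal_le_ofReal
  refine le_trans (le_of_eq ?_) (abs_norm_sub_norm_le _ _)
  rw [norm_polarMap, norm_polarMap, abs_of_nonneg (hR₁.trans (hγ.radius_mem t ht).1),
    abs_of_nonneg (hR₁.trans (hγ.radius_mem 0 (by simp)).1)]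

theorem abs_radius_sub_le_geoDist (hR₁ : 0 ≤ R₁) (p q : ClosedCover α R₁ R₂) :
    ENNReal.ofReal |q.radius - p.radius| ≤ geoDist p q := by
  refine le_iInf₂ fun γ hγ => ?_
  rw [← hγ.target_radius]
  exact hγ.abs_radius_sub_le hR₁ (by simp)

theorem abs_radius_sub_lt_of_geoDist_lt (hR₁ : 0 ≤ R₁) {p q : ClosedCover α R₁ R₂} {ε : ℝ}
    (hε : 0 < ε) (h : geoDist p q < ENNReal.ofReal ε) : |q.radius - p.radius| < ε :=
  (ENNReal.ofReal_lt_ofReal_iff hε).1 ((abs_radius_sub_le_geoDist hR₁ p q).trans_lt h)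

/-- A bound which holds between nearby points of a path adds up along the path. -/
theorem edist_le_mul_pathLength {f : ℝ × ℝ → ℂ} {γ : ℝ → ℝ × ℝ}
    (hγ : ContinuousOn γ (Icc 0 1)) {K : ℝ≥0∞} {η : ℝ} (hη : 0 < η)
    (h : ∀ s ∈ Icc (0 : ℝ) 1, ∀ t ∈ Icc (0 : ℝ) 1, dist (γ s) (γ t) < η →
      edist (f (γ s)) (f (γ t))
        ≤ K * edist (polarMap (γ s).1 (γ s).2) (polarMap (γ t).1 (γ t).2)) :
    edist (f (γ 0)) (f (γ 1)) ≤ K * pathLength γ := by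
  have huc := isCompact_Icc.uniformContinuousOn_of_continuous hγ
  obtain ⟨δ, hδ, hd⟩ := Metric.uniformContinuousOn_iff.1 huc η hη
  obtain ⟨n, hn⟩ := exists_nat_one_div_lt hδ
  set u : ℕ → ℝ := fun i => min 1 ((i : ℝ) / (n + 1)) with hu
  have hmono : Monotone u := fun i j hij => by
    simp only [hu]; gcongr
  have hmem : ∀ i, u i ∈ Icc (0 : ℝ) 1 := fun i =>
    ⟨le_min zero_le_one (by positivity), min_le_left _ _⟩
  have h0 : u 0 = 0 := by simp [hu]
  have h1 : u (n + 1) = 1 := by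
    simp only [hu]
    rw [Nat.cast_add, Nat.cast_one, div_self (by positivity), min_self]
  have hstep : ∀ i, dist (u (i + 1)) (u i) < δ := fun i => by
    refine lt_of_le_of_lt ?_ hn
    simp only [hu, Real.dist_eq]
    refine (abs_min_sub_min_le_max _ _ _ _).trans ?_
    rw [sub_self, abs_zero, ← sub_div]
    push_cast
    rw [add_sub_cancel_left, abs_of_nonneg (by positivity)]
    exact max_le (by positivity) le_rfl
  calc edist (f (γ 0)) (f (γ 1)) = edist (f (γ (u 0))) (f (γ (u (n + 1)))) := by rw [h0, h1]
    _ ≤ ∑ i ∈ Finset.range (n + 1), edist (f (γ (u i))) (f (γ (u (i + 1)))) :=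
      edist_le_range_sum_edist (fun i => f (γ (u i))) (n + 1)
    _ ≤ ∑ i ∈ Finset.range (n + 1), K * edist (polarMap (γ (u (i + 1))).1 (γ (u (i + 1))).2)
          (polarMap (γ (u i)).1 (γ (u i)).2) := by
      refine Finset.sum_le_sum fun i _ => ?_
      rw [edist_comm]
      exact h _ (hmem _) _ (hmem _) (hd _ (hmem _) _ (hmem _) (hstep i))
    _ ≤ K * pathLength γ := by
      rw [← Finset.mul_sum]
      gcongr
      exact eVariationOn.sum_le (f := fun t => polarMap (γ t).1 (γ t).2) hmono hmem

/-! ### The local Lipschitz constant -/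

theorem edist_le_of_lipConst_lt {u : ClosedCover α R₁ R₂ → ℂ} {V : Set (ClosedCover α R₁ R₂)} {K : ℝ≥0∞}
    (h : lipConst u V < K) : ∀ p ∈ V, ∀ q ∈ V, edist (u p) (u q) ≤ K * geoDist p q := by
  obtain ⟨K', hK', hlt⟩ := sInf_lt_iff.1 h
  exact fun p hp q hq => (hK' p hp q hq).trans (by gcongr)

theorem localLip_le_of_forall {u : ClosedCover α R₁ R₂ → ℂ} {p : ClosedCover α R₁ R₂} {K : ℝ≥0∞}
    {ε : ℝ} (hε : 0 < ε)
    (h : ∀ q ∈ interiorPart α R₁ R₂, geoDist p q < ENNReal.ofReal ε →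
      ∀ q' ∈ interiorPart α R₁ R₂, geoDist p q' < ENNReal.ofReal ε →
        edist (u q) (u q') ≤ K * geoDist q q') : localLip u p ≤ K := by
  refine (iInf₂_le (Real.toNNReal ε) (Real.toNNReal_pos.2 hε)).trans (sInf_le ?_)
  exact fun q hq q' hq' => h q hq.1 hq.2 q' hq'.1 hq'.2

theorem exists_of_localLip_lt {u : ClosedCover α R₁ R₂ → ℂ} {p : ClosedCover α R₁ R₂} {K : ℝ≥0∞}
    (h : localLip u p < K) : ∃ ε : ℝ, 0 < ε ∧
      ∀ q ∈ interiorPart α R₁ R₂, geoDist p q < ENNReal.ofReal ε →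
      ∀ q' ∈ interiorPart α R₁ R₂, geoDist p q' < ENNReal.ofReal ε →
        edist (u q) (u q') ≤ K * geoDist q q' := by
  simp only [localLip, iInf_lt_iff] at h
  obtain ⟨ε, hε, hlt⟩ := h
  refine ⟨ε, hε, fun q hq hq1 q' hq' hq1' => ?_⟩
  rw [ENNReal.ofReal_coe_nnreal] at hq1 hq1'
  exact edist_le_of_lipConst_lt hlt q ⟨hq, hq1⟩ q' ⟨hq', hq1'⟩

theorem localLip_neg (u : ClosedCover α R₁ R₂ → ℂ) (p : ClosedCover α R₁ R₂) :
    localLip (-u) p = localLip u p := by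
  simp only [localLip, lipConst, Pi.neg_apply, edist_neg_neg]

theorem localLip_congr (hR₁ : 0 ≤ R₁) {u v : ClosedCover α R₁ R₂ → ℂ} {p : ClosedCover α R₁ R₂}
    {ε : ℝ} (hε : 0 < ε) (h : ∀ q, |q.radius - p.radius| < ε → u q = v q) :
    localLip u p = localLip v p := by
  have key : ∀ u v : ClosedCover α R₁ R₂ → ℂ,
      (∀ q, |q.radius - p.radius| < ε → u q = v q) → localLip u p ≤ localLip v p := by
    intro u v h
    refine le_of_forall_gt_imp_ge_of_dense fun K hK => ?_
    obtain ⟨δ, hδ, hlip⟩ := exists_of_localLip_lt hK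
    refine localLip_le_of_forall (lt_min hδ hε) fun q hq hq1 q' hq' hq1' => ?_
    have e1 : ENNReal.ofReal (min δ ε) ≤ ENNReal.ofReal δ :=
      ENNReal.ofReal_le_ofReal (min_le_left _ _)
    have e2 : ENNReal.ofReal (min δ ε) ≤ ENNReal.ofReal ε :=
      ENNReal.ofReal_le_ofReal (min_le_right _ _)
    rw [h q (abs_radius_sub_lt_of_geoDist_lt hR₁ hε (hq1.trans_le e2)),
      h q' (abs_radius_sub_lt_of_geoDist_lt hR₁ hε (hq1'.trans_le e2))]
    exact hlip q hq (hq1.trans_le e1) q' hq' (hq1'.trans_le e1)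
  exact le_antisymm (key u v h) (key v u fun q hq => (h q hq).symm)

theorem edist_le_ofReal_mul {x y : ℂ} {K : ℝ} (hK : 0 ≤ K) {d : ℝ} (hd : 0 ≤ d) {g : ℝ≥0∞}
    (h : edist x y ≤ ENNReal.ofReal K * g) (hg : g ≤ ENNReal.ofReal d) : ‖x - y‖ ≤ K * d := by
  have h1 : edist x y ≤ ENNReal.ofReal (K * d) := by
    rw [ENNReal.ofReal_mul hK]
    exact h.trans (by gcongr)
  rwa [edist_dist, ENNReal.ofReal_le_ofReal_iff (by positivity), dist_eq_norm] at h1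

/-- Near a point where the local Lipschitz constant is less than `K`, a map is `K`-Lipschitz
along radii. -/
theorem radial_bound_of_localLip_lt (hR₁ : 0 ≤ R₁) {u : ClosedCover α R₁ R₂ → ℂ} {r θ K : ℝ}
    (hr : r ∈ Ioo R₁ R₂) (hK : 0 ≤ K)
    (h : localLip u (ofPolar α r θ (Ioo_subset_Icc_self hr)) < ENNReal.ofReal K) :
    ∃ ε > 0, ∀ (x : ℝ) (hx : x ∈ Ioo R₁ R₂), |x - r| < ε → ∀ (y : ℝ) (hy : y ∈ Ioo R₁ R₂),
      |y - r| < ε → ‖u (ofPolar α x θ (Ioo_subset_Icc_self hx))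
        - u (ofPolar α y θ (Ioo_subset_Icc_self hy))‖ ≤ K * |x - y| := by
  obtain ⟨ε, hε, hlip⟩ := exists_of_localLip_lt h
  have hg : ∀ (x : ℝ) (hx : x ∈ Ioo R₁ R₂), |x - r| < ε →
      geoDist (ofPolar α r θ (Ioo_subset_Icc_self hr)) (ofPolar α x θ (Ioo_subset_Icc_self hx))
        < ENNReal.ofReal ε := fun x hx hxε => by
    refine (geoDist_radial_le _ _ hR₁).trans_lt ?_
    rwa [abs_sub_comm, ENNReal.ofReal_lt_ofReal_iff hε]
  refine ⟨ε, hε, fun x hx hxε y hy hyε => ?_⟩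
  exact edist_le_ofReal_mul hK (abs_nonneg _) (hlip _ hx (hg x hx hxε) _ hy (hg y hy hyε))
    (geoDist_radial_le _ _ hR₁)

/-- Near a point where the local Lipschitz constant is less than `K`, a map is `K`-Lipschitz
along the circle through that point. -/
theorem circle_bound_of_localLip_lt (hR₁ : 0 ≤ R₁) {u : ClosedCover α R₁ R₂ → ℂ} {r θ K : ℝ}
    (hr : r ∈ Ioo R₁ R₂) (hK : 0 ≤ K)
    (h : localLip u (ofPolar α r θ (Ioo_subset_Icc_self hr)) < ENNReal.ofReal K) :
    ∃ ε > 0, ∀ η, |η - θ| < ε → ‖u (ofPolar α r η (Ioo_subset_Icc_self hr))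
        - u (ofPolar α r θ (Ioo_subset_Icc_self hr))‖ ≤ K * (r * |η - θ|) := by
  obtain ⟨ε, hε, hlip⟩ := exists_of_localLip_lt h
  have hr0 : 0 < r := hR₁.trans_lt hr.1
  have hg : ∀ η, |η - θ| < ε / r →
      geoDist (ofPolar α r θ (Ioo_subset_Icc_self hr)) (ofPolar α r η (Ioo_subset_Icc_self hr))
        < ENNReal.ofReal ε := fun η hη => by
    refine (geoDist_circle_le _ hR₁).trans_lt ?_
    rw [abs_sub_comm, ENNReal.ofReal_lt_ofReal_iff hε]
    rwa [lt_div_iff₀' hr0] at hη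
  refine ⟨ε / r, by positivity, fun η hη => ?_⟩
  refine edist_le_ofReal_mul hK (by positivity)
    (hlip _ hr (hg η hη) _ hr (hg θ ?_)) (geoDist_circle_le _ hR₁)
  rw [sub_self, abs_zero]
  positivity

theorem IsLip.exists_radial_bound (hR₁ : 0 ≤ R₁) {u : ClosedCover α R₁ R₂ → ℂ} (hu : IsLip u) :
    ∃ K : ℝ, 0 ≤ K ∧ ∀ (x y θ : ℝ) (hx : x ∈ Icc R₁ R₂) (hy : y ∈ Icc R₁ R₂),
      ‖u (ofPolar α x θ hx) - u (ofPolar α y θ hy)‖ ≤ K * |x - y| := by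
  obtain ⟨K, hK⟩ := hu
  refine ⟨K, K.2, fun x y θ hx hy => ?_⟩
  refine edist_le_ofReal_mul K.2 (abs_nonneg _) ?_ (geoDist_radial_le (α := α) (θ := θ) hx hy hR₁)
  simpa using hK _ _

end ClosedCover

/-! ### Real-variable tools -/

/-- A mean value inequality for functions which are controlled locally, to the right of each
interior point, by the derivative of `B`. -/
theorem norm_sub_le_of_local_bound {E : Type*} [NormedAddCommGroup E] {f : ℝ → E} {B B' : ℝ → ℝ}
    {a b : ℝ} (hab : a ≤ b) (hf : ContinuousOn f (Icc a b)) (hB : ContinuousOn B (Icc a b))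
    (hB' : ∀ x ∈ Ioo a b, HasDerivAt B (B' x) x)
    (h : ∀ x ∈ Ioo a b, ∀ K > B' x, ∀ᶠ z in 𝓝[>] x, ‖f z - f x‖ ≤ K * (z - x)) :
    ‖f b - f a‖ ≤ B b - B a := by
  rcases hab.eq_or_lt with rfl | hab
  · simp
  have step : ∀ c ∈ Ioo a b, ‖f b - f c‖ ≤ B b - B c := by
    intro c hc
    have hsub : Icc c b ⊆ Icc a b := Icc_subset_Icc_left hc.1.le
    refine le_of_forall_pos_le_add fun ε hε => ?_
    have hbc : 0 < b - c := sub_pos.2 hc.2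
    set δ := ε / (b - c) with hδ
    have hδ0 : 0 < δ := by positivity
    have hmem : ∀ x ∈ Ico c b, x ∈ Ioo a b := fun x hx => ⟨hc.1.trans_le hx.1, hx.2⟩
    have key := image_norm_le_of_liminf_right_slope_norm_lt_deriv_boundary
      (f := fun x => f x - f c) (f' := B') (a := c) (b := b)
      (B := fun x => B x - B c + δ * (x - c)) (B' := fun x => B' x + δ)
      ((hf.mono hsub).sub continuousOn_const) ?_ (by simp)
      (((hB.mono hsub).sub continuousOn_const).add (by fun_prop)) ?_ ?_
      (right_mem_Icc.2 hc.2.le)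
    · have : δ * (b - c) = ε := by rw [hδ]; field_simp
      linarith
    · intro x hx r hr
      refine Eventually.frequently ?_
      filter_upwards [h x (hmem x hx) ((B' x + r) / 2) (by linarith), self_mem_nhdsWithin]
        with z hz hxz
      have hxz' : 0 < z - x := sub_pos.2 hxz
      rw [slope_def_field, div_lt_iff₀ hxz']
      have h1 : ‖f z - f c‖ - ‖f x - f c‖ ≤ ‖f z - f x‖ := by
        refine (norm_sub_norm_le _ _).trans (le_of_eq ?_)
        congr 1
        abel
      simp only [Function.comp]
      nlinarith
    · intro x hx
      have h1 : HasDerivAt (fun x => B x - B c + δ * (x - c)) (B' x + δ) x := by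
        have h2 : HasDerivAt (fun x : ℝ => δ * (x - c)) (δ * 1) x :=
          ((hasDerivAt_id x).sub_const c).const_mul δ
        rw [mul_one] at h2
        exact ((hB' x (hmem x hx)).sub_const (B c)).fun_add h2
      exact h1.hasDerivWithinAt
    · intro x hx _
      linarith
  have hne : (𝓝[Ioo a b] a).NeBot := left_nhdsWithin_Ioo_neBot hab
  have ha : a ∈ Icc a b := left_mem_Icc.2 hab.le
  have t1 : Tendsto (fun c => ‖f b - f c‖) (𝓝[Ioo a b] a) (𝓝 ‖f b - f a‖) :=
    (tendsto_const_nhds.sub ((hf a ha).mono_left (nhdsWithin_mono _ Ioo_subset_Icc_self))).norm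
  have t2 : Tendsto (fun c => B b - B c) (𝓝[Ioo a b] a) (𝓝 (B b - B a)) :=
    tendsto_const_nhds.sub ((hB a ha).mono_left (nhdsWithin_mono _ Ioo_subset_Icc_self))
  exact le_of_tendsto_of_tendsto t1 t2 (eventually_mem_nhdsWithin.mono step)

/-- Between two points where a continuous function is nonpositive, a point where it is positive lies
in an interval of positivity bounded by two zeros. -/
theorem exists_Ioo_pos_of_pos {f : ℝ → ℝ} {a b r : ℝ} (hf : ContinuousOn f (Icc a b))
    (hr : r ∈ Icc a b) (ha : f a ≤ 0) (hb : f b ≤ 0) (hpos : 0 < f r) :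
    ∃ s t, a ≤ s ∧ s < r ∧ r < t ∧ t ≤ b ∧ f s = 0 ∧ f t = 0 ∧ ∀ x ∈ Ioo s t, 0 < f x := by
  have left : ∃ s, a ≤ s ∧ s < r ∧ f s = 0 ∧ ∀ x ∈ Ioc s r, 0 < f x := by
    have hcont : ContinuousOn f (Icc a r) := hf.mono (Icc_subset_Icc_right hr.2)
    have hZ : IsCompact (Icc a r ∩ f ⁻¹' {0}) :=
      isCompact_Icc.of_isClosed_subset (hcont.preimage_isClosed_of_isClosed isClosed_Icc
        isClosed_singleton) inter_subset_left
    obtain ⟨z, hz, hz0⟩ := intermediate_value_Icc hr.1 hcont ⟨ha, hpos.le⟩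
    obtain ⟨s, ⟨hs, hs0⟩, hmax⟩ := hZ.exists_isGreatest ⟨z, hz, hz0⟩
    simp only [mem_preimage, mem_singleton_iff] at hs0
    refine ⟨s, hs.1, lt_of_le_of_ne hs.2 (by rintro rfl; linarith), hs0, fun x hx => ?_⟩
    by_contra hle
    obtain ⟨w, hw, hw0⟩ := intermediate_value_Icc hx.2
      (hcont.mono (Icc_subset_Icc_left (hs.1.trans hx.1.le))) ⟨not_lt.1 hle, hpos.le⟩
    have := hmax ⟨⟨(hs.1.trans hx.1.le).trans hw.1, hw.2⟩, hw0⟩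
    linarith [hx.1, hw.1]
  have right : ∃ t, r < t ∧ t ≤ b ∧ f t = 0 ∧ ∀ x ∈ Ico r t, 0 < f x := by
    have hcont : ContinuousOn f (Icc r b) := hf.mono (Icc_subset_Icc_left hr.1)
    have hZ : IsCompact (Icc r b ∩ f ⁻¹' {0}) :=
      isCompact_Icc.of_isClosed_subset (hcont.preimage_isClosed_of_isClosed isClosed_Icc
        isClosed_singleton) inter_subset_left
    obtain ⟨z, hz, hz0⟩ := intermediate_value_Icc' hr.2 hcont ⟨hb, hpos.le⟩
    obtain ⟨s, ⟨hs, hs0⟩, hmin⟩ := hZ.exists_isLeast ⟨z, hz, hz0⟩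
    simp only [mem_preimage, mem_singleton_iff] at hs0
    refine ⟨s, lt_of_le_of_ne hs.1 (by rintro rfl; linarith), hs.2, hs0, fun x hx => ?_⟩
    by_contra hle
    obtain ⟨w, hw, hw0⟩ := intermediate_value_Icc' hx.1
      (hcont.mono (Icc_subset_Icc_right (hx.2.le.trans hs.2))) ⟨not_lt.1 hle, hpos.le⟩
    have := hmin ⟨⟨hw.1, hw.2.trans (hx.2.le.trans hs.2)⟩, hw0⟩
    linarith [hx.2, hw.2]
  obtain ⟨s, h1, h2, h3, h4⟩ := left
  obtain ⟨t, h5, h6, h7, h8⟩ := right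
  refine ⟨s, t, h1, h2, h5, h6, h3, h7, fun x hx => ?_⟩
  rcases le_total x r with h | h
  · exact h4 x ⟨hx.1, h⟩
  · exact h8 x ⟨h, hx.2⟩

/-- `f` is `K`-Lipschitz on `J`. -/
def LipOn (f : ℝ → ℝ) (K : ℝ) (J : Set ℝ) : Prop :=
  ∀ x ∈ J, ∀ y ∈ J, x ≤ y → |f y - f x| ≤ K * (y - x)

theorem LipOn.mono {f : ℝ → ℝ} {K K' : ℝ} {J J' : Set ℝ} (h : LipOn f K J) (hK : K ≤ K')
    (hJ : J' ⊆ J) : LipOn f K' J' := fun x hx y hy hxy =>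
  (h x (hJ hx) y (hJ hy) hxy).trans (mul_le_mul_of_nonneg_right hK (sub_nonneg.2 hxy))

theorem LipOn.congr {f g : ℝ → ℝ} {K : ℝ} {J : Set ℝ} (h : LipOn f K J) (hfg : EqOn f g J) :
    LipOn g K J := fun x hx y hy hxy => by
  rw [← hfg hx, ← hfg hy]
  exact h x hx y hy hxy

theorem LipOn.abs_sub_le {f : ℝ → ℝ} {K : ℝ} {J : Set ℝ} (h : LipOn f K J) {x y : ℝ} (hx : x ∈ J)
    (hy : y ∈ J) : |f x - f y| ≤ K * |x - y| := by
  rcases le_total x y with hxy | hxy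
  · rw [abs_sub_comm, abs_sub_comm x, abs_of_nonneg (sub_nonneg.2 hxy)]
    exact h x hx y hy hxy
  · rw [abs_of_nonneg (sub_nonneg.2 hxy)]
    exact h y hy x hx hxy

theorem LipOn.continuousOn {f : ℝ → ℝ} {K : ℝ} {J : Set ℝ} (h : LipOn f K J) :
    ContinuousOn f J := by
  refine (LipschitzOnWith.of_dist_le_mul (K := Real.toNNReal K) fun x hx y hy => ?_).continuousOn
  rw [Real.dist_eq, Real.dist_eq]
  exact (h.abs_sub_le hx hy).trans (by gcongr; exact Real.le_coe_toNNReal K)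

theorem LipOn.union {f : ℝ → ℝ} {K : ℝ} {J : Set ℝ} [hJ : OrdConnected J] (s : ℝ)
    (h₁ : LipOn f K (J ∩ Iic s)) (h₂ : LipOn f K (J ∩ Ici s)) : LipOn f K J := by
  intro x hx y hy hxy
  rcases le_total y s with hys | hys
  · exact h₁ x ⟨hx, hxy.trans hys⟩ y ⟨hy, hys⟩ hxy
  rcases le_total s x with hsx | hsx
  · exact h₂ x ⟨hx, hsx⟩ y ⟨hy, hsx.trans hxy⟩ hxy
  have hs : s ∈ J := hJ.out hx hy ⟨hsx, hys⟩
  have e1 := h₁ x ⟨hx, hsx⟩ s ⟨hs, self_mem_Iic⟩ hsx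
  have e2 := h₂ s ⟨hs, self_mem_Ici⟩ y ⟨hy, hys⟩ hys
  calc |f y - f x| = |(f y - f s) + (f s - f x)| := by congr 1; ring
    _ ≤ |f y - f s| + |f s - f x| := abs_add_le _ _
    _ ≤ K * (y - x) := by linarith

/-- The continuous function `G` bounds on `[s, t]` the local Lipschitz constant of the radial map
with profile `φ`: both the local slope of `φ` and the angular stretching `a |φ r| / r` are at most
`G`. -/
structure HasSlopeBound (a : ℝ) (φ G : ℝ → ℝ) (s t : ℝ) : Prop where
  continuousOn : ContinuousOn G (Icc s t)
  angular : ∀ x ∈ Icc s t, a * |φ x| ≤ G x * x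
  lipOn : ∀ x ∈ Icc s t, ∀ y ∈ Icc s t, ∀ K, (∀ z ∈ Icc x y, G z ≤ K) → LipOn φ K (Icc x y)

namespace HasSlopeBound

variable {a s t m : ℝ} {φ ψ G H : ℝ → ℝ}

theorem mono (h : HasSlopeBound a φ G s t) {s' t' : ℝ} (hs : s ≤ s') (ht : t' ≤ t) :
    HasSlopeBound a φ G s' t' :=
  ⟨h.continuousOn.mono (Icc_subset_Icc hs ht), fun x hx => h.angular x (Icc_subset_Icc hs ht hx),
    fun x hx y hy => h.lipOn x (Icc_subset_Icc hs ht hx) y (Icc_subset_Icc hs ht hy)⟩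

theorem congr (h : HasSlopeBound a φ G s t) (h₁ : EqOn φ ψ (Icc s t)) (h₂ : EqOn G H (Icc s t)) :
    HasSlopeBound a ψ H s t where
  continuousOn := h.continuousOn.congr h₂.symm
  angular x hx := by rw [← h₁ hx, ← h₂ hx]; exact h.angular x hx
  lipOn x hx y hy K hK := by
    have hsub : Icc x y ⊆ Icc s t := Icc_subset_Icc hx.1 hy.2
    exact (h.lipOn x hx y hy K fun z hz => by rw [h₂ (hsub hz)]; exact hK z hz).congr
      (h₁.mono hsub)

theorem union (h₁ : HasSlopeBound a φ G s m) (h₂ : HasSlopeBound a φ G m t) (hsm : s ≤ m)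
    (hmt : m ≤ t) : HasSlopeBound a φ G s t where
  continuousOn := by
    rw [← Icc_union_Icc_eq_Icc hsm hmt]
    exact h₁.continuousOn.union_of_isClosed h₂.continuousOn isClosed_Icc isClosed_Icc
  angular x hx := by
    rcases le_total x m with h | h
    · exact h₁.angular x ⟨hx.1, h⟩
    · exact h₂.angular x ⟨h, hx.2⟩
  lipOn x hx y hy K hK := by
    rcases le_total y m with hym | hym
    · intro z hz w hw hzw
      have hxy : x ≤ y := hz.1.trans hz.2
      exact h₁.lipOn x ⟨hx.1, hxy.trans hym⟩ y ⟨hy.1, hym⟩ K hK z hz w hw hzw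
    rcases le_total m x with hmx | hmx
    · intro z hz w hw hzw
      have hxy : x ≤ y := hz.1.trans hz.2
      exact h₂.lipOn x ⟨hmx, hx.2⟩ y ⟨hmx.trans hxy, hy.2⟩ K hK z hz w hw hzw
    refine LipOn.union m ?_ ?_
    · refine (h₁.lipOn x ⟨hx.1, hmx⟩ m ⟨hsm, le_rfl⟩ K
        fun z hz => hK z ⟨hz.1, hz.2.trans hym⟩).mono le_rfl ?_
      exact fun z hz => ⟨hz.1.1, hz.2⟩
    · refine (h₂.lipOn m ⟨le_rfl, hmt⟩ y ⟨hym, hy.2⟩ K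
        fun z hz => hK z ⟨hmx.trans hz.1, hz.2⟩).mono le_rfl ?_
      exact fun z hz => ⟨hz.2, hz.1.2⟩

theorem abs (h : HasSlopeBound a φ G s t) : HasSlopeBound a (fun x => |φ x|) G s t where
  continuousOn := h.continuousOn
  angular x hx := by rw [abs_abs]; exact h.angular x hx
  lipOn x hx y hy K hK z hz w hw hzw :=
    (abs_abs_sub_abs_le _ _).trans (h.lipOn x hx y hy K hK z hz w hw hzw)

theorem sup (hs : 0 ≤ s) (h₁ : HasSlopeBound a φ G s t) (h₂ : HasSlopeBound a ψ H s t) :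
    HasSlopeBound a (fun x => max (φ x) (ψ x)) (fun x => max (G x) (H x)) s t where
  continuousOn := ContinuousOn.sup h₁.continuousOn h₂.continuousOn
  angular x hx := by
    have hx0 : 0 ≤ x := hs.trans hx.1
    rcases max_choice (φ x) (ψ x) with h | h <;> rw [h]
    · exact (h₁.angular x hx).trans (by gcongr; exact le_max_left _ _)
    · exact (h₂.angular x hx).trans (by gcongr; exact le_max_right _ _)
  lipOn x hx y hy K hK z hz w hw hzw :=
    (abs_max_sub_max_le_max _ _ _ _).trans (max_le
      (h₁.lipOn x hx y hy K (fun z hz => (le_max_left _ _).trans (hK z hz)) z hz w hw hzw)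
      (h₂.lipOn x hx y hy K (fun z hz => (le_max_right _ _).trans (hK z hz)) z hz w hw hzw))

theorem exists_bound (h : HasSlopeBound a φ G s t) (hs : 0 ≤ s) : ∃ K, 0 ≤ K ∧ LipOn φ K (Icc s t) ∧
    ∀ x ∈ Icc s t, a * |φ x| ≤ K * x := by
  obtain ⟨K, hK⟩ := isCompact_Icc.bddAbove_image h.continuousOn
  refine ⟨max K 0, le_max_right _ _, ?_, fun x hx => ?_⟩
  · intro x hx y hy hxy
    have hst : s ≤ t := hx.1.trans hx.2
    exact h.lipOn s (left_mem_Icc.2 hst) t (right_mem_Icc.2 hst) _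
      (fun z hz => (hK (mem_image_of_mem G hz)).trans (le_max_left _ _)) x hx y hy hxy
  · refine (h.angular x hx).trans ?_
    have : G x ≤ max K 0 := (hK (mem_image_of_mem G hx)).trans (le_max_left _ _)
    have hx0 : 0 ≤ x := hs.trans hx.1
    gcongr

/-- Near a point `r`, bounds by any constant larger than `G r` hold. -/
theorem exists_near (h : HasSlopeBound a φ G s t) (hs : 0 ≤ s) {r K : ℝ} (hr : r ∈ Icc s t)
    (hK : G r < K) : ∃ ε > 0, LipOn φ K (Ioo (r - ε) (r + ε) ∩ Icc s t) ∧
      ∀ x ∈ Ioo (r - ε) (r + ε) ∩ Icc s t, a * |φ x| ≤ K * x := by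
  obtain ⟨ε, hε, hsub⟩ := Metric.mem_nhdsWithin_iff.1
    ((h.continuousOn r hr).eventually (gt_mem_nhds hK))
  rw [Real.ball_eq_Ioo] at hsub
  refine ⟨ε, hε, fun x hx y hy hxy => ?_, fun x hx => ?_⟩
  · refine h.lipOn x hx.2 y hy.2 K (fun z hz => ?_) x ⟨le_rfl, hxy⟩ y ⟨hxy, le_rfl⟩ hxy
    exact (hsub ⟨⟨hx.1.1.trans_le hz.1, hz.2.trans_lt hy.1.2⟩, hx.2.1.trans hz.1,
      hz.2.trans hy.2.2⟩ : G z < K).le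
  · have hx0 : 0 ≤ x := hs.trans hx.2.1
    refine (h.angular x hx.2).trans ?_
    have : G x < K := hsub hx
    gcongr

end HasSlopeBound

namespace ClosedCover

variable {α R₁ R₂ : ℝ}

/-! ### Radial maps -/

/-- `u` is the radial map with profile `φ`, that is `u (r, θ) = ρ (φ r, α θ)`. -/
def HasProfile (u : ClosedCover α R₁ R₂ → ℂ) (φ : ℝ → ℝ) : Prop :=
  ∀ (p : ClosedCover α R₁ R₂) (θ : ℝ), (θ : AddCircle (2 * Real.pi / α)) = p.angle →
    u p = polarMap (φ p.radius) (α * θ)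

theorem HasProfile.apply_ofPolar {u : ClosedCover α R₁ R₂ → ℂ} {φ : ℝ → ℝ} (hu : HasProfile u φ)
    {r : ℝ} (θ : ℝ) (hr : r ∈ Icc R₁ R₂) : u (ofPolar α r θ hr) = polarMap (φ r) (α * θ) :=
  hu _ θ rfl

theorem HasProfile.neg {u : ClosedCover α R₁ R₂ → ℂ} {φ : ℝ → ℝ} (hu : HasProfile u φ) :
    HasProfile (-u) (fun r => -φ r) := fun p θ h => by
  rw [Pi.neg_apply, hu p θ h, polarMap_neg]

theorem HasProfile.eq {u v : ClosedCover α R₁ R₂ → ℂ} {φ ψ : ℝ → ℝ} (hu : HasProfile u φ)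
    (hv : HasProfile v ψ) {p : ClosedCover α R₁ R₂} (h : φ p.radius = ψ p.radius) : u p = v p := by
  obtain ⟨θ, hθ⟩ := exists_angle p
  rw [hu p θ hθ, hv p θ hθ, h]

theorem polarMap_mul_eq_of_coe_eq (hα : α ≠ 0) (x : ℝ) {θ η : ℝ}
    (h : (θ : AddCircle (2 * Real.pi / α)) = η) : polarMap x (α * θ) = polarMap x (α * η) := by
  obtain ⟨n, hn⟩ := AddCircle.coe_eq_zero_iff _ |>.1
    (show ((θ - η : ℝ) : AddCircle (2 * Real.pi / α)) = 0 by rw [AddCircle.coe_sub, h, sub_self])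
  have hθ : α * θ = α * η + n * (2 * Real.pi) := by
    rw [zsmul_eq_mul] at hn
    field_simp at hn
    linarith
  simp [polarMap, hθ, Real.cos_add_int_mul_two_pi, Real.sin_add_int_mul_two_pi]

theorem exists_hasProfile (hα : α ≠ 0) (φ : ℝ → ℝ) :
    ∃ u : ClosedCover α R₁ R₂ → ℂ, HasProfile u φ := by
  choose θ hθ using fun p : ClosedCover α R₁ R₂ => exists_angle p
  exact ⟨fun p => polarMap (φ p.radius) (α * θ p), fun p η hη =>
    polarMap_mul_eq_of_coe_eq hα _ ((hθ p).trans hη.symm)⟩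

/-- A radial map expands a path by a factor at most `K` if `K` bounds the radial slope and the
angular stretching over the radii along the path. -/
theorem HasProfile.edist_le_mul_pathLength (hR₁ : 0 ≤ R₁) {u : ClosedCover α R₁ R₂ → ℂ}
    {φ : ℝ → ℝ} (hu : HasProfile u φ) {I : Set ℝ} {K K' : ℝ} (hK : 0 ≤ K) (hK' : K < K')
    (h₁ : LipOn φ K I) (h₂ : ∀ x ∈ I, |α| * |φ x| ≤ K * x)
    {p q : ClosedCover α R₁ R₂} {γ : ℝ → ℝ × ℝ} (hγ : IsLiftedPath p q γ)
    (hI : ∀ t ∈ Icc (0 : ℝ) 1, (γ t).1 ∈ I) :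
    edist (u p) (u q) ≤ ENNReal.ofReal K' * pathLength γ := by
  obtain ⟨C, hC, hCK⟩ : ∃ C, 1 < C ∧ C * K ≤ K' := by
    refine ⟨1 + (K' - K) / (K + 1), by have := sub_pos.2 hK'; simp; positivity, ?_⟩
    have : (K' - K) / (K + 1) * K ≤ K' - K := by
      rw [div_mul_eq_mul_div, div_le_iff₀ (by positivity)]
      nlinarith
    linarith
  obtain ⟨η, hη, hcos⟩ := exists_one_sub_cos_mul_le α (show 1 < C ^ 2 by nlinarith)
  rw [hu p _ hγ.source_angle, hu q _ hγ.target_angle, ← hγ.source_radius, ← hγ.target_radius]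
  refine ClosedCover.edist_le_mul_pathLength (f := fun z => polarMap (φ z.1) (α * z.2))
    hγ.continuousOn hη fun s hs t ht hst => ?_
  have hst' : |(γ s).2 - (γ t).2| < η := lt_of_le_of_lt (le_max_right _ _) hst
  rw [edist_dist, edist_dist, ← ENNReal.ofReal_mul (hK.trans hK'.le), dist_eq_norm, dist_eq_norm]
  apply ENNReal.ofReal_le_ofReal
  refine (norm_polarMap_sub_le_mul (hR₁.trans (hγ.radius_mem s hs).1)
    (hR₁.trans (hγ.radius_mem t ht).1) hK hC.le (h₁.abs_sub_le (hI s hs) (hI t ht))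
    (h₂ _ (hI s hs)) (h₂ _ (hI t ht)) ?_).trans (by gcongr)
  exact hcos _ hst'

theorem le_mul_geoDist {e : ℝ≥0∞} {K : ℝ} (hK : 0 < K) {p q : ClosedCover α R₁ R₂}
    (h : ∀ γ, IsLiftedPath p q γ → e ≤ ENNReal.ofReal K * pathLength γ) :
    e ≤ ENNReal.ofReal K * geoDist p q := by
  have h0 : ENNReal.ofReal K ≠ 0 := by simpa using hK
  rw [mul_comm, ← ENNReal.div_le_iff h0 ENNReal.ofReal_ne_top]
  refine le_iInf₂ fun γ hγ => ?_
  rw [ENNReal.div_le_iff h0 ENNReal.ofReal_ne_top, mul_comm]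
  exact h γ hγ

theorem HasProfile.isLip (hR₁ : 0 ≤ R₁) {u : ClosedCover α R₁ R₂ → ℂ}
    {φ : ℝ → ℝ} (hu : HasProfile u φ) {K : ℝ} (hK : 0 ≤ K)
    (h₁ : LipOn φ K (Icc R₁ R₂)) (h₂ : ∀ x ∈ Icc R₁ R₂, |α| * |φ x| ≤ K * x) : IsLip u :=
  ⟨Real.toNNReal (K + 1), fun _ _ => le_mul_geoDist (by linarith) fun _ hγ =>
    hu.edist_le_mul_pathLength hR₁ hK (lt_add_one K) h₁ h₂ hγ hγ.radius_mem⟩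

theorem HasProfile.exists_lipOn (hR₁ : 0 ≤ R₁) {u : ClosedCover α R₁ R₂ → ℂ}
    {φ : ℝ → ℝ} (hu : HasProfile u φ) (h : IsLip u) :
    ∃ K, 0 ≤ K ∧ LipOn φ K (Icc R₁ R₂) := by
  obtain ⟨K, hK, H⟩ := h.exists_radial_bound hR₁
  refine ⟨K, hK, fun x hx y hy hxy => ?_⟩
  have := H y x 0 hy hx
  rwa [hu.apply_ofPolar, hu.apply_ofPolar, polarMap_sub, norm_polarMap,
    abs_of_nonneg (sub_nonneg.2 hxy)] at this

theorem HasProfile.localLip_le (hR₁ : 0 ≤ R₁) {u : ClosedCover α R₁ R₂ → ℂ}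
    {φ : ℝ → ℝ} (hu : HasProfile u φ) {p : ClosedCover α R₁ R₂} {K : ℝ} (hK : 0 ≤ K)
    (h : ∀ K' > K, ∃ ε > 0,
      LipOn φ K' (Ioo (p.radius - ε) (p.radius + ε) ∩ Icc R₁ R₂) ∧
      ∀ x ∈ Ioo (p.radius - ε) (p.radius + ε) ∩ Icc R₁ R₂, |α| * |φ x| ≤ K' * x) :
    localLip u p ≤ ENNReal.ofReal K := by
  refine le_of_forall_gt_imp_ge_of_dense fun L hL => ?_
  obtain ⟨K', hKK', hL'⟩ : ∃ K' > K, ENNReal.ofReal K' ≤ L := by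
    rcases eq_or_ne L ⊤ with rfl | hLtop
    · exact ⟨K + 1, by linarith, le_top⟩
    · refine ⟨L.toReal, ?_, ENNReal.ofReal_toReal_le⟩
      exact (ENNReal.ofReal_lt_iff_lt_toReal hK hLtop).1 hL
  refine le_trans ?_ hL'
  obtain ⟨ε, hε, hlip, hang⟩ := h ((K + K') / 2) (by linarith)
  have hm0 : 0 ≤ (K + K') / 2 := by linarith
  have hmK : (K + K') / 2 < K' := by linarith
  have hK'0 : 0 < K' := hK.trans_lt hKK'
  -- Paths shorter than `ε / 2` between points of the ball of radius `ε / 4` stay in the annulus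
  -- where the bounds hold; for longer paths the bound follows through the centre of the ball.
  have center : ∀ q : ClosedCover α R₁ R₂, geoDist p q < ENNReal.ofReal (ε / 4) →
      edist (u p) (u q) ≤ ENNReal.ofReal K' * ENNReal.ofReal (ε / 4) := by
    intro q hq
    simp only [geoDist, iInf_lt_iff] at hq
    obtain ⟨γ, hγ, hlen⟩ := hq
    refine (hu.edist_le_mul_pathLength hR₁ hm0 hmK hlip hang hγ fun t ht => ?_).trans (by gcongr)
    have h1 := (hγ.abs_radius_sub_le hR₁ ht).trans_lt hlen
    rw [ENNReal.ofReal_lt_ofReal_iff (by positivity), abs_lt] at h1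
    exact ⟨⟨by linarith, by linarith⟩, hγ.radius_mem t ht⟩
  refine localLip_le_of_forall (ε := ε / 4) (by positivity) fun q _ hq q' _ hq' => ?_
  refine le_mul_geoDist hK'0 fun γ hγ => ?_
  rcases lt_or_ge (pathLength γ) (ENNReal.ofReal (ε / 2)) with hlen | hlen
  · refine hu.edist_le_mul_pathLength hR₁ hm0 hmK hlip hang hγ fun t ht => ?_
    have h1 := (hγ.abs_radius_sub_le hR₁ ht).trans_lt hlen
    rw [ENNReal.ofReal_lt_ofReal_iff (by positivity), abs_lt] at h1
    have h2 := abs_lt.1 (abs_radius_sub_lt_of_geoDist_lt hR₁ (by positivity) hq)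
    exact ⟨⟨by linarith, by linarith⟩, hγ.radius_mem t ht⟩
  · calc edist (u q) (u q') ≤ edist (u p) (u q) + edist (u p) (u q') := edist_triangle_left _ _ _
      _ ≤ ENNReal.ofReal K' * ENNReal.ofReal (ε / 4)
          + ENNReal.ofReal K' * ENNReal.ofReal (ε / 4) := add_le_add (center q hq) (center q' hq')
      _ = ENNReal.ofReal K' * ENNReal.ofReal (ε / 2) := by
        rw [← mul_add, ← ENNReal.ofReal_add (by positivity) (by positivity)]
        congr 2
        ring
      _ ≤ _ := by gcongr

theorem HasProfile.localLip_le_of_hasSlopeBound (hR₁ : 0 ≤ R₁) {u : ClosedCover α R₁ R₂ → ℂ}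
    {φ G : ℝ → ℝ} (hu : HasProfile u φ) {s t : ℝ} (hs : R₁ ≤ s)
    (h : HasSlopeBound |α| φ G s t) {p : ClosedCover α R₁ R₂} (hp : p.radius ∈ Ioo s t) :
    localLip u p ≤ ENNReal.ofReal (G p.radius) := by
  have hp0 : 0 < p.radius := (hR₁.trans hs).trans_lt hp.1
  have hG : 0 ≤ G p.radius := by
    have := h.angular _ (Ioo_subset_Icc_self hp)
    exact nonneg_of_mul_nonneg_left (le_trans (by positivity) this) hp0
  refine hu.localLip_le hR₁ hG fun K' hK' => ?_
  obtain ⟨ε, hε, h1, h2⟩ := h.exists_near (hR₁.trans hs) (Ioo_subset_Icc_self hp) hK'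
  obtain ⟨δ, hδ, hδε, h3, h4⟩ : ∃ δ > 0, δ ≤ ε ∧ δ ≤ p.radius - s ∧ δ ≤ t - p.radius :=
    ⟨min ε (min (p.radius - s) (t - p.radius)),
      lt_min hε (lt_min (sub_pos.2 hp.1) (sub_pos.2 hp.2)), min_le_left _ _,
      (min_le_right _ _).trans (min_le_left _ _), (min_le_right _ _).trans (min_le_right _ _)⟩
  have hsub : Ioo (p.radius - δ) (p.radius + δ) ∩ Icc R₁ R₂
      ⊆ Ioo (p.radius - ε) (p.radius + ε) ∩ Icc s t := fun x hx =>
    ⟨⟨by linarith [hx.1.1], by linarith [hx.1.2]⟩, by linarith [hx.1.1], by linarith [hx.1.2]⟩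
  exact ⟨δ, hδ, h1.mono le_rfl hsub, fun x hx => h2 x (hsub hx)⟩

/-- The angular stretching bounds the local Lipschitz constant from below. -/
theorem HasProfile.le_localLip (hR₁ : 0 ≤ R₁) {u : ClosedCover α R₁ R₂ → ℂ} (hα : α ≠ 0)
    {φ : ℝ → ℝ} (hu : HasProfile u φ) {p : ClosedCover α R₁ R₂}
    (hp : p ∈ interiorPart α R₁ R₂) :
    ENNReal.ofReal (|α| * |φ p.radius| / p.radius) ≤ localLip u p := by
  by_contra! hlt
  have hr0 : 0 < p.radius := hR₁.trans_lt hp.1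
  obtain ⟨θ, hθ⟩ := exists_eq_ofPolar p
  set r := p.radius with hr
  -- choose `K` strictly between the local Lipschitz constant and the angular stretching
  obtain ⟨K, h0, h1, h2⟩ : ∃ K : ℝ, 0 ≤ K ∧ localLip u p < ENNReal.ofReal K
      ∧ K < |α| * |φ r| / r := by
    obtain ⟨L, hL1, hL2⟩ := exists_between hlt
    have hLtop : L ≠ ⊤ := ne_top_of_lt hL2
    refine ⟨L.toReal, ENNReal.toReal_nonneg, by rwa [ENNReal.ofReal_toReal hLtop], ?_⟩
    exact (ENNReal.lt_ofReal_iff_toReal_lt hLtop).1 hL2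
  rw [lt_div_iff₀ hr0] at h2
  have hp' : r ∈ Ioo R₁ R₂ := hp
  rw [hθ] at h1
  obtain ⟨ε, hε, hbound⟩ := circle_bound_of_localLip_lt hR₁ hp' h0 h1
  have hφ : 0 < |α| * |φ r| := lt_of_le_of_lt (by positivity) h2
  obtain ⟨C, hC, hCK⟩ : ∃ C, 1 < C ∧ C * (K * r) ^ 2 < (|α| * |φ r|) ^ 2 := by
    have h3 : (K * r) ^ 2 < (|α| * |φ r|) ^ 2 := by gcongr
    have h4 : Tendsto (fun C : ℝ => C * (K * r) ^ 2) (𝓝[>] 1) (𝓝 (1 * (K * r) ^ 2)) :=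
      ((continuous_id.mul continuous_const).tendsto _).mono_left nhdsWithin_le_nhds
    rw [one_mul] at h4
    obtain ⟨C, hC⟩ := ((h4.eventually (gt_mem_nhds h3)).and self_mem_nhdsWithin).exists
    exact ⟨C, hC.2, hC.1⟩
  obtain ⟨η, hη, hcos⟩ := exists_sq_le_mul_one_sub_cos hC
  obtain ⟨h, hh0, hh1, hh2⟩ : ∃ h > 0, h < ε ∧ |α| * h < η := by
    have hα' : 0 < |α| := abs_pos.2 hα
    refine ⟨min (ε / 2) (η / (2 * |α|)), by positivity, (min_le_left _ _).trans_lt (by linarith), ?_⟩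
    calc |α| * min (ε / 2) (η / (2 * |α|)) ≤ |α| * (η / (2 * |α|)) := by
          gcongr; exact min_le_right _ _
      _ = η / 2 := by field_simp
      _ < η := by linarith
  have hb := hbound (θ + h) (by rwa [add_sub_cancel_left, abs_of_pos hh0])
  rw [hu.apply_ofPolar, hu.apply_ofPolar, add_sub_cancel_left, abs_of_pos hh0] at hb
  have hb2 : ‖polarMap (φ r) (α * (θ + h)) - polarMap (φ r) (α * θ)‖ ^ 2 ≤ (K * (r * h)) ^ 2 := by
    gcongr
  rw [norm_polarMap_sub_sq, sub_self, show α * (θ + h) - α * θ = α * h by ring] at hb2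
  have hc := hcos (α * h) (by rwa [abs_mul, abs_of_pos hh0])
  have h5 : (|α| * |φ r|) ^ 2 * h ^ 2 ≤ C * (K * r) ^ 2 * h ^ 2 := by
    rw [mul_pow, sq_abs, sq_abs]
    nlinarith [mul_le_mul_of_nonneg_left hc (sq_nonneg (φ r))]
  have h6 : C * (K * r) ^ 2 * h ^ 2 < (|α| * |φ r|) ^ 2 * h ^ 2 := by gcongr
  linarith

theorem HasProfile.lipOn_of_localLip_lt (hR₁ : 0 ≤ R₁) {u : ClosedCover α R₁ R₂ → ℂ}
    {φ : ℝ → ℝ} (hu : HasProfile u φ) {p : ClosedCover α R₁ R₂}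
    (hp : p ∈ interiorPart α R₁ R₂) {K : ℝ} (hK : 0 ≤ K) (h : localLip u p < ENNReal.ofReal K) :
    ∃ ε > 0, Ioo (p.radius - ε) (p.radius + ε) ⊆ Ioo R₁ R₂ ∧
      LipOn φ K (Ioo (p.radius - ε) (p.radius + ε)) := by
  obtain ⟨θ, hθ⟩ := exists_eq_ofPolar p
  set r := p.radius with hr
  have hp' : r ∈ Ioo R₁ R₂ := hp
  rw [hθ] at h
  obtain ⟨ε, hε, H⟩ := radial_bound_of_localLip_lt hR₁ hp' hK h
  refine ⟨min ε (min (r - R₁) (R₂ - r)),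
    lt_min hε (lt_min (sub_pos.2 hp'.1) (sub_pos.2 hp'.2)), ?_⟩
  have e1 := min_le_left ε (min (r - R₁) (R₂ - r))
  have e2 := (min_le_right ε (min (r - R₁) (R₂ - r))).trans (min_le_left _ _)
  have e3 := (min_le_right ε (min (r - R₁) (R₂ - r))).trans (min_le_right _ _)
  have hsub : Ioo (r - min ε (min (r - R₁) (R₂ - r))) (r + min ε (min (r - R₁) (R₂ - r)))
      ⊆ Ioo R₁ R₂ := fun x hx => ⟨by linarith [hx.1], by linarith [hx.2]⟩
  refine ⟨hsub, fun x hx y hy hxy => ?_⟩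
  have := H y (hsub hy) (abs_lt.2 ⟨by linarith [hy.1], by linarith [hy.2]⟩) x (hsub hx)
    (abs_lt.2 ⟨by linarith [hx.1], by linarith [hx.2]⟩)
  rwa [hu.apply_ofPolar, hu.apply_ofPolar, polarMap_sub, norm_polarMap,
    abs_of_nonneg (sub_nonneg.2 hxy)] at this

end ClosedCover

namespace ClosedCover

variable {α R₁ R₂ : ℝ}

/-! ### Consequences of tightness for a radial map -/

theorem IsLip.neg {u : ClosedCover α R₁ R₂ → ℂ} (h : IsLip u) : IsLip (-u) := by
  obtain ⟨K, hK⟩ := h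
  exact ⟨K, fun p q => by rw [Pi.neg_apply, Pi.neg_apply, edist_neg_neg]; exact hK p q⟩

theorem IsTight.neg {u : ClosedCover α R₁ R₂ → ℂ} (h : IsTight u) : IsTight (-u) := by
  refine ⟨h.1.neg, fun ⟨v, hv⟩ => h.2 ⟨-v, hv.lip_left.neg, h.1, fun p hp => ?_, ?_⟩⟩
  · rw [Pi.neg_apply, hv.eqOn_boundary hp, Pi.neg_apply, neg_neg]
  · simpa only [localLip_neg] using hv.sup_lt_sup

/-- The replacement principle: replacing the profile `ψ` of a tight radial map on `[t₁, t₂]` by `η`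
cannot make it tighter. The local Lipschitz constant can increase only where the bound `G` for `η`
exceeds the angular stretching of `ψ`, and there `G` is at most `S`; so no point can have its local
Lipschitz constant lowered from a value larger than `S`. -/
theorem IsTight.localLip_le_of_replacement (hR : 0 < R₁) (hα : α ≠ 0)
    {u : ClosedCover α R₁ R₂ → ℂ} (ht : IsTight u) {ψ : ℝ → ℝ} (hu : HasProfile u ψ)
    {t₁ t₂ : ℝ} (h₁ : R₁ ≤ t₁) (h₁₂ : t₁ < t₂) (h₂ : t₂ ≤ R₂) {η G : ℝ → ℝ}
    (hη : HasSlopeBound |α| η G t₁ t₂) (e₁ : η t₁ = ψ t₁) (e₂ : η t₂ = ψ t₂) {S : ℝ}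
    (hS : ∀ r ∈ Icc t₁ t₂, G r ≤ S ∨ G r * r ≤ |α| * |ψ r|)
    {p : ClosedCover α R₁ R₂} (hp : p.radius ∈ Ioo t₁ t₂) :
    localLip u p ≤ ENNReal.ofReal (max (G p.radius) S) := by
  have hR₁ : 0 ≤ R₁ := hR.le
  have ht₁ : 0 ≤ t₁ := hR₁.trans h₁
  set φ : ℝ → ℝ := fun x => if x ∈ Icc t₁ t₂ then η x else ψ x with hφ
  have φ_in : EqOn η φ (Icc t₁ t₂) := fun x hx => by simp only [hφ, if_pos hx]
  have φ_left : EqOn ψ φ (Iic t₁) := fun x hx => by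
    by_cases h : x ∈ Icc t₁ t₂
    · rw [le_antisymm hx h.1, ← e₁]; exact φ_in (left_mem_Icc.2 h₁₂.le)
    · simp only [hφ, if_neg h]
  have φ_right : EqOn ψ φ (Ici t₂) := fun x hx => by
    by_cases h : x ∈ Icc t₁ t₂
    · rw [le_antisymm h.2 hx, ← e₂]; exact φ_in (right_mem_Icc.2 h₁₂.le)
    · simp only [hφ, if_neg h]
  obtain ⟨v, hv⟩ := exists_hasProfile (R₁ := R₁) (R₂ := R₂) hα φ
  -- gluing of Lipschitz bounds
  have glue : ∀ (K : ℝ) (J : Set ℝ) [OrdConnected J], LipOn ψ K J → LipOn η K (J ∩ Icc t₁ t₂) →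
      LipOn φ K J := by
    intro K J hJ hl hm
    refine LipOn.union t₁ ((hl.mono le_rfl inter_subset_left).congr
      (φ_left.mono inter_subset_right)) (LipOn.union t₂ ?_ ?_)
    · have hsub : J ∩ Ici t₁ ∩ Iic t₂ ⊆ J ∩ Icc t₁ t₂ := fun x hx => ⟨hx.1.1, hx.1.2, hx.2⟩
      exact (hm.mono le_rfl hsub).congr (φ_in.mono (hsub.trans inter_subset_right))
    · exact (hl.mono le_rfl fun x hx => hx.1.1).congr (φ_right.mono inter_subset_right)
  have hφ' : HasSlopeBound |α| φ G t₁ t₂ := hη.congr φ_in fun x _ => rfl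
  -- the new map is Lipschitz
  have hvlip : IsLip v := by
    obtain ⟨K, hK, hKl⟩ := hu.exists_lipOn hR₁ ht.1
    obtain ⟨L, hL, hLl, -⟩ := hη.exists_bound ht₁
    have hl : LipOn φ (max K L) (Icc R₁ R₂) :=
      glue _ _ (hKl.mono (le_max_left _ _) Subset.rfl)
        (hLl.mono (le_max_right _ _) inter_subset_right)
    obtain ⟨B, hB⟩ := isCompact_Icc.exists_bound_of_continuousOn hl.continuousOn
    refine hv.isLip hR₁ (K := max (max K L) (|α| * B / R₁)) (le_max_of_le_left (le_max_of_le_left hK))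
      (hl.mono (le_max_left _ _) Subset.rfl) fun x hx => ?_
    have hB0 : 0 ≤ B := (norm_nonneg _).trans (hB x hx)
    calc |α| * |φ x| ≤ |α| * B := by gcongr; exact hB x hx
      _ = |α| * B / R₁ * R₁ := by field_simp
      _ ≤ max (max K L) (|α| * B / R₁) * x := by
        gcongr
        · exact le_max_right _ _
        · exact hx.1
  have hout : ∀ q : ClosedCover α R₁ R₂, q.radius ∉ Icc t₁ t₂ → localLip v q = localLip u q := by
    intro q hq
    rw [mem_Icc, not_and_or, not_le, not_le] at hq
    rcases hq with hq | hq
    · refine localLip_congr hR₁ (sub_pos.2 hq) fun q' hq' => (hu.eq hv (φ_left ?_)).symm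
      have := (abs_lt.1 hq').2
      exact mem_Iic.2 (by linarith)
    · refine localLip_congr hR₁ (sub_pos.2 hq) fun q' hq' => (hu.eq hv (φ_right ?_)).symm
      have := (abs_lt.1 hq').1
      exact mem_Ici.2 (by linarith)
  have hin : ∀ q ∈ interiorPart α R₁ R₂, q.radius ∈ Icc t₁ t₂ →
      localLip v q ≤ max (localLip u q) (ENNReal.ofReal (G q.radius)) := by
    intro q hq hqt
    have hq0 : 0 < q.radius := hR₁.trans_lt hq.1
    have hG : 0 ≤ G q.radius := by
      exact nonneg_of_mul_nonneg_left (le_trans (by positivity) (hη.angular _ hqt)) hq0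
    refine le_of_forall_gt_imp_ge_of_dense fun L hL => ?_
    rcases eq_or_ne L ⊤ with rfl | hLtop
    · exact le_top
    obtain ⟨hL1, hL2⟩ := max_lt_iff.1 hL
    lift L to ℝ≥0 using hLtop
    have hL0 : (L : ℝ≥0∞) = ENNReal.ofReal L := by simp
    rw [hL0] at hL1 hL2 ⊢
    refine hv.localLip_le hR₁ L.2 fun K' hK' => ?_
    rw [ENNReal.ofReal_lt_ofReal_iff_of_nonneg hG] at hL2
    obtain ⟨ε, hε, hsub, hlip⟩ := hu.lipOn_of_localLip_lt hR₁ hq L.2 hL1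
    obtain ⟨δ, hδ, hδ1, hδ2⟩ := hη.exists_near ht₁ hqt hL2
    have hang : |α| * |ψ q.radius| < L * q.radius := by
      have := (hu.le_localLip hR₁ hα hq).trans_lt hL1
      rwa [ENNReal.ofReal_lt_ofReal_iff_of_nonneg (by positivity), div_lt_iff₀ hq0] at this
    have hcont : ContinuousAt ψ q.radius := hlip.continuousOn.continuousAt
      (Ioo_mem_nhds (by linarith) (by linarith))
    obtain ⟨ζ, hζ, hζs⟩ := Metric.mem_nhds_iff.1
      ((((continuousAt_const (y := |α|)).mul hcont.abs).sub
        ((continuousAt_const (y := (L : ℝ))).mul continuousAt_id)).eventually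
          (gt_mem_nhds (show |α| * |ψ q.radius| - L * q.radius < 0 by linarith)))
    rw [Real.ball_eq_Ioo] at hζs
    refine ⟨min ε (min δ ζ), lt_min hε (lt_min hδ hζ), ?_, ?_⟩
    all_goals
      have m1 := min_le_left ε (min δ ζ)
      have m2 := (min_le_right ε (min δ ζ)).trans (min_le_left _ _)
      have m3 := (min_le_right ε (min δ ζ)).trans (min_le_right _ _)
    · refine (glue L (Ioo (q.radius - min ε (min δ ζ)) (q.radius + min ε (min δ ζ)))
        (hlip.mono le_rfl ?_) (hδ1.mono le_rfl ?_)).mono hK'.le inter_subset_left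
      · exact Ioo_subset_Ioo (by linarith) (by linarith)
      · exact inter_subset_inter_left _ (Ioo_subset_Ioo (by linarith) (by linarith))
    · intro x hx
      have hx0 : 0 ≤ x := hR₁.trans hx.2.1
      refine le_trans ?_ (mul_le_mul_of_nonneg_right hK'.le hx0)
      by_cases h : x ∈ Icc t₁ t₂
      · rw [← φ_in h]
        exact hδ2 x ⟨⟨by linarith [hx.1.1], by linarith [hx.1.2]⟩, h⟩
      · have h1 : |α| * |ψ x| - L * x < 0 :=
          hζs ⟨by linarith [hx.1.1], by linarith [hx.1.2]⟩
        simp only [hφ, if_neg h]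
        linarith
  by_contra! hlt
  have hmax : max (ENNReal.ofReal (G p.radius)) (ENNReal.ofReal S) < localLip u p := by
    rwa [← ENNReal.ofReal_max]
  have hpint : p ∈ interiorPart α R₁ R₂ := ⟨h₁.trans_lt hp.1, hp.2.trans_le h₂⟩
  refine ht.2 ⟨v, hvlip, ht.1, fun q hq => (hu.eq hv ?_).symm, lt_of_le_of_lt (b := ENNReal.ofReal S)
    (iSup₂_le fun q hq => ?_) ?_⟩
  · rcases hq with hq | hq
    · exact φ_left (by rw [hq]; exact h₁)
    · exact φ_right (by rw [hq]; exact h₂)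
  · obtain ⟨hqi, hqlt⟩ := hq
    by_cases hqt : q.radius ∈ Icc t₁ t₂
    · have h3 := hin q hqi hqt
      have h4 : localLip v q ≤ ENNReal.ofReal (G q.radius) := by
        rcases le_max_iff.1 h3 with h | h
        · exact absurd hqlt (not_lt.2 h)
        · exact h
      rcases hS _ hqt with h | h
      · exact h4.trans (ENNReal.ofReal_le_ofReal h)
      · have hq0 : 0 < q.radius := hR₁.trans_lt hqi.1
        have h5 : ENNReal.ofReal (G q.radius) ≤ localLip u q :=
          (ENNReal.ofReal_le_ofReal ((le_div_iff₀ hq0).2 h)).trans (hu.le_localLip hR₁ hα hqi)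
        exact absurd (hqlt.trans_le h4) (not_lt.2 h5)
    · rw [hout q hqt] at hqlt
      exact absurd hqlt (lt_irrefl _)
  · refine ((le_max_right _ _).trans_lt hmax).trans_le ?_
    refine le_iSup₂_of_le p ⟨hpint, ?_⟩ le_rfl
    exact (hv.localLip_le_of_hasSlopeBound hR₁ h₁ hφ' hp).trans_lt
      ((le_max_left _ _).trans_lt hmax)

end ClosedCover

/-! ### The chord rule and comparison from below -/

/-- A segment along which the slope dominates the angular stretching at both ends. The quantity
`a |f| - |k| r` is convex, so that the slope dominates in between too. -/
theorem hasSlopeBound_line {a k s t : ℝ} {f : ℝ → ℝ} (ha : 0 ≤ a)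
    (hf : ∀ x ∈ Icc s t, ∀ y ∈ Icc s t, f y - f x = k * (y - x))
    (hs : a * |f s| ≤ |k| * s) (ht : a * |f t| ≤ |k| * t) :
    HasSlopeBound a f (fun _ => |k|) s t where
  continuousOn := continuousOn_const
  angular x hx := by
    rcases hx.1.eq_or_lt with rfl | hsx
    · exact hs
    have hst : 0 < t - s := by linarith [hx.2]
    have h1 := hf s ⟨le_rfl, hx.1.trans hx.2⟩ x hx
    have h2 := hf s ⟨le_rfl, hx.1.trans hx.2⟩ t ⟨hx.1.trans hx.2, le_rfl⟩
    have h3 : (t - s) * |f x| ≤ (t - x) * |f s| + (x - s) * |f t| := by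
      rw [← abs_of_pos hst, ← abs_of_nonneg (sub_nonneg.2 hx.2), ← abs_of_pos (sub_pos.2 hsx),
        ← abs_mul, ← abs_mul, ← abs_mul]
      refine le_trans (le_of_eq ?_) (abs_add_le _ _)
      congr 1
      rw [show f x = f s + k * (x - s) by linarith, show f t = f s + k * (t - s) by linarith]
      ring
    have h4 : (t - s) * (a * |f x|) ≤ (t - s) * (|k| * x) := by
      nlinarith [mul_le_mul_of_nonneg_left h3 ha,
        mul_le_mul_of_nonneg_left hs (sub_nonneg.2 hx.2),
        mul_le_mul_of_nonneg_left ht (sub_nonneg.2 hsx.le)]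
    exact le_of_mul_le_mul_left h4 hst
  lipOn x hx y hy K hK z hz w hw hzw := by
    have hsub : Icc x y ⊆ Icc s t := Icc_subset_Icc hx.1 hy.2
    rw [hf z (hsub hz) w (hsub hw), abs_mul, abs_of_nonneg (sub_nonneg.2 hzw)]
    exact mul_le_mul_of_nonneg_right (hK z hz) (sub_nonneg.2 hzw)

namespace ClosedCover

variable {α R₁ R₂ : ℝ}

/-- `ψ` is the profile of a tight radial map. -/
def IsTightProfile (α R₁ R₂ : ℝ) (ψ : ℝ → ℝ) : Prop :=
  ∃ u : ClosedCover α R₁ R₂ → ℂ, HasProfile u ψ ∧ IsTight u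

namespace IsTightProfile

variable {ψ : ℝ → ℝ}

theorem neg (h : IsTightProfile α R₁ R₂ ψ) : IsTightProfile α R₁ R₂ fun r => -ψ r := by
  obtain ⟨u, hu, ht⟩ := h
  exact ⟨-u, hu.neg, ht.neg⟩

theorem continuousOn (hR : 0 < R₁) (h : IsTightProfile α R₁ R₂ ψ) :
    ContinuousOn ψ (Icc R₁ R₂) := by
  obtain ⟨u, hu, ht⟩ := h
  obtain ⟨K, -, hK⟩ := hu.exists_lipOn hR.le ht.1
  exact hK.continuousOn

/-- The replacement principle `IsTight.localLip_le_of_replacement`, read as a bound for the angular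
stretching of a tight profile. -/
theorem angular_le_of_replacement (hR : 0 < R₁) (hα : α ≠ 0) (h : IsTightProfile α R₁ R₂ ψ)
    {t₁ t₂ : ℝ} (h₁ : R₁ ≤ t₁) (h₁₂ : t₁ < t₂) (h₂ : t₂ ≤ R₂) {η G : ℝ → ℝ}
    (hη : HasSlopeBound |α| η G t₁ t₂) (e₁ : η t₁ = ψ t₁) (e₂ : η t₂ = ψ t₂) {S : ℝ}
    (hS : ∀ r ∈ Icc t₁ t₂, G r ≤ S ∨ G r * r ≤ |α| * |ψ r|) {r : ℝ} (hr : r ∈ Ioo t₁ t₂) :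
    |α| * |ψ r| ≤ max (G r) S * r := by
  obtain ⟨u, hu, ht⟩ := h
  have hmem : r ∈ Icc R₁ R₂ := ⟨h₁.trans hr.1.le, hr.2.le.trans h₂⟩
  have hr0 : 0 < r := hR.trans_le hmem.1
  set p : ClosedCover α R₁ R₂ := ofPolar α r 0 hmem with hp
  have hpint : p ∈ interiorPart α R₁ R₂ := ⟨h₁.trans_lt hr.1, hr.2.trans_le h₂⟩
  have h3 := ht.localLip_le_of_replacement hR hα hu h₁ h₁₂ h₂ hη e₁ e₂ hS (p := p) hr
  have h4 := (hu.le_localLip hR.le hα hpint).trans h3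
  have h5 : 0 ≤ max (G r) S := by
    refine le_max_of_le_left ?_
    have := hη.angular r (Ioo_subset_Icc_self hr)
    exact nonneg_of_mul_nonneg_left (le_trans (by positivity) this) hr0
  change ENNReal.ofReal (|α| * |ψ r| / r) ≤ ENNReal.ofReal (max (G r) S) at h4
  rw [ENNReal.ofReal_le_ofReal_iff h5, div_le_iff₀ hr0] at h4
  exact h4

/-- A tight profile is affine between two points whose chord is steep enough that along it the slope
dominates the angular stretching: replacing it by the chord shows that its slopes are at most that of
the chord. -/
theorem eq_chord (hR : 0 < R₁) (hα : α ≠ 0) (h : IsTightProfile α R₁ R₂ ψ)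
    {t₁ t₂ k : ℝ} (h₁ : R₁ ≤ t₁) (h₂ : t₂ ≤ R₂)
    (hk : ψ t₂ = ψ t₁ + k * (t₂ - t₁)) (ha₁ : |α| * |ψ t₁| ≤ |k| * t₁)
    (ha₂ : |α| * |ψ t₂| ≤ |k| * t₂) {x : ℝ} (hx : x ∈ Icc t₁ t₂) :
    ψ x = ψ t₁ + k * (x - t₁) := by
  rcases (hx.1.trans hx.2).eq_or_lt with rfl | h₁₂
  · rw [le_antisymm hx.2 hx.1]; ring
  have hcont := h.continuousOn hR
  obtain ⟨u, hu, ht⟩ := h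
  have hline := hasSlopeBound_line (f := fun x => ψ t₁ + k * (x - t₁)) (k := k) (s := t₁) (t := t₂)
    (abs_nonneg α) (fun x _ y _ => by ring) (by simpa using ha₁) (by simpa only [← hk] using ha₂)
  have hlip : ∀ x ∈ Ioo t₁ t₂, ∀ K > |k|, ∀ᶠ z in 𝓝[>] x, ‖ψ z - ψ x‖ ≤ K * (z - x) := by
    intro x hx K hK
    have hmem : x ∈ Icc R₁ R₂ := ⟨h₁.trans hx.1.le, hx.2.le.trans h₂⟩
    have h3 := ht.localLip_le_of_replacement hR hα hu h₁ h₁₂ h₂ hline (by simp) hk.symm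
      (S := |k|) (fun _ _ => Or.inl le_rfl) (p := ofPolar α x 0 hmem) hx
    rw [max_self] at h3
    have hK0 : 0 < K := (abs_nonneg k).trans_lt hK
    obtain ⟨ε, hε, -, h4⟩ := hu.lipOn_of_localLip_lt hR.le
      (p := ofPolar α x 0 hmem) ⟨h₁.trans_lt hx.1, hx.2.trans_le h₂⟩ hK0.le
      (h3.trans_lt ((ENNReal.ofReal_lt_ofReal_iff hK0).2 hK))
    filter_upwards [Ioo_mem_nhdsGT (show x < x + ε by linarith)] with z hz
    exact h4 x ⟨by change x - ε < x; linarith, by change x < x + ε; linarith⟩ z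
      ⟨by change x - ε < z; linarith [hz.1], hz.2⟩ hz.1.le
  have hsub : Icc t₁ t₂ ⊆ Icc R₁ R₂ := Icc_subset_Icc h₁ h₂
  have mv : ∀ y ∈ Icc t₁ t₂, ∀ z ∈ Icc t₁ t₂, y ≤ z → |ψ z - ψ y| ≤ |k| * (z - y) := by
    intro y hy z hz hyz
    have := norm_sub_le_of_local_bound (f := ψ) (B := fun x => |k| * x) (B' := fun _ => |k|) hyz
      (hcont.mono ((Icc_subset_Icc hy.1 hz.2).trans hsub)) (by fun_prop)
      (fun x _ => by simpa using (hasDerivAt_id x).const_mul |k|)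
      (fun x hx => hlip x ⟨hy.1.trans_lt hx.1, hx.2.trans_le hz.2⟩)
    rw [mul_sub]
    exact this
  have m1 := abs_le.1 (mv t₁ (left_mem_Icc.2 h₁₂.le) x hx hx.1)
  have m2 := abs_le.1 (mv x hx t₂ (right_mem_Icc.2 h₁₂.le) hx.2)
  rcases le_total 0 k with hk0 | hk0
  · rw [abs_of_nonneg hk0] at m1 m2
    linarith
  · rw [abs_of_nonpos hk0] at m1 m2
    linarith

/-- A tight profile cannot be touched from below by a uniformly convex function whose slope at the
point of contact dominates the angular stretching there. -/
theorem not_touched_below (hR : 0 < R₁) (hα : α ≠ 0) (h : IsTightProfile α R₁ R₂ ψ) {τ p ε : ℝ}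
    (hτ : τ ∈ Ioo R₁ R₂) (hε : 0 < ε) (hp : |α| * |ψ τ| < |p| * τ)
    (htouch : ∀ᶠ y in 𝓝 τ, ψ τ + p * (y - τ) + ε * (y - τ) ^ 2 ≤ ψ y) : False := by
  have hcont := h.continuousOn hR
  -- the line of slope `p` through `(τ, ψ τ + ε d² / 2)` cuts off a chord around `τ`
  have hev : ∀ᶠ d in 𝓝[>] (0 : ℝ), 0 < d ∧ R₁ < τ - d ∧ τ + d < R₂ ∧
      |α| * (|ψ τ| + |p| * d + ε * d ^ 2 / 2) < |p| * (τ - d) ∧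
      ∀ y ∈ Icc (τ - d) (τ + d), ψ τ + p * (y - τ) + ε * (y - τ) ^ 2 ≤ ψ y := by
    obtain ⟨δ, hδ, hsub⟩ := Metric.eventually_nhds_iff.1 htouch
    have c1 : ∀ᶠ d in 𝓝 (0 : ℝ), R₁ < τ - d := by
      have : Tendsto (fun d : ℝ => τ - d) (𝓝 0) (𝓝 (τ - 0)) := by
        exact (continuous_const.sub continuous_id).tendsto _
      exact this.eventually (lt_mem_nhds (by simpa using hτ.1))
    have c2 : ∀ᶠ d in 𝓝 (0 : ℝ), τ + d < R₂ := by
      have : Tendsto (fun d : ℝ => τ + d) (𝓝 0) (𝓝 (τ + 0)) := by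
        exact (continuous_const.add continuous_id).tendsto _
      exact this.eventually (gt_mem_nhds (by simpa using hτ.2))
    have c3 : ∀ᶠ d in 𝓝 (0 : ℝ),
        |α| * (|ψ τ| + |p| * d + ε * d ^ 2 / 2) - |p| * (τ - d) < 0 := by
      have : Tendsto (fun d : ℝ => |α| * (|ψ τ| + |p| * d + ε * d ^ 2 / 2) - |p| * (τ - d)) (𝓝 0)
          (𝓝 (|α| * (|ψ τ| + |p| * 0 + ε * 0 ^ 2 / 2) - |p| * (τ - 0))) := by
        refine Continuous.tendsto ?_ _
        fun_prop
      refine this.eventually (gt_mem_nhds ?_)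
      simpa using hp
    filter_upwards [nhdsWithin_le_nhds c1, nhdsWithin_le_nhds c2, nhdsWithin_le_nhds c3,
      self_mem_nhdsWithin, nhdsWithin_le_nhds (gt_mem_nhds hδ)] with d h1 h2 h3 h4 h5
    refine ⟨h4, h1, h2, by linarith, fun y hy => hsub ?_⟩
    rw [Real.dist_eq, abs_lt]
    exact ⟨by linarith [hy.1], by linarith [hy.2]⟩
  obtain ⟨d, hd, hd1, hd2, hd3, hd4⟩ := hev.exists
  set g : ℝ → ℝ := fun y => ψ y - (ψ τ + p * (y - τ) + ε * d ^ 2 / 2) with hg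
  have hgc : ContinuousOn g (Icc (τ - d) (τ + d)) :=
    (hcont.mono (Icc_subset_Icc hd1.le hd2.le)).sub (by fun_prop)
  have hεd : 0 < ε * d ^ 2 := by positivity
  have g0 : g τ ≤ 0 := by
    simp only [hg]
    linarith [mul_zero p, sub_self τ, show p * (τ - τ) = 0 by ring]
  have gl : 0 ≤ g (τ - d) := by
    have := hd4 (τ - d) ⟨le_rfl, by linarith⟩
    have e : (τ - d - τ) ^ 2 = d ^ 2 := by ring
    rw [e] at this
    simp only [hg]
    linarith
  have gr : 0 ≤ g (τ + d) := by
    have := hd4 (τ + d) ⟨by linarith, le_rfl⟩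
    have e : (τ + d - τ) ^ 2 = d ^ 2 := by ring
    rw [e] at this
    simp only [hg]
    linarith
  obtain ⟨x₁, hx₁, hgx₁⟩ := intermediate_value_Icc' (show τ - d ≤ τ by linarith)
    (hgc.mono (Icc_subset_Icc_right (by linarith))) ⟨g0, gl⟩
  obtain ⟨x₂, hx₂, hgx₂⟩ := intermediate_value_Icc (show τ ≤ τ + d by linarith)
    (hgc.mono (Icc_subset_Icc_left (by linarith))) ⟨g0, gr⟩
  simp only [hg, sub_eq_zero] at hgx₁ hgx₂
  have hsteep : ∀ x ∈ Icc (τ - d) (τ + d), ψ x = ψ τ + p * (x - τ) + ε * d ^ 2 / 2 →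
      |α| * |ψ x| ≤ |p| * x := by
    intro x hx hψ
    have h1 : |ψ x| ≤ |ψ τ| + |p| * d + ε * d ^ 2 / 2 := by
      rw [hψ]
      refine (abs_add_le _ _).trans (add_le_add ((abs_add_le _ _).trans ?_) ?_)
      · rw [abs_mul]
        gcongr
        exact abs_le.2 ⟨by linarith [hx.1], by linarith [hx.2]⟩
      · rw [abs_of_pos (by positivity)]
    calc |α| * |ψ x| ≤ |α| * (|ψ τ| + |p| * d + ε * d ^ 2 / 2) := by gcongr
      _ ≤ |p| * (τ - d) := hd3.le
      _ ≤ |p| * x := by gcongr; exact hx.1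
  have := h.eq_chord hR hα (t₁ := x₁) (t₂ := x₂) (k := p) (by linarith [hx₁.1])
    (by linarith [hx₂.2]) (by rw [hgx₁, hgx₂]; ring)
    (hsteep x₁ ⟨hx₁.1, by linarith [hx₁.2]⟩ hgx₁) (hsteep x₂ ⟨by linarith [hx₂.1], hx₂.2⟩ hgx₂)
    (x := τ) ⟨hx₁.2, hx₂.1⟩
  rw [hgx₁] at this
  nlinarith

/-- Comparison from below with a function `Φ` which has subgradients `P` dominating the angular
stretching of `ψ`, nonpositive up to `m` and nonnegative beyond `m`. Otherwise a uniformly convex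
perturbation of `Φ` with steeper slopes would touch `ψ` from below. -/
theorem le_of_subgradient (hR : 0 < R₁) (hα : α ≠ 0) (h : IsTightProfile α R₁ R₂ ψ)
    {t₁ t₂ m : ℝ} {Φ P : ℝ → ℝ} (h₁ : R₁ ≤ t₁) (h₂ : t₂ ≤ R₂) (hΦ : ContinuousOn Φ (Icc t₁ t₂))
    (hsub : ∀ x ∈ Ioo t₁ t₂, ∀ᶠ y in 𝓝 x, Φ x + P x * (y - x) ≤ Φ y)
    (hang : ∀ x ∈ Ioo t₁ t₂, |α| * |ψ x| ≤ |P x| * x)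
    (hneg : ∀ x ∈ Ioo t₁ t₂, x ≤ m → P x ≤ 0) (hpos : ∀ x ∈ Ioo t₁ t₂, m < x → 0 ≤ P x)
    (e₁ : Φ t₁ ≤ ψ t₁) (e₂ : Φ t₂ ≤ ψ t₂) {x : ℝ} (hx : x ∈ Icc t₁ t₂) : Φ x ≤ ψ x := by
  by_contra! hlt
  have hcont := h.continuousOn hR
  -- Subtracting a small multiple of the strictly concave function `k` makes `Φ` uniformly convex
  -- and its slopes strictly steeper.
  set N : ℝ := (|t₁ - m| + |t₂ - m|) ^ 2 + |t₁ - m| + |t₂ - m| with hN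
  set k : ℝ → ℝ := fun y => N - (y - m) ^ 2 - |y - m| with hk
  set q : ℝ → ℝ := fun y => if y ≤ m then 2 * (m - y) + 1 else -(2 * (y - m) + 1) with hq
  have hkq : ∀ y z, k z ≤ k y + q y * (z - y) - (z - y) ^ 2 := by
    intro y z
    simp only [hk, hq]
    split_ifs with hym
    · rw [abs_of_nonpos (show y - m ≤ 0 by linarith)]
      nlinarith [neg_abs_le (z - m)]
    · rw [abs_of_pos (show 0 < y - m by linarith)]
      nlinarith [le_abs_self (z - m)]
  have hk1 : 0 ≤ k t₁ := by
    simp only [hk, hN]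
    nlinarith [abs_nonneg (t₁ - m), abs_nonneg (t₂ - m), sq_abs (t₁ - m)]
  have hk2 : 0 ≤ k t₂ := by
    simp only [hk, hN]
    nlinarith [abs_nonneg (t₁ - m), abs_nonneg (t₂ - m), sq_abs (t₂ - m)]
  obtain ⟨ε, hε, hεx⟩ : ∃ ε > 0, ε * k x < Φ x - ψ x := by
    have h0 : 0 < Φ x - ψ x := sub_pos.2 hlt
    refine ⟨(Φ x - ψ x) / (|k x| + 1), by positivity, ?_⟩
    rw [div_mul_eq_mul_div, div_lt_iff₀ (by positivity)]
    nlinarith [le_abs_self (k x)]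
  have hkc : Continuous k := by fun_prop
  obtain ⟨τ, hτ, hmin⟩ := isCompact_Icc.exists_isMinOn ⟨x, hx⟩
    (((hcont.mono (Icc_subset_Icc h₁ h₂)).sub hΦ).add
      (hkc.const_smul ε).continuousOn)
  have hmin' : ∀ y ∈ Icc t₁ t₂, ψ τ - Φ τ + ε * k τ ≤ ψ y - Φ y + ε * k y := fun y hy => hmin hy
  have hτneg : ψ τ - Φ τ + ε * k τ < 0 := (hmin' x hx).trans_lt (by linarith)
  have hτ1 : t₁ < τ := lt_of_le_of_ne hτ.1 (by
    rintro rfl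
    have := mul_nonneg hε.le hk1
    linarith)
  have hτ2 : τ < t₂ := lt_of_le_of_ne hτ.2 (by
    rintro rfl
    have := mul_nonneg hε.le hk2
    linarith)
  have hτI : τ ∈ Ioo t₁ t₂ := ⟨hτ1, hτ2⟩
  have hτ0 : 0 < τ := hR.trans_le (h₁.trans hτ.1)
  refine h.not_touched_below hR hα (τ := τ) (p := P τ - ε * q τ) (ε := ε)
    ⟨h₁.trans_lt hτ1, hτ2.trans_le h₂⟩ hε ?_ ?_
  · have : |P τ| < |P τ - ε * q τ| := by
      simp only [hq]
      split_ifs with hm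
      · have h3 := hneg τ hτI hm
        have h4 : 0 < ε * (2 * (m - τ) + 1) := by
          have : 0 ≤ m - τ := by linarith
          positivity
        rw [abs_of_nonpos h3, abs_of_nonpos (by linarith)]
        linarith
      · have h3 := hpos τ hτI (not_le.1 hm)
        have h4 : 0 < ε * (2 * (τ - m) + 1) := by
          have : 0 ≤ τ - m := by linarith
          positivity
        rw [abs_of_nonneg h3, abs_of_nonneg (by linarith)]
        linarith
    exact (hang τ hτI).trans_lt (by gcongr)
  · filter_upwards [hsub τ hτI, Ioo_mem_nhds hτ1 hτ2] with y hy hyI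
    have h3 := hmin' y (Ioo_subset_Icc_self hyI)
    have h4 := mul_le_mul_of_nonneg_left (hkq τ y) hε.le
    nlinarith

end IsTightProfile

end ClosedCover

/-! ### Power arcs -/

/-- The multiple of the power function `r ^ b` which takes the value `c` at `R`. -/
noncomputable def powerArc (c R b r : ℝ) : ℝ := c * (r / R) ^ b

section powerArc

variable {c R b r x y : ℝ}

theorem powerArc_self (hR : 0 < R) : powerArc c R b R = c := by
  rw [powerArc, div_self hR.ne', Real.one_rpow, mul_one]

theorem powerArc_neg (c R b r : ℝ) : powerArc (-c) R b r = -powerArc c R b r := by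
  simp [powerArc]

theorem powerArc_nonneg (hR : 0 < R) (hc : 0 ≤ c) (hr : 0 ≤ r) : 0 ≤ powerArc c R b r :=
  mul_nonneg hc (Real.rpow_nonneg (by positivity) _)

theorem powerArc_nonpos (hR : 0 < R) (hc : c ≤ 0) (hr : 0 ≤ r) : powerArc c R b r ≤ 0 :=
  mul_nonpos_of_nonpos_of_nonneg hc (Real.rpow_nonneg (by positivity) _)

theorem abs_powerArc (hR : 0 < R) (hr : 0 ≤ r) : |powerArc c R b r| = powerArc |c| R b r := by
  rw [powerArc, powerArc, abs_mul, abs_of_nonneg (Real.rpow_nonneg (by positivity) _)]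

theorem hasDerivAt_powerArc (hR : 0 < R) (hr : 0 < r) :
    HasDerivAt (powerArc c R b) (b * powerArc c R b r / r) r := by
  have h1 : HasDerivAt (fun x : ℝ => x / R) (1 / R) r := (hasDerivAt_id r).div_const R
  have h2 := (h1.rpow_const (p := b) (Or.inl (by positivity))).const_mul c
  refine h2.congr_deriv ?_
  rw [Real.rpow_sub_one (by positivity), powerArc]
  field_simp

theorem powerArc_eq_mul (hR : 0 < R) (hx : 0 < x) (hy : 0 < y) :
    powerArc c R b y = powerArc c R b x * (y / x) ^ b := by
  rw [powerArc, powerArc, mul_assoc, ← Real.mul_rpow (by positivity) (by positivity)]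
  congr 2
  field_simp

/-- Nonnegative power arcs with exponent outside `(0, 1)` lie above their tangents. -/
theorem powerArc_tangent_le (hR : 0 < R) (hc : 0 ≤ c) (hb : b ≤ 0 ∨ 1 ≤ b) (hx : 0 < x)
    (hy : 0 < y) :
    powerArc c R b x + b * powerArc c R b x / x * (y - x) ≤ powerArc c R b y := by
  have hpow : 1 + b * (y / x - 1) ≤ (y / x) ^ b := by
    have hyx : 0 < y / x := by positivity
    rcases hb with hb | hb
    · rw [Real.rpow_def_of_pos hyx]
      have h1 := Real.log_le_sub_one_of_pos hyx
      have h2 := Real.add_one_le_exp (Real.log (y / x) * b)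
      nlinarith
    · have := one_add_mul_self_le_rpow_one_add (show -1 ≤ y / x - 1 by linarith) hb
      rwa [add_sub_cancel] at this
  rw [powerArc_eq_mul hR hx hy]
  have := mul_le_mul_of_nonneg_left hpow (powerArc_nonneg (b := b) hR hc hx.le)
  refine le_trans (le_of_eq ?_) this
  field_simp

theorem abs_powerArc_anti (hR : 0 < R) (hb : b ≤ 0) (hx : 0 < x) (hxy : x ≤ y) :
    |powerArc c R b y| ≤ |powerArc c R b x| := by
  rw [abs_powerArc hR hx.le, abs_powerArc hR (hx.le.trans hxy)]
  refine mul_le_mul_of_nonneg_left ?_ (abs_nonneg c)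
  exact Real.rpow_le_rpow_of_nonpos (by positivity) (by gcongr) hb

theorem abs_powerArc_div_mono (hR : 0 < R) (hb : 1 ≤ b) (hx : 0 < x) (hxy : x ≤ y) :
    |powerArc c R b x| / x ≤ |powerArc c R b y| / y := by
  have key : ∀ z, 0 < z → |powerArc c R b z| / z = |c| / R * (z / R) ^ (b - 1) := by
    intro z hz
    rw [abs_powerArc hR hz.le, powerArc, Real.rpow_sub_one (by positivity)]
    field_simp
  rw [key x hx, key y (hx.trans_le hxy)]
  refine mul_le_mul_of_nonneg_left ?_ (by positivity)
  exact Real.rpow_le_rpow (by positivity) (by gcongr) (by linarith)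

theorem hasSlopeBound_powerArc (hR : 0 < R) {s t : ℝ} (hs : 0 < s) :
    HasSlopeBound |b| (powerArc c R b) (fun r => |b| * |powerArc c R b r| / r) s t := by
  have hcont : ∀ {x y : ℝ}, 0 < x → ContinuousOn (powerArc c R b) (Icc x y) := fun hx z hz =>
    (hasDerivAt_powerArc hR (hx.trans_le hz.1)).continuousAt.continuousWithinAt
  refine ⟨?_, fun x hx => ?_, fun x hx y hy K hK z hz w hw hzw => ?_⟩
  · exact ((hcont hs).abs.const_smul |b|).div continuousOn_id fun x hx => (hs.trans_le hx.1).ne'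
  · have : 0 < x := hs.trans_le hx.1
    field_simp
    exact le_rfl
  · have hx0 : 0 < x := hs.trans_le hx.1
    have hz0 : 0 < z := hx0.trans_le hz.1
    have := norm_sub_le_of_local_bound (f := powerArc c R b) (B := fun x => K * x)
      (B' := fun _ => K) hzw (hcont hz0) (by fun_prop)
      (fun v _ => by simpa using (hasDerivAt_id v).const_mul K) fun v hv L hL => ?_
    · rw [mul_sub]
      exact this
    · have hv0 : 0 < v := hz0.trans hv.1
      have hd := (hasDerivAt_powerArc (c := c) (b := b) hR hv0).hasDerivWithinAt (s := Ioi v)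
      have hlt : ‖b * powerArc c R b v / v‖ < L := by
        rw [Real.norm_eq_abs, abs_div, abs_mul, abs_of_pos hv0]
        exact (hK v ⟨hz.1.trans hv.1.le, hv.2.le.trans hw.2⟩).trans_lt hL
      have hev := (hd.limsup_norm_slope_le hlt)
      filter_upwards [hev, self_mem_nhdsWithin] with u hu hu'
      have hpos : 0 < u - v := sub_pos.2 hu'
      rw [Real.norm_eq_abs, Real.norm_eq_abs, abs_of_pos hpos, inv_mul_lt_iff₀ hpos] at hu
      rw [Real.norm_eq_abs]
      linarith

end powerArc

/-! ### The profile of the tight radial map -/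

/-- The parameters of the profile of the tight radial map. The profile follows the arc
`M₁ (r / R₁) ^ (-a)` on `[R₁, s₁]`, along which `|φ'| = a |φ| / r`, then a segment of slope
`slope` on `[s₁, s₂]`, along which `|φ'| ≥ a |φ| / r`, and finally the arc `M₂ (r / R₂) ^ a` on
`[s₂, R₂]`, along which again `|φ'| = a |φ| / r`. The last arc is present only if `1 < a`. -/
structure Transition (a M₁ M₂ R₁ R₂ : ℝ) where
  s₁ : ℝ
  s₂ : ℝ
  slope : ℝ
  le_s₁ : R₁ ≤ s₁
  s₁_le_s₂ : s₁ ≤ s₂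
  s₂_le : s₂ ≤ R₂
  left_le : a * |powerArc M₁ R₁ (-a) s₁| ≤ |slope| * s₁
  left_eq : R₁ < s₁ → a * |powerArc M₁ R₁ (-a) s₁| = |slope| * s₁
  right_le : a * |powerArc M₂ R₂ a s₂| ≤ |slope| * s₂
  right_eq : s₂ < R₂ → a * |powerArc M₂ R₂ a s₂| = |slope| * s₂
  one_lt : s₂ < R₂ → 1 < a
  matching : powerArc M₂ R₂ a s₂ = powerArc M₁ R₁ (-a) s₁ + slope * (s₂ - s₁)

namespace Transition

variable {a M₁ M₂ R₁ R₂ : ℝ} (T : Transition a M₁ M₂ R₁ R₂) {r : ℝ}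

/-- The profile described by the parameters. -/
noncomputable def profile (r : ℝ) : ℝ :=
  if r ≤ T.s₁ then powerArc M₁ R₁ (-a) r
  else if r ≤ T.s₂ then powerArc M₁ R₁ (-a) T.s₁ + T.slope * (r - T.s₁)
  else powerArc M₂ R₂ a r

/-- The local Lipschitz constant of the radial map with this profile. At `r = s₁` the value is
`|slope|`, which is the value of the first branch too unless `s₁ = R₁`. -/
noncomputable def bound (r : ℝ) : ℝ :=
  if r < T.s₁ then a * |powerArc M₁ R₁ (-a) r| / r
  else if r ≤ T.s₂ then |T.slope|
  else a * |powerArc M₂ R₂ a r| / r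

theorem profile_left (hr : r ≤ T.s₁) : T.profile r = powerArc M₁ R₁ (-a) r := if_pos hr

theorem profile_mid (h₁ : T.s₁ ≤ r) (h₂ : r ≤ T.s₂) :
    T.profile r = powerArc M₁ R₁ (-a) T.s₁ + T.slope * (r - T.s₁) := by
  rcases h₁.eq_or_lt with rfl | h₁
  · rw [T.profile_left le_rfl]; ring
  · rw [profile, if_neg (not_le.2 h₁), if_pos h₂]

theorem profile_right (hr : T.s₂ ≤ r) : T.profile r = powerArc M₂ R₂ a r := by
  rcases hr.eq_or_lt with rfl | hr
  · rw [T.profile_mid T.s₁_le_s₂ le_rfl, T.matching]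
  · rw [profile, if_neg (not_le.2 (T.s₁_le_s₂.trans_lt hr)), if_neg (not_le.2 hr)]

theorem bound_mid (h₁ : T.s₁ ≤ r) (h₂ : r ≤ T.s₂) : T.bound r = |T.slope| := by
  rw [bound, if_neg (not_lt.2 h₁), if_pos h₂]

theorem bound_left (hR₁ : 0 < R₁) (h : R₁ < T.s₁) (hr : r ≤ T.s₁) :
    T.bound r = a * |powerArc M₁ R₁ (-a) r| / r := by
  rcases hr.eq_or_lt with rfl | hr
  · have h0 : 0 < T.s₁ := hR₁.trans h
    rw [T.bound_mid le_rfl T.s₁_le_s₂, T.left_eq h]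
    field_simp
  · rw [bound, if_pos hr]

theorem bound_right (hR₁ : 0 < R₁) (h : T.s₂ < R₂) (hr : T.s₂ ≤ r) :
    T.bound r = a * |powerArc M₂ R₂ a r| / r := by
  rcases hr.eq_or_lt with rfl | hr
  · have h0 : 0 < T.s₂ := hR₁.trans_le (T.le_s₁.trans T.s₁_le_s₂)
    rw [T.bound_mid T.s₁_le_s₂ le_rfl, T.right_eq h]
    field_simp
  · rw [bound, if_neg (not_lt.2 (T.s₁_le_s₂.trans hr.le)), if_neg (not_le.2 hr)]

theorem slope_le_left (ha : 0 < a) (hR₁ : 0 < R₁) (h : R₁ < T.s₁) (hr : 0 < r) (hr₁ : r ≤ T.s₁) :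
    |T.slope| * r ≤ a * |powerArc M₁ R₁ (-a) r| := by
  calc |T.slope| * r ≤ |T.slope| * T.s₁ := by gcongr
    _ = a * |powerArc M₁ R₁ (-a) T.s₁| := (T.left_eq h).symm
    _ ≤ a * |powerArc M₁ R₁ (-a) r| :=
      mul_le_mul_of_nonneg_left (abs_powerArc_anti hR₁ (neg_nonpos.2 ha.le) hr hr₁) ha.le

theorem slope_le_right (hR₁ : 0 < R₁) (h : T.s₂ < R₂) (hr : T.s₂ ≤ r) :
    |T.slope| * r ≤ a * |powerArc M₂ R₂ a r| := by
  have h0 : 0 < T.s₂ := hR₁.trans_le (T.le_s₁.trans T.s₁_le_s₂)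
  have hr0 : 0 < r := h0.trans_le hr
  have ha := T.one_lt h
  have h1 := abs_powerArc_div_mono (c := M₂) (h0.trans h) ha.le h0 hr
  have h2 : |T.slope| = a * (|powerArc M₂ R₂ a T.s₂| / T.s₂) := by
    have := T.right_eq h
    field_simp
    linarith
  calc |T.slope| * r = a * (|powerArc M₂ R₂ a T.s₂| / T.s₂) * r := by rw [h2]
    _ ≤ a * (|powerArc M₂ R₂ a r| / r) * r := by gcongr
    _ = _ := by field_simp

theorem slope_le_bound (ha : 0 < a) (hR₁ : 0 < R₁) (hr : r ∈ Icc R₁ R₂) :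
    |T.slope| ≤ T.bound r := by
  have hr0 : 0 < r := hR₁.trans_le hr.1
  rcases lt_or_ge r T.s₁ with h | h
  · have h1 : R₁ < T.s₁ := hr.1.trans_lt h
    rw [T.bound_left hR₁ h1 h.le, le_div_iff₀ hr0]
    exact T.slope_le_left ha hR₁ h1 hr0 h.le
  rcases le_or_gt r T.s₂ with h' | h'
  · rw [T.bound_mid h h']
  · have h1 : T.s₂ < R₂ := h'.trans_le hr.2
    rw [T.bound_right hR₁ h1 h'.le, le_div_iff₀ hr0]
    exact T.slope_le_right hR₁ h1 h'.le

theorem hasSlopeBound (ha : 0 < a) (hR₁ : 0 < R₁) (hR : R₁ < R₂) :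
    HasSlopeBound a T.profile T.bound R₁ R₂ := by
  have hs₁ : 0 < T.s₁ := hR₁.trans_le T.le_s₁
  have hs₂ : 0 < T.s₂ := hs₁.trans_le T.s₁_le_s₂
  have mid : HasSlopeBound a T.profile T.bound T.s₁ T.s₂ := by
    refine (hasSlopeBound_line (f := T.profile) (k := T.slope) ha.le ?_ ?_ ?_).congr
      (fun _ _ => rfl) fun x hx => (T.bound_mid hx.1 hx.2).symm
    · intro x hx y hy
      rw [T.profile_mid hx.1 hx.2, T.profile_mid hy.1 hy.2]
      ring
    · rw [T.profile_left le_rfl]; exact T.left_le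
    · rw [T.profile_right le_rfl]; exact T.right_le
  have left : HasSlopeBound a T.profile T.bound R₁ T.s₂ := by
    rcases T.le_s₁.eq_or_lt with h | h
    · exact mid.mono h.ge le_rfl
    · refine HasSlopeBound.union ?_ mid T.le_s₁ T.s₁_le_s₂
      have := hasSlopeBound_powerArc (c := M₁) (b := -a) hR₁ (t := T.s₁) hR₁
      rw [abs_neg, abs_of_pos ha] at this
      exact this.congr (fun x hx => (T.profile_left hx.2).symm)
        fun x hx => (T.bound_left hR₁ h hx.2).symm
  rcases T.s₂_le.eq_or_lt with h | h
  · exact left.mono le_rfl h.ge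
  · refine left.union ?_ (T.le_s₁.trans T.s₁_le_s₂) T.s₂_le
    have := hasSlopeBound_powerArc (c := M₂) (b := a) (hR₁.trans hR) (t := R₂) hs₂
    rw [abs_of_pos ha] at this
    exact this.congr (fun x hx => (T.profile_right hx.1).symm)
      fun x hx => (T.bound_right hR₁ h hx.1).symm

/-- The parameters for the boundary values `-M₁` and `-M₂`. -/
def neg : Transition a (-M₁) (-M₂) R₁ R₂ where
  s₁ := T.s₁
  s₂ := T.s₂
  slope := -T.slope
  le_s₁ := T.le_s₁
  s₁_le_s₂ := T.s₁_le_s₂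
  s₂_le := T.s₂_le
  left_le := by simpa only [powerArc_neg, abs_neg] using T.left_le
  left_eq := by simpa only [powerArc_neg, abs_neg] using T.left_eq
  right_le := by simpa only [powerArc_neg, abs_neg] using T.right_le
  right_eq := by simpa only [powerArc_neg, abs_neg] using T.right_eq
  one_lt := T.one_lt
  matching := by rw [powerArc_neg, powerArc_neg, T.matching]; ring

theorem bound_neg (r : ℝ) : T.neg.bound r = T.bound r := by
  simp only [bound, neg, powerArc_neg, abs_neg]

theorem profile_neg (r : ℝ) : T.neg.profile r = -T.profile r := by
  simp only [profile, neg, powerArc_neg]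
  split_ifs <;> ring

end Transition

/-! ### Existence of the profile -/

section

variable {a M₁ M₂ R₁ R₂ : ℝ}

/-- For each slope `k`, the point where the inner arc reaches the slope `k`. -/
theorem exists_left_transition (ha : 0 < a) (hR₁ : 0 < R₁) (hR : R₁ < R₂) :
    ∃ s : ℝ → ℝ, ContinuousOn s (Ioi 0) ∧ ∀ k > 0, a * |powerArc M₁ R₁ (-a) R₂| ≤ k * R₂ →
      R₁ ≤ s k ∧ s k ≤ R₂ ∧ a * |powerArc M₁ R₁ (-a) (s k)| ≤ k * s k ∧
      (R₁ < s k → a * |powerArc M₁ R₁ (-a) (s k)| = k * s k) ∧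
      (a * |powerArc M₁ R₁ (-a) R₂| = k * R₂ → s k = R₂) ∧ (a * |M₁| ≤ k * R₁ → s k = R₁) := by
  have ha1 : 0 < a + 1 := by linarith
  have hR₂ : 0 < R₂ := hR₁.trans hR
  set A : ℝ := a * |M₁| * R₁ ^ a with hA
  have hA0 : 0 ≤ A := by positivity
  have key : ∀ r > 0, a * |powerArc M₁ R₁ (-a) r| = A / r ^ (a + 1) * r := by
    intro r hr
    rw [abs_powerArc hR₁ hr.le, powerArc, Real.rpow_neg (by positivity),
      Real.div_rpow hr.le hR₁.le, Real.rpow_add_one hr.ne']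
    have : 0 < r ^ a := by positivity
    field_simp
    rw [hA]
  have le_iff : ∀ r > 0, ∀ k > 0, a * |powerArc M₁ R₁ (-a) r| ≤ k * r ↔ A / k ≤ r ^ (a + 1) := by
    intro r hr k hk
    have : 0 < r ^ (a + 1) := by positivity
    rw [key r hr, mul_le_mul_iff_left₀ hr, div_le_iff₀ this, div_le_iff₀' hk]
  have eq_iff : ∀ r > 0, ∀ k > 0, a * |powerArc M₁ R₁ (-a) r| = k * r ↔ A / k = r ^ (a + 1) := by
    intro r hr k hk
    have : 0 < r ^ (a + 1) := by positivity
    rw [key r hr, mul_left_inj' hr.ne', div_eq_iff this.ne', div_eq_iff hk.ne', mul_comm k]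
  have hpow : ∀ k > 0, ((A / k) ^ (a + 1)⁻¹) ^ (a + 1) = A / k := fun k hk =>
    Real.rpow_inv_rpow (by positivity) ha1.ne'
  refine ⟨fun k => max R₁ ((A / k) ^ (a + 1)⁻¹), ?_, fun k hk hkR => ?_⟩
  · refine continuousOn_const.sup ?_
    refine ContinuousOn.rpow_const ?_ fun _ _ => Or.inr (by positivity)
    exact continuousOn_const.div continuousOn_id fun x hx => (mem_Ioi.1 hx).ne'
  have hw0 : 0 ≤ (A / k) ^ (a + 1)⁻¹ := by positivity
  have hwR : (A / k) ^ (a + 1)⁻¹ ≤ R₂ := by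
    rw [Real.rpow_inv_le_iff_of_pos (by positivity) hR₂.le ha1]
    exact (le_iff R₂ hR₂ k hk).1 hkR
  have hs0 : 0 < max R₁ ((A / k) ^ (a + 1)⁻¹) := lt_max_of_lt_left hR₁
  dsimp only
  refine ⟨le_max_left _ _, max_le hR.le hwR, ?_, fun h => ?_, fun h => ?_, fun h => ?_⟩
  · rw [le_iff _ hs0 k hk]
    calc A / k = ((A / k) ^ (a + 1)⁻¹) ^ (a + 1) := (hpow k hk).symm
      _ ≤ _ := Real.rpow_le_rpow hw0 (le_max_right _ _) ha1.le
  · have h1 : max R₁ ((A / k) ^ (a + 1)⁻¹) = (A / k) ^ (a + 1)⁻¹ := by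
      refine max_eq_right ?_
      by_contra! h2
      rw [max_eq_left h2.le] at h
      exact lt_irrefl _ h
    rw [eq_iff _ hs0 k hk, h1, hpow k hk]
  · rw [(eq_iff _ hR₂ k hk).1 h, Real.rpow_rpow_inv hR₂.le ha1.ne', max_eq_right hR.le]
  · refine max_eq_left ?_
    rw [Real.rpow_inv_le_iff_of_pos (by positivity) hR₁.le ha1, ← le_iff R₁ hR₁ k hk,
      powerArc_self hR₁]
    exact h

/-- For each slope `k`, the point where the outer arc reaches the slope `k`. -/
theorem exists_right_transition (ha : 1 < a) (hM₂ : M₂ ≠ 0) (hR₁ : 0 < R₁) (hR : R₁ < R₂) :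
    ∃ s : ℝ → ℝ, ContinuousOn s (Ioi 0) ∧ ∀ k > 0, a * |powerArc M₂ R₂ a R₁| ≤ k * R₁ →
      R₁ ≤ s k ∧ s k ≤ R₂ ∧ a * |powerArc M₂ R₂ a (s k)| ≤ k * s k ∧
      (s k < R₂ → a * |powerArc M₂ R₂ a (s k)| = k * s k) ∧
      (a * |powerArc M₂ R₂ a R₁| = k * R₁ → s k = R₁) ∧ (a * |M₂| ≤ k * R₂ → s k = R₂) := by
  have ha1 : 0 < a - 1 := by linarith
  have hR₂ : 0 < R₂ := hR₁.trans hR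
  have hM : 0 < |M₂| := abs_pos.2 hM₂
  set B : ℝ := R₂ ^ a / (a * |M₂|) with hB
  have hB0 : 0 < B := by positivity
  have key : ∀ r > 0, a * |powerArc M₂ R₂ a r| = r ^ (a - 1) / B * r := by
    intro r hr
    rw [abs_powerArc hR₂ hr.le, powerArc, Real.div_rpow hr.le hR₂.le, Real.rpow_sub_one hr.ne', hB]
    have : 0 < R₂ ^ a := by positivity
    field_simp
  have le_iff : ∀ r > 0, ∀ k > 0, a * |powerArc M₂ R₂ a r| ≤ k * r ↔ r ^ (a - 1) ≤ k * B := by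
    intro r hr k hk
    rw [key r hr, mul_le_mul_iff_left₀ hr, div_le_iff₀ hB0]
  have eq_iff : ∀ r > 0, ∀ k > 0, a * |powerArc M₂ R₂ a r| = k * r ↔ r ^ (a - 1) = k * B := by
    intro r hr k hk
    rw [key r hr, mul_left_inj' hr.ne', div_eq_iff hB0.ne']
  have hpow : ∀ k > 0, ((k * B) ^ (a - 1)⁻¹) ^ (a - 1) = k * B := fun k hk =>
    Real.rpow_inv_rpow (by positivity) ha1.ne'
  refine ⟨fun k => min R₂ ((k * B) ^ (a - 1)⁻¹), ?_, fun k hk hkR => ?_⟩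
  · refine continuousOn_const.inf ?_
    refine ContinuousOn.rpow_const (by fun_prop) fun _ _ => Or.inr (by positivity)
  have hw0 : 0 < (k * B) ^ (a - 1)⁻¹ := by positivity
  have hwR : R₁ ≤ (k * B) ^ (a - 1)⁻¹ := by
    rw [Real.le_rpow_inv_iff_of_pos hR₁.le (by positivity) ha1]
    exact (le_iff R₁ hR₁ k hk).1 hkR
  have hs0 : 0 < min R₂ ((k * B) ^ (a - 1)⁻¹) := lt_min hR₂ hw0
  dsimp only
  refine ⟨le_min hR.le hwR, min_le_left _ _, ?_, fun h => ?_, fun h => ?_, fun h => ?_⟩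
  · rw [le_iff _ hs0 k hk]
    calc _ ≤ ((k * B) ^ (a - 1)⁻¹) ^ (a - 1) :=
          Real.rpow_le_rpow hs0.le (min_le_right _ _) ha1.le
      _ = k * B := hpow k hk
  · have h1 : min R₂ ((k * B) ^ (a - 1)⁻¹) = (k * B) ^ (a - 1)⁻¹ := by
      refine min_eq_right ?_
      by_contra! h2
      rw [min_eq_left h2.le] at h
      exact lt_irrefl _ h
    rw [eq_iff _ hs0 k hk, h1, hpow k hk]
  · rw [← (eq_iff _ hR₁ k hk).1 h, Real.rpow_rpow_inv hR₁.le ha1.ne', min_eq_right hR.le]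
  · refine min_eq_left ?_
    rw [Real.le_rpow_inv_iff_of_pos hR₂.le (by positivity) ha1, ← le_iff R₂ hR₂ k hk,
      powerArc_self hR₂]
    exact h

/-- A chord of slope `±k` between the arcs gives the parameters of a profile. -/
theorem Transition.nonempty_of_abs_eq {s₁ s₂ k : ℝ} (hk : 0 ≤ k) (h₁ : R₁ ≤ s₁) (h₁₂ : s₁ ≤ s₂)
    (h₂ : s₂ ≤ R₂) (l₁ : a * |powerArc M₁ R₁ (-a) s₁| ≤ k * s₁)
    (l₂ : R₁ < s₁ → a * |powerArc M₁ R₁ (-a) s₁| = k * s₁)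
    (r₁ : a * |powerArc M₂ R₂ a s₂| ≤ k * s₂)
    (r₂ : s₂ < R₂ → a * |powerArc M₂ R₂ a s₂| = k * s₂) (r₃ : s₂ < R₂ → 1 < a)
    (hm : |powerArc M₂ R₂ a s₂ - powerArc M₁ R₁ (-a) s₁| = k * (s₂ - s₁)) :
    Nonempty (Transition a M₁ M₂ R₁ R₂) := by
  obtain ⟨ℓ, hℓ, hℓm⟩ : ∃ ℓ, |ℓ| = k ∧
      powerArc M₂ R₂ a s₂ = powerArc M₁ R₁ (-a) s₁ + ℓ * (s₂ - s₁) := by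
    rcases abs_cases (powerArc M₂ R₂ a s₂ - powerArc M₁ R₁ (-a) s₁) with ⟨h, -⟩ | ⟨h, -⟩
    · exact ⟨k, abs_of_nonneg hk, by linarith⟩
    · exact ⟨-k, by rw [abs_neg, abs_of_nonneg hk], by linarith⟩
  subst hℓ
  exact ⟨⟨s₁, s₂, ℓ, h₁, h₁₂, h₂, l₁, l₂, r₁, r₂, r₃, hℓm⟩⟩

/-- The slope of the segment is found by the intermediate value theorem: for steep slopes both
transition points are at the boundary and the segment overshoots, and for the least admissible slope
the transition points meet or are in the wrong order. -/
theorem Transition.nonempty (ha : 0 < a) (hR₁ : 0 < R₁) (hR : R₁ < R₂) :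
    Nonempty (Transition a M₁ M₂ R₁ R₂) := by
  have hR₂ : 0 < R₂ := hR₁.trans hR
  have hRR : 0 < R₂ - R₁ := sub_pos.2 hR
  -- If the transition points depend continuously on the slope `k`, the intermediate value theorem
  -- gives a slope for which the segment fits.
  have ivt : ∀ (s₁ s₂ : ℝ → ℝ) (k₀ : ℝ), 0 < k₀ → ContinuousOn s₁ (Ioi 0) →
      ContinuousOn s₂ (Ioi 0) → (∀ k, k₀ ≤ k → 0 < s₁ k) → (∀ k, k₀ ≤ k → 0 < s₂ k) →
      s₂ k₀ ≤ s₁ k₀ → (∀ k, a * |M₁| ≤ k * R₁ → k₀ ≤ k → s₁ k = R₁) →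
      (∀ k, a * |M₂| ≤ k * R₂ → k₀ ≤ k → s₂ k = R₂) → ∃ k, k₀ ≤ k ∧ s₁ k ≤ s₂ k ∧
        |powerArc M₂ R₂ a (s₂ k) - powerArc M₁ R₁ (-a) (s₁ k)| = k * (s₂ k - s₁ k) := by
    intro s₁ s₂ k₀ hk₀ c₁ c₂ p₁ p₂ hle e₁ e₂
    set K := max (max k₀ (a * |M₁| / R₁)) (max (a * |M₂| / R₂) ((|M₁| + |M₂|) / (R₂ - R₁))) with hK
    have K0 : k₀ ≤ K := (le_max_left _ _).trans (le_max_left _ _)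
    have K1 : a * |M₁| ≤ K * R₁ :=
      (div_le_iff₀ hR₁).1 ((le_max_right _ _).trans (le_max_left _ _))
    have K2 : a * |M₂| ≤ K * R₂ :=
      (div_le_iff₀ hR₂).1 ((le_max_left _ _).trans (le_max_right _ _))
    have K3 : |M₁| + |M₂| ≤ K * (R₂ - R₁) :=
      (div_le_iff₀ hRR).1 ((le_max_right _ _).trans (le_max_right _ _))
    have arc : ∀ {c R b : ℝ} {s : ℝ → ℝ}, 0 < R → ContinuousOn s (Ioi 0) →
        (∀ k, k₀ ≤ k → 0 < s k) → ContinuousOn (fun k => powerArc c R b (s k)) (Icc k₀ K) := by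
      intro c R b s hR' hs hpos k hk
      exact (hasDerivAt_powerArc hR' (hpos k hk.1)).continuousAt.comp_continuousWithinAt
        ((hs k (hk₀.trans_le hk.1)).mono fun x hx => hk₀.trans_le hx.1)
    have hsub : Icc k₀ K ⊆ Ioi 0 := fun x hx => hk₀.trans_le hx.1
    have hG : ContinuousOn (fun k => k * (s₂ k - s₁ k)
        - |powerArc M₂ R₂ a (s₂ k) - powerArc M₁ R₁ (-a) (s₁ k)|) (Icc k₀ K) :=
      (continuousOn_id.mul ((c₂.mono hsub).sub (c₁.mono hsub))).sub
        ((arc hR₂ c₂ p₂).sub (arc hR₁ c₁ p₁)).abs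
    have start : k₀ * (s₂ k₀ - s₁ k₀)
        - |powerArc M₂ R₂ a (s₂ k₀) - powerArc M₁ R₁ (-a) (s₁ k₀)| ≤ 0 := by
      have : k₀ * (s₂ k₀ - s₁ k₀) ≤ 0 :=
        mul_nonpos_of_nonneg_of_nonpos hk₀.le (by linarith)
      linarith [abs_nonneg (powerArc M₂ R₂ a (s₂ k₀) - powerArc M₁ R₁ (-a) (s₁ k₀))]
    have finish : 0 ≤ K * (s₂ K - s₁ K)
        - |powerArc M₂ R₂ a (s₂ K) - powerArc M₁ R₁ (-a) (s₁ K)| := by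
      rw [e₁ K K1 K0, e₂ K K2 K0, powerArc_self hR₁, powerArc_self hR₂]
      have := abs_sub M₂ M₁
      linarith
    obtain ⟨k, hk, hk0⟩ := intermediate_value_Icc K0 hG ⟨start, finish⟩
    have hkpos : 0 < k := hk₀.trans_le hk.1
    simp only at hk0
    refine ⟨k, hk.1, ?_, by linarith⟩
    have h0 : 0 ≤ k * (s₂ k - s₁ k) := by
      linarith [abs_nonneg (powerArc M₂ R₂ a (s₂ k) - powerArc M₁ R₁ (-a) (s₁ k))]
    linarith [nonneg_of_mul_nonneg_right h0 hkpos]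
  by_cases hcase : a ≤ 1 ∨ M₂ = 0
  · -- there is no outer arc
    have right : ∀ k s, 0 ≤ k → R₁ ≤ s → a * |powerArc M₁ R₁ (-a) s| ≤ k * s →
        |M₂ - powerArc M₁ R₁ (-a) s| = k * (R₂ - s) → a * |powerArc M₂ R₂ a R₂| ≤ k * R₂ := by
      intro k s hk hs h1 h2
      rw [powerArc_self hR₂]
      rcases hcase with h | h
      · have h3 : |M₂| ≤ k * (R₂ - s) + |powerArc M₁ R₁ (-a) s| := by
          rw [← h2]
          linarith [abs_sub_abs_le_abs_sub M₂ (powerArc M₁ R₁ (-a) s)]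
        have h4 : 0 ≤ k * (R₂ - s) := h2 ▸ abs_nonneg _
        nlinarith [mul_le_mul_of_nonneg_left h3 ha.le]
      · rw [h, abs_zero, mul_zero]
        positivity
    by_cases hM₁ : M₁ = 0
    · have hm : |M₂ - powerArc M₁ R₁ (-a) R₁| = |M₂| / (R₂ - R₁) * (R₂ - R₁) := by
        rw [powerArc_self hR₁, hM₁, sub_zero]; field_simp
      have hl : a * |powerArc M₁ R₁ (-a) R₁| ≤ |M₂| / (R₂ - R₁) * R₁ := by
        rw [powerArc_self hR₁, hM₁, abs_zero, mul_zero]; positivity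
      exact nonempty_of_abs_eq (s₁ := R₁) (s₂ := R₂) (k := |M₂| / (R₂ - R₁)) (by positivity)
        le_rfl hR.le le_rfl hl (fun h => absurd h (lt_irrefl _))
        (right _ _ (by positivity) le_rfl hl hm) (fun h => absurd h (lt_irrefl _))
        (fun h => absurd h (lt_irrefl _)) (by rw [powerArc_self hR₂]; exact hm)
    · obtain ⟨s₁, c₁, H⟩ := exists_left_transition (M₁ := M₁) ha hR₁ hR
      have hpos : 0 < |powerArc M₁ R₁ (-a) R₂| :=
        abs_pos.2 (mul_ne_zero hM₁ (Real.rpow_pos_of_pos (by positivity) _).ne')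
      set k₀ := a * |powerArc M₁ R₁ (-a) R₂| / R₂ with hk₀
      have hk₀pos : 0 < k₀ := by positivity
      have cond : ∀ k, k₀ ≤ k → a * |powerArc M₁ R₁ (-a) R₂| ≤ k * R₂ := fun k hk =>
        (div_le_iff₀ hR₂).1 hk
      have eq₀ : s₁ k₀ = R₂ := (H k₀ hk₀pos (cond k₀ le_rfl)).2.2.2.2.1 (by rw [hk₀]; field_simp)
      obtain ⟨k, hk, hle, hm⟩ := ivt s₁ (fun _ => R₂) k₀ hk₀pos c₁ continuousOn_const
        (fun k hk => hR₁.trans_le (H k (hk₀pos.trans_le hk) (cond k hk)).1) (fun _ _ => hR₂)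
        eq₀.ge (fun k h hk => (H k (hk₀pos.trans_le hk) (cond k hk)).2.2.2.2.2 h) fun _ _ _ => rfl
      have hkpos := hk₀pos.trans_le hk
      obtain ⟨g1, g2, g3, g4, -, -⟩ := H k hkpos (cond k hk)
      simp only [powerArc_self hR₂] at hm
      exact nonempty_of_abs_eq hkpos.le g1 g2 le_rfl g3 g4 (right _ _ hkpos.le g1 g3 hm)
        (fun h => absurd h (lt_irrefl _)) (fun h => absurd h (lt_irrefl _))
        (by rw [powerArc_self hR₂]; exact hm)
  · rw [not_or, not_le] at hcase
    obtain ⟨ha1, hM₂⟩ := hcase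
    obtain ⟨s₁, c₁, H₁⟩ := exists_left_transition (M₁ := M₁) ha hR₁ hR
    obtain ⟨s₂, c₂, H₂⟩ := exists_right_transition (M₂ := M₂) ha1 hM₂ hR₁ hR
    have hpos : 0 < |powerArc M₂ R₂ a R₁| :=
      abs_pos.2 (mul_ne_zero hM₂ (Real.rpow_pos_of_pos (by positivity) _).ne')
    set k₀ := max (a * |powerArc M₁ R₁ (-a) R₂| / R₂) (a * |powerArc M₂ R₂ a R₁| / R₁) with hk₀
    have hk₀pos : 0 < k₀ := lt_max_of_lt_right (by positivity)
    have cond₁ : ∀ k, k₀ ≤ k → a * |powerArc M₁ R₁ (-a) R₂| ≤ k * R₂ := fun k hk =>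
      (div_le_iff₀ hR₂).1 ((le_max_left _ _).trans hk)
    have cond₂ : ∀ k, k₀ ≤ k → a * |powerArc M₂ R₂ a R₁| ≤ k * R₁ := fun k hk =>
      (div_le_iff₀ hR₁).1 ((le_max_right _ _).trans hk)
    have G₁ := H₁ k₀ hk₀pos (cond₁ k₀ le_rfl)
    have G₂ := H₂ k₀ hk₀pos (cond₂ k₀ le_rfl)
    have start : s₂ k₀ ≤ s₁ k₀ := by
      rcases max_choice (a * |powerArc M₁ R₁ (-a) R₂| / R₂) (a * |powerArc M₂ R₂ a R₁| / R₁)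
        with h | h
      · rw [G₁.2.2.2.2.1 (by rw [hk₀, h]; field_simp)]
        exact G₂.2.1
      · rw [G₂.2.2.2.2.1 (by rw [hk₀, h]; field_simp)]
        exact G₁.1
    obtain ⟨k, hk, hle, hm⟩ := ivt s₁ s₂ k₀ hk₀pos c₁ c₂
      (fun k hk => hR₁.trans_le (H₁ k (hk₀pos.trans_le hk) (cond₁ k hk)).1)
      (fun k hk => hR₁.trans_le (H₂ k (hk₀pos.trans_le hk) (cond₂ k hk)).1) start
      (fun k h hk => (H₁ k (hk₀pos.trans_le hk) (cond₁ k hk)).2.2.2.2.2 h)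
      (fun k h hk => (H₂ k (hk₀pos.trans_le hk) (cond₂ k hk)).2.2.2.2.2 h)
    have hkpos := hk₀pos.trans_le hk
    obtain ⟨g1, g2, g3, g4, -, -⟩ := H₁ k hkpos (cond₁ k hk)
    obtain ⟨f1, f2, f3, f4, -, -⟩ := H₂ k hkpos (cond₂ k hk)
    exact nonempty_of_abs_eq hkpos.le g1 hle f2 g3 g4 f3 f4 (fun _ => ha1) hm

end

namespace ClosedCover

/-! ### Uniqueness of the tight profile -/

namespace IsTightProfile

variable {α R₁ R₂ M₁ M₂ : ℝ} {ψ : ℝ → ℝ}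

/-- The barrier, made of the inner arc and an increasing line, has the slope bound `bound`. Where a
tight profile exceeds it, the barrier is an admissible replacement. -/
theorem angular_le_bound_of_le_one (hα : α ≠ 0) (hR₁ : 0 < R₁) (hR : R₁ < R₂)
    (h : IsTightProfile α R₁ R₂ ψ) (e₁ : ψ R₁ = M₁) (e₂ : ψ R₂ = M₂)
    (T : Transition |α| M₁ M₂ R₁ R₂) (ha1 : |α| ≤ 1) {x : ℝ} (hx : x ∈ Icc R₁ R₂) :
    |α| * ψ x ≤ T.bound x * x := by
  have ha : 0 < |α| := abs_pos.2 hα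
  have hR₂ : 0 < R₂ := hR₁.trans hR
  have hs₂ : T.s₂ = R₂ := T.s₂_le.eq_of_not_lt fun hlt => absurd (T.one_lt hlt) (not_lt.2 ha1)
  have hs₁R₂ : T.s₁ ≤ R₂ := T.s₁_le_s₂.trans T.s₂_le
  set D := powerArc M₁ R₁ (-|α|) with hD
  set W : ℝ → ℝ := fun x => if x ≤ T.s₁ then |D x| else |D T.s₁| + |T.slope| * (x - T.s₁) with hW
  have W_left : ∀ {y}, y ≤ T.s₁ → W y = |D y| := fun hy => if_pos hy
  have W_right : ∀ {y}, T.s₁ ≤ y → W y = |D T.s₁| + |T.slope| * (y - T.s₁) := by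
    intro y hy
    rcases hy.eq_or_lt with rfl | hy
    · rw [W_left le_rfl]; ring
    · exact if_neg (not_le.2 hy)
  have hWb : HasSlopeBound |α| W T.bound R₁ R₂ := by
    have right : HasSlopeBound |α| W T.bound T.s₁ R₂ := by
      refine (hasSlopeBound_line (f := W) (k := |T.slope|) ha.le ?_ ?_ ?_).congr
        (fun _ _ => rfl) fun y hy => ?_
      · intro y hy z hz
        rw [W_right hy.1, W_right hz.1]
        ring
      · rw [W_left le_rfl, abs_abs, abs_abs]; exact T.left_le
      · rw [W_right hs₁R₂, abs_abs, abs_of_nonneg (add_nonneg (abs_nonneg _)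
          (mul_nonneg (abs_nonneg _) (sub_nonneg.2 hs₁R₂)))]
        have h1 := T.left_le
        have h2 : 0 ≤ |T.slope| * (R₂ - T.s₁) :=
          mul_nonneg (abs_nonneg _) (sub_nonneg.2 hs₁R₂)
        nlinarith
      · rw [T.bound_mid hy.1 (hy.2.trans hs₂.ge), abs_abs]
    rcases T.le_s₁.eq_or_lt with h1 | h1
    · exact right.mono h1.ge le_rfl
    · refine HasSlopeBound.union ?_ right T.le_s₁ hs₁R₂
      have := (hasSlopeBound_powerArc (c := M₁) (b := -|α|) hR₁ (t := T.s₁) hR₁).abs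
      rw [abs_neg, abs_of_pos ha] at this
      exact this.congr (fun y hy => (W_left hy.2).symm)
        fun y hy => (T.bound_left hR₁ h1 hy.2).symm
  suffices hle : ψ x ≤ W x by
    calc |α| * ψ x ≤ |α| * |W x| := by gcongr; exact hle.trans (le_abs_self _)
      _ ≤ _ := hWb.angular x hx
  by_contra! hlt
  have hWc : ContinuousOn W (Icc R₁ R₂) := by
    obtain ⟨K, -, hK, -⟩ := hWb.exists_bound hR₁.le
    exact hK.continuousOn
  have hW₁ : ψ R₁ ≤ W R₁ := by
    rw [W_left T.le_s₁, hD, powerArc_self hR₁, e₁]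
    exact le_abs_self _
  have hW₂ : ψ R₂ ≤ W R₂ := by
    have hm := T.matching
    rw [hs₂, powerArc_self hR₂] at hm
    rw [W_right hs₁R₂, e₂]
    have h1 := mul_le_mul_of_nonneg_right (le_abs_self T.slope) (sub_nonneg.2 hs₁R₂)
    have h2 := le_abs_self (D T.s₁)
    linarith
  obtain ⟨t₁, t₂, h1, h2, h3, h4, h5, h6, h7⟩ := exists_Ioo_pos_of_pos
    ((h.continuousOn hR₁).sub hWc) hx (sub_nonpos.2 hW₁) (sub_nonpos.2 hW₂) (sub_pos.2 hlt)
  have h5' : ψ t₁ = W t₁ := sub_eq_zero.1 h5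
  have h6' : ψ t₂ = W t₂ := sub_eq_zero.1 h6
  have h7' : ∀ y ∈ Ioo t₁ t₂, W y < ψ y := fun y hy => sub_pos.1 (h7 y hy)
  have hWψ : ∀ y ∈ Icc t₁ t₂, W y ≤ ψ y := by
    intro y hy
    rcases hy.1.eq_or_lt with rfl | hy1
    · exact h5'.ge
    rcases hy.2.eq_or_lt with rfl | hy2
    · exact h6'.ge
    exact (h7' y ⟨hy1, hy2⟩).le
  have h12 : t₁ < t₂ := h2.trans h3
  rcases le_or_gt T.s₁ t₁ with hst | hst
  · -- the interval lies in the part where the barrier is a line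
    have b₁ : T.bound t₁ = |T.slope| := T.bound_mid hst (by rw [hs₂]; linarith)
    have b₂ : T.bound t₂ = |T.slope| := T.bound_mid (hst.trans h12.le) (by rw [hs₂]; linarith)
    have a₁ := hWb.angular t₁ ⟨h1, by linarith⟩
    have a₂ := hWb.angular t₂ ⟨by linarith, h4⟩
    have := h.eq_chord hR₁ hα (k := |T.slope|) h1 h4
      (by rw [h5', h6', W_right hst, W_right (hst.trans h12.le)]; ring)
      (by rw [abs_abs, h5', ← b₁]; exact a₁) (by rw [abs_abs, h6', ← b₂]; exact a₂)
      (x := x) ⟨h2.le, h3.le⟩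
    rw [W_right (hst.trans h2.le)] at hlt
    rw [h5', W_right hst] at this
    linarith
  · -- on the inner arc the barrier has smaller local Lipschitz constant than `ψ`
    have hr1 : t₁ < (t₁ + min t₂ T.s₁) / 2 := by
      have := lt_min h12 hst
      linarith
    have hr2 : (t₁ + min t₂ T.s₁) / 2 < min t₂ T.s₁ := by
      have := lt_min h12 hst
      linarith
    set r := (t₁ + min t₂ T.s₁) / 2
    have hrt : r ∈ Ioo t₁ t₂ := ⟨hr1, hr2.trans_le (min_le_left _ _)⟩
    have hrs : r < T.s₁ := hr2.trans_le (min_le_right _ _)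
    have hr0 : 0 < r := hR₁.trans_le (h1.trans hr1.le)
    have hb : ∀ y, 0 < y → y < T.s₁ → T.bound y * y = |α| * W y := by
      intro y hy hys
      rw [Transition.bound, if_pos hys, W_left hys.le]
      field_simp
      rfl
    have h8 := h.angular_le_of_replacement hR₁ hα h1 h12 h4 (hWb.mono h1 h4) h5'.symm h6'.symm
      (S := |T.slope|) (fun y hy => ?_) hrt
    · rw [max_eq_left (T.slope_le_bound ha hR₁ ⟨h1.trans hr1.le, by linarith [hrt.2]⟩),
        hb r hr0 hrs] at h8
      have h9 := h7' r hrt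
      have h10 := mul_lt_mul_of_pos_left h9 ha
      have h11 := mul_le_mul_of_nonneg_left (le_abs_self (ψ r)) ha.le
      linarith
    · rcases lt_or_ge y T.s₁ with hys | hys
      · right
        rw [hb y (hR₁.trans_le (h1.trans hy.1)) hys]
        gcongr
        exact (hWψ y hy).trans (le_abs_self _)
      · left
        rw [T.bound_mid hys (by rw [hs₂]; exact hy.2.trans h4)]

/-- The barrier is the larger of the absolute values of the two arcs. Its slope bound is its angular
stretching, so that it is an admissible replacement wherever a tight profile exceeds it. -/
theorem angular_le_bound_of_one_lt (hα : α ≠ 0) (hR₁ : 0 < R₁) (hR : R₁ < R₂)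
    (h : IsTightProfile α R₁ R₂ ψ) (e₁ : ψ R₁ = M₁) (e₂ : ψ R₂ = M₂)
    (T : Transition |α| M₁ M₂ R₁ R₂) (ha1 : 1 < |α|) {x : ℝ} (hx : x ∈ Icc R₁ R₂) :
    |α| * ψ x ≤ T.bound x * x := by
  have ha : 0 < |α| := abs_pos.2 hα
  have hR₂ : 0 < R₂ := hR₁.trans hR
  have hx0 : 0 < x := hR₁.trans_le hx.1
  have hs₁ : 0 < T.s₁ := hR₁.trans_le T.le_s₁
  set D := powerArc M₁ R₁ (-|α|) with hD
  set U := powerArc M₂ R₂ |α| with hU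
  have hDb : |α| * |D x| ≤ T.bound x * x := by
    rcases lt_or_ge x T.s₁ with hxs | hxs
    · rw [Transition.bound, if_pos hxs]
      field_simp
      exact le_rfl
    · calc |α| * |D x| ≤ |α| * |D T.s₁| :=
            mul_le_mul_of_nonneg_left (abs_powerArc_anti hR₁ (neg_nonpos.2 ha.le) hs₁ hxs) ha.le
        _ ≤ |T.slope| * T.s₁ := T.left_le
        _ ≤ T.bound x * x := by
          have := T.slope_le_bound ha hR₁ hx
          have := (abs_nonneg T.slope).trans this
          gcongr
  have hUb : |α| * |U x| ≤ T.bound x * x := by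
    rcases le_or_gt x T.s₂ with hxs | hxs
    · have hs₂ : 0 < T.s₂ := hx0.trans_le hxs
      have h1 := abs_powerArc_div_mono (c := M₂) hR₂ ha1.le hx0 hxs
      have h2 : |α| * (|powerArc M₂ R₂ |α| T.s₂| / T.s₂) ≤ |T.slope| := by
        rw [← mul_div_assoc, div_le_iff₀ hs₂]
        exact T.right_le
      calc |α| * |U x| = |α| * (|U x| / x) * x := by field_simp
        _ ≤ |α| * (|powerArc M₂ R₂ |α| T.s₂| / T.s₂) * x := by gcongr
        _ ≤ |T.slope| * x := by gcongr
        _ ≤ _ := by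
          have := T.slope_le_bound ha hR₁ hx
          gcongr
    · rw [T.bound_right hR₁ (hxs.trans_le hx.2) hxs.le]
      field_simp
      exact le_rfl
  set W : ℝ → ℝ := fun x => max |D x| |U x| with hW
  suffices hle : ψ x ≤ W x by
    rcases max_choice |D x| |U x| with hc | hc <;> simp only [hW, hc] at hle
    · exact (mul_le_mul_of_nonneg_left hle ha.le).trans hDb
    · exact (mul_le_mul_of_nonneg_left hle ha.le).trans hUb
  by_contra! hlt
  have hWb : HasSlopeBound |α| W (fun r => max (|α| * |D r| / r) (|α| * |U r| / r)) R₁ R₂ := by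
    have b₁ := (hasSlopeBound_powerArc (c := M₁) (b := -|α|) hR₁ (t := R₂) hR₁).abs
    have b₂ := (hasSlopeBound_powerArc (c := M₂) (b := |α|) hR₂ (t := R₂) hR₁).abs
    rw [abs_neg, abs_abs] at b₁
    rw [abs_abs] at b₂
    exact b₁.sup hR₁.le b₂
  have hG : ∀ y, 0 < y → max (|α| * |D y| / y) (|α| * |U y| / y) * y = |α| * W y := by
    intro y hy
    rw [max_mul_of_nonneg _ _ hy.le, div_mul_cancel₀ _ hy.ne', div_mul_cancel₀ _ hy.ne',
      ← mul_max_of_nonneg _ _ ha.le]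
  have hWc : ContinuousOn W (Icc R₁ R₂) := by
    obtain ⟨K, -, hK, -⟩ := hWb.exists_bound hR₁.le
    exact hK.continuousOn
  have hW₁ : ψ R₁ ≤ W R₁ := by
    refine le_max_of_le_left ?_
    rw [hD, powerArc_self hR₁, e₁]
    exact le_abs_self _
  have hW₂ : ψ R₂ ≤ W R₂ := by
    refine le_max_of_le_right ?_
    rw [hU, powerArc_self hR₂, e₂]
    exact le_abs_self _
  obtain ⟨t₁, t₂, h1, h2, h3, h4, h5, h6, h7⟩ := exists_Ioo_pos_of_pos
    ((h.continuousOn hR₁).sub hWc) hx (sub_nonpos.2 hW₁) (sub_nonpos.2 hW₂) (sub_pos.2 hlt)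
  have h5' : ψ t₁ = W t₁ := sub_eq_zero.1 h5
  have h6' : ψ t₂ = W t₂ := sub_eq_zero.1 h6
  have hWψ : ∀ y ∈ Icc t₁ t₂, W y ≤ ψ y := by
    intro y hy
    rcases hy.1.eq_or_lt with rfl | hy1
    · exact h5'.ge
    rcases hy.2.eq_or_lt with rfl | hy2
    · exact h6'.ge
    exact (sub_pos.1 (h7 y ⟨hy1, hy2⟩)).le
  have h8 := h.angular_le_of_replacement hR₁ hα h1 (h2.trans h3) h4 (hWb.mono h1 h4) h5'.symm
    h6'.symm (S := 0) (fun y hy => Or.inr ?_) (r := x) ⟨h2, h3⟩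
  · rw [max_eq_left (by positivity), hG x hx0] at h8
    have h10 := mul_lt_mul_of_pos_left hlt ha
    have h11 := mul_le_mul_of_nonneg_left (le_abs_self (ψ x)) ha.le
    linarith
  · rw [hG y (hR₁.trans_le (h1.trans hy.1))]
    gcongr
    exact (hWψ y hy).trans (le_abs_self _)

/-- The angular stretching of a tight profile is at most the local Lipschitz constant of the
solution. -/
theorem angular_le_bound (hα : α ≠ 0) (hR₁ : 0 < R₁) (hR : R₁ < R₂)
    (h : IsTightProfile α R₁ R₂ ψ) (e₁ : ψ R₁ = M₁) (e₂ : ψ R₂ = M₂)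
    (T : Transition |α| M₁ M₂ R₁ R₂) {x : ℝ} (hx : x ∈ Icc R₁ R₂) :
    |α| * |ψ x| ≤ T.bound x * x := by
  have key : ∀ {M₁ M₂ : ℝ} {ψ : ℝ → ℝ} (T : Transition |α| M₁ M₂ R₁ R₂),
      IsTightProfile α R₁ R₂ ψ → ψ R₁ = M₁ → ψ R₂ = M₂ → |α| * ψ x ≤ T.bound x * x := by
    intro M₁ M₂ ψ T h e₁ e₂
    rcases le_or_gt |α| 1 with ha | ha
    · exact h.angular_le_bound_of_le_one hα hR₁ hR e₁ e₂ T ha hx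
    · exact h.angular_le_bound_of_one_lt hα hR₁ hR e₁ e₂ T ha hx
  rcases abs_cases (ψ x) with ⟨hc, -⟩ | ⟨hc, -⟩ <;> rw [hc]
  · exact key T h e₁ e₂
  · rw [← T.bound_neg]
    exact key T.neg h.neg (by rw [e₁]) (by rw [e₂])

/-- Comparison from below on an interval where the profile given by the transition is convex. -/
theorem profile_le (hα : α ≠ 0) (hR₁ : 0 < R₁) (hR : R₁ < R₂)
    (h : IsTightProfile α R₁ R₂ ψ) (e₁ : ψ R₁ = M₁) (e₂ : ψ R₂ = M₂)
    (T : Transition |α| M₁ M₂ R₁ R₂) {t₁ t₂ : ℝ} (h₁ : t₁ = T.s₁ ∨ t₁ = R₁ ∧ 0 ≤ M₁)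
    (h₂ : t₂ = T.s₂ ∨ t₂ = R₂ ∧ 0 ≤ M₂) (f₁ : T.profile t₁ ≤ ψ t₁) (f₂ : T.profile t₂ ≤ ψ t₂)
    {x : ℝ} (hx : x ∈ Icc t₁ t₂) : T.profile x ≤ ψ x := by
  have ha : 0 < |α| := abs_pos.2 hα
  have hR₂ : 0 < R₂ := hR₁.trans hR
  have ht₁ : R₁ ≤ t₁ := by
    rcases h₁ with h | h
    · rw [h]; exact T.le_s₁
    · exact h.1.ge
  have ht₂ : t₂ ≤ R₂ := by
    rcases h₂ with h | h
    · rw [h]; exact T.s₂_le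
    · exact h.1.le
  have hs₁ : 0 < T.s₁ := hR₁.trans_le T.le_s₁
  have hs₂ : 0 < T.s₂ := hs₁.trans_le T.s₁_le_s₂
  have left : ∀ y ∈ Ioo t₁ t₂, y ≤ T.s₁ → R₁ < T.s₁ ∧ 0 ≤ M₁ := by
    intro y hy hys
    rcases h₁ with h | h
    · exact absurd hy.1 (not_lt.2 (hys.trans h.ge))
    · exact ⟨h.1.ge.trans_lt (hy.1.trans_le hys), h.2⟩
  have right : ∀ y, y < t₂ → T.s₂ ≤ y → T.s₂ < R₂ ∧ 0 ≤ M₂ := by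
    intro y hy hys
    rcases h₂ with h | h
    · exact absurd hy (not_lt.2 (h.le.trans hys))
    · exact ⟨hys.trans_lt (hy.trans_le ht₂), h.2⟩
  -- tangents of the two arcs
  have tanD : 0 ≤ M₁ → R₁ < T.s₁ → ∀ y, 0 < y → y ≤ T.s₁ → ∀ z, 0 < z →
      powerArc M₁ R₁ (-|α|) y + -T.bound y * (z - y) ≤ powerArc M₁ R₁ (-|α|) z := by
    intro hM hlt y hy hys z hz
    rw [T.bound_left hR₁ hlt hys, abs_of_nonneg (powerArc_nonneg hR₁ hM hy.le)]
    refine le_trans (le_of_eq ?_)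
      (powerArc_tangent_le hR₁ hM (Or.inl (neg_nonpos.2 ha.le)) hy hz)
    ring
  have tanU : 0 ≤ M₂ → T.s₂ < R₂ → ∀ y, T.s₂ ≤ y → ∀ z, 0 < z →
      powerArc M₂ R₂ |α| y + T.bound y * (z - y) ≤ powerArc M₂ R₂ |α| z := by
    intro hM hlt y hys z hz
    have hy : 0 < y := hs₂.trans_le hys
    rw [T.bound_right hR₁ hlt hys, abs_of_nonneg (powerArc_nonneg hR₂ hM hy.le)]
    exact powerArc_tangent_le hR₂ hM (Or.inr (T.one_lt hlt).le) hy hz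
  have mid : ∀ y, T.s₁ ≤ y → y ≤ T.s₂ → T.profile y = T.profile T.s₁ + T.slope * (y - T.s₁) := by
    intro y hy hy'
    rw [T.profile_mid hy hy', T.profile_left le_rfl]
  -- beyond `s₂` the profile stays above the line of slope `|slope|`, if it is met at all
  have beyond : ∀ y, T.s₂ ≤ y → y < t₂ →
      T.profile T.s₂ + |T.slope| * (y - T.s₂) ≤ T.profile y := by
    intro y hy hyt
    obtain ⟨r1, r2⟩ := right y hyt hy
    have := tanU r2 r1 T.s₂ le_rfl y (hs₂.trans_le hy)
    rwa [T.bound_mid T.s₁_le_s₂ le_rfl, ← T.profile_right le_rfl, ← T.profile_right hy] at this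
  have hb : ∀ y ∈ Ioo t₁ t₂, |T.slope| ≤ T.bound y := fun y hy =>
    T.slope_le_bound ha hR₁ ⟨ht₁.trans hy.1.le, hy.2.le.trans ht₂⟩
  have hbc : ContinuousOn T.profile (Icc R₁ R₂) := by
    obtain ⟨K, -, hK, -⟩ := (T.hasSlopeBound ha hR₁ hR).exists_bound hR₁.le
    exact hK.continuousOn
  refine h.le_of_subgradient hR₁ hα (t₁ := t₁) (t₂ := t₂)
    (m := if T.slope < 0 then T.s₂ else T.s₁) (Φ := T.profile)
    (P := fun y => if y ≤ T.s₁ then -T.bound y else if y ≤ T.s₂ then T.slope else T.bound y)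
    ht₁ ht₂ (hbc.mono (Icc_subset_Icc ht₁ ht₂)) (fun y hy => ?_) (fun y hy => ?_)
    (fun y hy hym => ?_) (fun y hy hym => ?_) f₁ f₂ hx
  · have hy0 : 0 < y := hR₁.trans (ht₁.trans_lt hy.1)
    have hlt₂ : ∀ᶠ z in 𝓝 y, z < t₂ := gt_mem_nhds hy.2
    rcases lt_trichotomy y T.s₁ with hys | rfl | hys
    · obtain ⟨l1, l2⟩ := left y hy hys.le
      filter_upwards [gt_mem_nhds hys, lt_mem_nhds hy0] with z hz hz0
      rw [if_pos hys.le, T.profile_left hys.le, T.profile_left hz.le]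
      exact tanD l2 l1 y hy0 hys.le z hz0
    · obtain ⟨l1, l2⟩ := left _ hy le_rfl
      filter_upwards [lt_mem_nhds hy0, hlt₂] with z hz0 hz₂
      rw [if_pos le_rfl]
      rcases le_total z T.s₁ with hz | hz
      · rw [T.profile_left le_rfl, T.profile_left hz]
        exact tanD l2 l1 _ hy0 le_rfl z hz0
      rw [T.bound_mid le_rfl T.s₁_le_s₂]
      have n1 := neg_abs_le T.slope
      have n2 := abs_nonneg T.slope
      rcases le_total z T.s₂ with hz' | hz'
      · rw [mid z hz hz']
        nlinarith
      · have g1 := beyond z hz' hz₂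
        rw [mid T.s₂ T.s₁_le_s₂ le_rfl] at g1
        have g2 : -|T.slope| * (T.s₂ - T.s₁) ≤ T.slope * (T.s₂ - T.s₁) :=
          mul_le_mul_of_nonneg_right n1 (sub_nonneg.2 T.s₁_le_s₂)
        have g3 : -|T.slope| * (z - T.s₂) ≤ |T.slope| * (z - T.s₂) :=
          mul_le_mul_of_nonneg_right (by linarith) (sub_nonneg.2 hz')
        linarith
    rcases lt_trichotomy y T.s₂ with hys' | rfl | hys'
    · filter_upwards [lt_mem_nhds hys, gt_mem_nhds hys'] with z hz hz'
      rw [if_neg (not_le.2 hys), if_pos hys'.le, mid y hys.le hys'.le, mid z hz.le hz'.le]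
      exact le_of_eq (by ring)
    · filter_upwards [lt_mem_nhds hys, hlt₂] with z hz hz₂
      rw [if_neg (not_le.2 hys), if_pos le_rfl]
      rcases le_total z T.s₂ with hz' | hz'
      · rw [mid z hz.le hz', mid T.s₂ T.s₁_le_s₂ le_rfl]
        exact le_of_eq (by ring)
      · refine le_trans ?_ (beyond z hz' hz₂)
        have := sub_nonneg.2 hz'
        gcongr
        exact le_abs_self _
    · obtain ⟨r1, r2⟩ := right y hy.2 hys'.le
      filter_upwards [lt_mem_nhds hys'] with z hz
      rw [if_neg (not_le.2 hys), if_neg (not_le.2 hys'), T.profile_right hys'.le,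
        T.profile_right hz.le]
      exact tanU r2 r1 y hys'.le z (hs₂.trans hz)
  · have hyR : y ∈ Icc R₁ R₂ := ⟨ht₁.trans hy.1.le, hy.2.le.trans ht₂⟩
    refine (h.angular_le_bound hα hR₁ hR e₁ e₂ T hyR).trans (le_of_eq ?_)
    congr 1
    have hbn : 0 ≤ T.bound y := (abs_nonneg _).trans (hb y hy)
    split_ifs with i1 i2
    · rw [abs_neg, abs_of_nonneg hbn]
    · exact T.bound_mid (not_le.1 i1).le i2
    · rw [abs_of_nonneg hbn]
  · have hbn : 0 ≤ T.bound y := (abs_nonneg _).trans (hb y hy)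
    have := T.s₁_le_s₂
    split_ifs at hym ⊢ <;> linarith
  · have hbn : 0 ≤ T.bound y := (abs_nonneg _).trans (hb y hy)
    have := T.s₁_le_s₂
    split_ifs at hym ⊢ <;> linarith

/-- The bound for the angular stretching gives the upper estimate on the arc, and comparison with
the convex part of the solution gives the lower one. -/
theorem eq_profile_left (hα : α ≠ 0) (hR₁ : 0 < R₁) (hR : R₁ < R₂)
    (h : IsTightProfile α R₁ R₂ ψ) (e₁ : ψ R₁ = M₁) (e₂ : ψ R₂ = M₂)
    (T : Transition |α| M₁ M₂ R₁ R₂) (hM : 0 ≤ M₁) {x : ℝ} (hx : x ∈ Icc R₁ T.s₁) :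
    ψ x = T.profile x := by
  have ha : 0 < |α| := abs_pos.2 hα
  have hR₂ : 0 < R₂ := hR₁.trans hR
  have hs₁ : 0 < T.s₁ := hR₁.trans_le T.le_s₁
  have hs₂ : 0 < T.s₂ := hs₁.trans_le T.s₁_le_s₂
  have g₁ : T.profile R₁ = ψ R₁ := by
    rw [T.profile_left T.le_s₁, powerArc_self hR₁, e₁]
  rcases T.le_s₁.eq_or_lt with hlt | hlt
  · rw [show x = R₁ from le_antisymm (hx.2.trans hlt.ge) hx.1, g₁]
  have hx0 : 0 < x := hR₁.trans_le hx.1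
  have hx2 : x ≤ T.s₂ := hx.2.trans T.s₁_le_s₂
  refine le_antisymm ?_ ?_
  · have h1 := h.angular_le_bound hα hR₁ hR e₁ e₂ T ⟨hx.1, hx2.trans T.s₂_le⟩
    rw [T.bound_left hR₁ hlt hx.2, div_mul_cancel₀ _ hx0.ne', mul_le_mul_iff_right₀ ha,
      abs_of_nonneg (powerArc_nonneg hR₁ hM hx0.le)] at h1
    rw [T.profile_left hx.2]
    exact (le_abs_self _).trans h1
  rcases T.s₂_le.eq_or_lt with hs | hs
  · refine h.profile_le hα hR₁ hR e₁ e₂ T (Or.inr ⟨rfl, hM⟩) (Or.inl rfl) g₁.le ?_ ⟨hx.1, hx2⟩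
    rw [T.profile_right le_rfl, hs, powerArc_self hR₂, e₂]
  rcases le_total M₂ 0 with hM₂ | hM₂
  · refine h.profile_le hα hR₁ hR e₁ e₂ T (Or.inr ⟨rfl, hM⟩) (Or.inl rfl) g₁.le ?_ ⟨hx.1, hx2⟩
    have h1 := h.angular_le_bound hα hR₁ hR e₁ e₂ T ⟨T.le_s₁.trans T.s₁_le_s₂, T.s₂_le⟩
    rw [T.bound_right hR₁ hs le_rfl, div_mul_cancel₀ _ hs₂.ne', mul_le_mul_iff_right₀ ha,
      abs_of_nonpos (powerArc_nonpos hR₂ hM₂ hs₂.le)] at h1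
    rw [T.profile_right le_rfl]
    linarith [neg_abs_le (ψ T.s₂)]
  · refine h.profile_le hα hR₁ hR e₁ e₂ T (Or.inr ⟨rfl, hM⟩) (Or.inr ⟨rfl, hM₂⟩) g₁.le ?_
      ⟨hx.1, hx2.trans T.s₂_le⟩
    rw [T.profile_right hs.le, powerArc_self hR₂, e₂]

theorem eq_profile_right (hα : α ≠ 0) (hR₁ : 0 < R₁) (hR : R₁ < R₂)
    (h : IsTightProfile α R₁ R₂ ψ) (e₁ : ψ R₁ = M₁) (e₂ : ψ R₂ = M₂)
    (T : Transition |α| M₁ M₂ R₁ R₂) (hM : 0 ≤ M₂) {x : ℝ} (hx : x ∈ Icc T.s₂ R₂) :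
    ψ x = T.profile x := by
  have ha : 0 < |α| := abs_pos.2 hα
  have hR₂ : 0 < R₂ := hR₁.trans hR
  have hs₁ : 0 < T.s₁ := hR₁.trans_le T.le_s₁
  have g₂ : T.profile R₂ = ψ R₂ := by
    rw [T.profile_right T.s₂_le, powerArc_self hR₂, e₂]
  rcases T.s₂_le.eq_or_lt with hlt | hlt
  · rw [show x = R₂ from le_antisymm hx.2 (hlt.ge.trans hx.1), g₂]
  have hx1 : T.s₁ ≤ x := T.s₁_le_s₂.trans hx.1
  have hx0 : 0 < x := hs₁.trans_le hx1
  refine le_antisymm ?_ ?_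
  · have h1 := h.angular_le_bound hα hR₁ hR e₁ e₂ T ⟨T.le_s₁.trans hx1, hx.2⟩
    rw [T.bound_right hR₁ hlt hx.1, div_mul_cancel₀ _ hx0.ne', mul_le_mul_iff_right₀ ha,
      abs_of_nonneg (powerArc_nonneg hR₂ hM hx0.le)] at h1
    rw [T.profile_right hx.1]
    exact (le_abs_self _).trans h1
  rcases T.le_s₁.eq_or_lt with hs | hs
  · refine h.profile_le hα hR₁ hR e₁ e₂ T (Or.inl rfl) (Or.inr ⟨rfl, hM⟩) ?_ g₂.le ⟨hx1, hx.2⟩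
    rw [T.profile_left le_rfl, ← hs, powerArc_self hR₁, e₁]
  rcases le_total M₁ 0 with hM₁ | hM₁
  · refine h.profile_le hα hR₁ hR e₁ e₂ T (Or.inl rfl) (Or.inr ⟨rfl, hM⟩) ?_ g₂.le ⟨hx1, hx.2⟩
    have h1 := h.angular_le_bound hα hR₁ hR e₁ e₂ T ⟨T.le_s₁, T.s₁_le_s₂.trans T.s₂_le⟩
    rw [T.bound_left hR₁ hs le_rfl, div_mul_cancel₀ _ hs₁.ne', mul_le_mul_iff_right₀ ha,
      abs_of_nonpos (powerArc_nonpos hR₁ hM₁ hs₁.le)] at h1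
    rw [T.profile_left le_rfl]
    linarith [neg_abs_le (ψ T.s₁)]
  · refine h.profile_le hα hR₁ hR e₁ e₂ T (Or.inr ⟨rfl, hM₁⟩) (Or.inr ⟨rfl, hM⟩) ?_ g₂.le
      ⟨T.le_s₁.trans hx1, hx.2⟩
    rw [T.profile_left T.le_s₁, powerArc_self hR₁, e₁]

/-- Every tight profile with boundary values `M₁` and `M₂` is the profile given by the
transition. -/
theorem eq_profile (hα : α ≠ 0) (hR₁ : 0 < R₁) (hR : R₁ < R₂)
    (h : IsTightProfile α R₁ R₂ ψ) (e₁ : ψ R₁ = M₁) (e₂ : ψ R₂ = M₂)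
    (T : Transition |α| M₁ M₂ R₁ R₂) {x : ℝ} (hx : x ∈ Icc R₁ R₂) :
    ψ x = T.profile x := by
  have left : ∀ y ∈ Icc R₁ T.s₁, ψ y = T.profile y := by
    intro y hy
    rcases le_total 0 M₁ with hM | hM
    · exact h.eq_profile_left hα hR₁ hR e₁ e₂ T hM hy
    · have := h.neg.eq_profile_left hα hR₁ hR (by rw [e₁]) (by rw [e₂]) T.neg (by linarith) hy
      rwa [T.profile_neg, neg_inj] at this
  have right : ∀ y ∈ Icc T.s₂ R₂, ψ y = T.profile y := by
    intro y hy
    rcases le_total 0 M₂ with hM | hM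
    · exact h.eq_profile_right hα hR₁ hR e₁ e₂ T hM hy
    · have := h.neg.eq_profile_right hα hR₁ hR (by rw [e₁]) (by rw [e₂]) T.neg (by linarith) hy
      rwa [T.profile_neg, neg_inj] at this
  rcases le_total x T.s₁ with h1 | h1
  · exact left x ⟨hx.1, h1⟩
  rcases le_total T.s₂ x with h2 | h2
  · exact right x ⟨h2, hx.2⟩
  have v₁ : ψ T.s₁ = powerArc M₁ R₁ (-|α|) T.s₁ := by
    rw [left _ ⟨T.le_s₁, le_rfl⟩, T.profile_left le_rfl]
  have v₂ : ψ T.s₂ = powerArc M₂ R₂ |α| T.s₂ := by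
    rw [right _ ⟨le_rfl, T.s₂_le⟩, T.profile_right le_rfl]
  rw [T.profile_mid h1 h2, ← v₁]
  exact h.eq_chord hR₁ hα T.le_s₁ T.s₂_le (by rw [v₁, v₂, T.matching])
    (by rw [v₁]; exact T.left_le) (by rw [v₂]; exact T.right_le) ⟨h1, h2⟩

end IsTightProfile

end ClosedCover

/-! ### Rigidity of circles and segments -/

/-- Equality in the triangle inequality on the real axis. -/
theorem Complex.eq_ofReal_of_norm_le {z : ℂ} {x y : ℝ} (h₁ : ‖z‖ ≤ x)
    (h₂ : ‖((x + y : ℝ) : ℂ) - z‖ ≤ y) : z = x := by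
  have r1 : z.re ≤ x := (Complex.re_le_norm z).trans h₁
  have r2 : x + y - z.re ≤ y := by
    have := (Complex.re_le_norm _).trans h₂
    rwa [Complex.sub_re, Complex.ofReal_re] at this
  have r3 : z.re = x := by linarith
  have r4 : ‖z‖ ^ 2 ≤ x ^ 2 := by gcongr
  rw [Complex.sq_norm, Complex.normSq_apply, r3] at r4
  have r5 : z.im = 0 := by nlinarith [mul_self_nonneg z.im]
  exact Complex.ext (by rw [r3, Complex.ofReal_re]) (by rw [r5, Complex.ofReal_im])

/-- If the distances of `Z` from two points of a line through the origin are at most the distances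
of a point between them, then `Z` is that point. -/
theorem eq_polarMap_of_norm_le {Z : ℂ} {m x y θ : ℝ} (hxy : 0 ≤ x ∧ 0 ≤ y ∨ x ≤ 0 ∧ y ≤ 0)
    (h₁ : ‖Z - polarMap m θ‖ ≤ |x|) (h₂ : ‖polarMap (m + (x + y)) θ - Z‖ ≤ |y|) :
    Z = polarMap (m + x) θ := by
  have he : Complex.exp (θ * Complex.I) ≠ 0 := Complex.exp_ne_zero _
  have hn : ‖Complex.exp (θ * Complex.I)‖ = 1 := Complex.norm_exp_ofReal_mul_I θ
  set z : ℂ := Z / Complex.exp (θ * Complex.I) - m with hz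
  have e1 : z * Complex.exp (θ * Complex.I) = Z - polarMap m θ := by
    rw [hz, polarMap_eq]
    field_simp
  have e2 : (((x + y : ℝ) : ℂ) - z) * Complex.exp (θ * Complex.I)
      = polarMap (m + (x + y)) θ - Z := by
    rw [sub_mul, e1, polarMap_eq, polarMap_eq]
    push_cast
    ring
  rw [← e1, norm_mul, hn, mul_one] at h₁
  rw [← e2, norm_mul, hn, mul_one] at h₂
  have key : z = x := by
    rcases hxy with ⟨hx, hy⟩ | ⟨hx, hy⟩
    · rw [abs_of_nonneg hx] at h₁
      rw [abs_of_nonneg hy] at h₂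
      exact Complex.eq_ofReal_of_norm_le h₁ h₂
    · rw [abs_of_nonpos hx] at h₁
      rw [abs_of_nonpos hy] at h₂
      have := Complex.eq_ofReal_of_norm_le (z := -z) (x := -x) (y := -y)
        (by rwa [norm_neg]) (by
          rw [← norm_neg]
          refine le_trans (le_of_eq ?_) h₂
          congr 1
          push_cast
          ring)
      rw [neg_eq_iff_eq_neg] at this
      rw [this]
      push_cast
      ring
  rw [key] at e1
  rw [polarMap_eq] at e1 ⊢
  push_cast
  linear_combination -e1

theorem eq_polarMap_of_circle_of_pos {α c d : ℝ} {V : ℝ → ℂ} (hα : 0 < α)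
    (hper : ∀ θ, V (θ + 2 * Real.pi / α) = V θ)
    (hlip : ∀ θ, ∀ K > α * d, ∀ᶠ η in 𝓝 θ, ‖V η - V θ‖ ≤ K * |η - θ|)
    (hclose : ∀ θ, ‖V θ - polarMap c (α * θ)‖ ≤ c - d) (θ : ℝ) : V θ = polarMap d (α * θ) := by
  set e : ℝ → ℂ := fun θ => Complex.exp (-(α * θ) * Complex.I) with he
  have e_norm : ∀ θ, ‖e θ‖ = 1 := fun θ => by
    have := Complex.norm_exp_ofReal_mul_I (-(α * θ))
    push_cast at this
    exact this
  have e_per : ∀ θ, e (θ + 2 * Real.pi / α) = e θ := fun θ => by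
    have : (-((α : ℂ) * ((θ + 2 * Real.pi / α : ℝ) : ℂ)) * Complex.I)
        = -(α * θ) * Complex.I - 2 * Real.pi * Complex.I := by
      have : (α : ℂ) ≠ 0 := by exact_mod_cast hα.ne'
      push_cast
      field_simp
      ring
    simp only [he]
    rw [this, Complex.exp_sub, Complex.exp_two_pi_mul_I, div_one]
  have e_deriv : ∀ θ, HasDerivAt e (e θ * (-α * Complex.I)) θ := fun θ => by
    have h1 : HasDerivAt (fun θ : ℝ => (-(α * θ) * Complex.I : ℂ)) (-(α * 1) * Complex.I) θ :=
      (((Complex.ofRealCLM.hasDerivAt (x := θ)).const_mul (α : ℂ)).fun_neg).mul_const Complex.I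
    simpa [he] using h1.cexp
  set w : ℝ → ℂ := fun θ => V θ * e θ with hw
  have w_close : ∀ θ, ‖w θ - c‖ ≤ c - d := by
    intro θ
    have h1 : w θ - c = (V θ - polarMap c (α * θ)) * e θ := by
      simp only [hw, he, polarMap_eq]
      push_cast
      rw [sub_mul, mul_assoc (c : ℂ), ← Complex.exp_add]
      simp
    rw [h1, norm_mul, e_norm, mul_one]
    exact hclose θ
  have w_re : ∀ θ, d ≤ (w θ).re := by
    intro θ
    have h1 := (abs_le.1 ((Complex.abs_re_le_norm _).trans (w_close θ))).1
    rw [Complex.sub_re, Complex.ofReal_re] at h1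
    linarith
  -- the imaginary part of `w` has slopes at most `α (d - re w)`
  have slope_le : ∀ θ, ∀ ε > 0, ∀ᶠ η in 𝓝[>] θ,
      (w η).im - (w θ).im ≤ (α * (d - (w θ).re) + ε) * (η - θ) := by
    intro θ ε hε
    have hd1 : HasDerivAt (fun η => (V θ * e η).im) (-α * (w θ).re) θ := by
      have h1 := ((e_deriv θ).const_mul (V θ))
      have h2 := (Complex.imCLM.hasFDerivAt (x := V θ * e θ)).comp_hasDerivAt θ h1
      refine h2.congr_deriv ?_
      simp only [hw, Complex.imCLM_apply]
      rw [← mul_assoc]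
      simp [Complex.mul_im, Complex.mul_re]
      ring
    have hd2 : ∀ᶠ η in 𝓝[>] θ,
        (V θ * e η).im - (V θ * e θ).im ≤ (-α * (w θ).re + ε / 2) * (η - θ) := by
      have h3 := (hasDerivAt_iff_tendsto_slope.1 hd1).mono_left
        (nhdsWithin_mono θ (fun x (hx : θ < x) => hx.ne'))
      filter_upwards [h3.eventually (gt_mem_nhds
        (show -α * (w θ).re < -α * (w θ).re + ε / 2 by linarith)), self_mem_nhdsWithin] with η h4 h5
      rw [slope_def_field, div_lt_iff₀ (sub_pos.2 h5)] at h4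
      exact h4.le
    filter_upwards [hd2, nhdsWithin_le_nhds (hlip θ (α * d + ε / 2) (by linarith)),
      self_mem_nhdsWithin] with η h4 h5 h6
    have h7 : (w η).im - (w θ).im = ((V η - V θ) * e η).im + ((V θ * e η).im - (V θ * e θ).im) := by
      simp only [hw]
      rw [sub_mul, Complex.sub_im]
      ring
    have h8 : ((V η - V θ) * e η).im ≤ (α * d + ε / 2) * (η - θ) := by
      refine (Complex.im_le_norm _).trans ?_
      rw [norm_mul, e_norm, mul_one]
      rwa [abs_of_pos (sub_pos.2 h6)] at h5
    rw [h7]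
    linarith
  have hV : Continuous V := by
    refine continuous_iff_continuousAt.2 fun θ => ?_
    obtain ⟨r, hr, hb⟩ := Metric.eventually_nhds_iff.1 (hlip θ (α * d + 1) (by linarith))
    refine continuousAt_of_locally_lipschitz hr (α * d + 1) fun y hy => ?_
    rw [dist_eq_norm, Real.dist_eq]
    exact hb hy
  have hwc : Continuous fun θ => (w θ).im := by
    have : Continuous e := continuous_iff_continuousAt.2 fun θ => (e_deriv θ).continuousAt
    exact Complex.continuous_im.comp (hV.mul this)
  have anti : ∀ a b, a ≤ b → (w b).im ≤ (w a).im := by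
    intro a b hab
    refine le_of_forall_pos_le_add fun δ hδ => ?_
    set ε := δ / (b - a + 1) with hε
    have hba : 0 < b - a + 1 := by linarith
    have hε0 : 0 < ε := by positivity
    have := image_le_of_liminf_slope_right_lt_deriv_boundary' (f := fun θ => (w θ).im)
      (f' := fun _ => 0) (a := a) (b := b) hwc.continuousOn (fun x _ r hr => ?_)
      (B := fun x => (w a).im + ε * (x - a)) (B' := fun _ => ε) (by simp) (by fun_prop)
      (fun x _ => ?_) (fun _ _ _ => hε0) (right_mem_Icc.2 hab)
    · refine this.trans ?_
      have : ε * (b - a + 1) = δ := by rw [hε]; field_simp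
      linarith
    · refine Eventually.frequently ?_
      filter_upwards [slope_le x (r / 2) (by linarith), self_mem_nhdsWithin] with z hz hxz
      have hxz' : 0 < z - x := sub_pos.2 hxz
      rw [slope_def_field, div_lt_iff₀ hxz']
      have h1 : α * (d - (w x).re) ≤ 0 :=
        mul_nonpos_of_nonneg_of_nonpos hα.le (by linarith [w_re x])
      refine hz.trans_lt ?_
      gcongr
      linarith
    · have h2 : HasDerivAt (fun x : ℝ => ε * (x - a)) (ε * 1) x :=
        ((hasDerivAt_id x).sub_const a).const_mul ε
      rw [mul_one] at h2
      exact (h2.const_add _).hasDerivWithinAt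
  -- being periodic, it is constant, so that `re w = d`
  have w_re' : (w θ).re = d := by
    refine le_antisymm ?_ (w_re θ)
    have hT : 0 < 2 * Real.pi / α := by positivity
    refine le_of_forall_pos_le_add fun ε hε => ?_
    obtain ⟨η, h1, h2⟩ := ((slope_le θ (α * ε) (by positivity)).and
      (Ioo_mem_nhdsGT (show θ < θ + 2 * Real.pi / α by linarith))).exists
    have h3 : (w (θ + 2 * Real.pi / α)).im = (w θ).im := by
      simp only [hw]
      rw [hper, e_per]
    have h4 := anti _ _ h2.2.le
    have h5 : 0 ≤ (α * (d - (w θ).re) + α * ε) * (η - θ) := by linarith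
    have h6 := nonneg_of_mul_nonneg_left h5 (sub_pos.2 h2.1)
    rw [← mul_add] at h6
    linarith [nonneg_of_mul_nonneg_right h6 hα]
  have w_im : (w θ).im = 0 := by
    have h1 : ‖w θ - c‖ ^ 2 ≤ (c - d) ^ 2 := by
      gcongr
      exact w_close θ
    rw [Complex.sq_norm, Complex.normSq_apply, Complex.sub_re, Complex.sub_im, Complex.ofReal_re,
      Complex.ofReal_im, w_re'] at h1
    nlinarith [mul_self_nonneg (w θ).im]
  have hwd : w θ = d :=
    Complex.ext (by rw [w_re', Complex.ofReal_re]) (by rw [w_im, Complex.ofReal_im])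
  have h1 : V θ = w θ * Complex.exp (α * θ * Complex.I) := by
    simp only [hw, he]
    rw [mul_assoc, ← Complex.exp_add]
    simp
  rw [h1, hwd, polarMap_eq]
  push_cast
  rfl

/-- Rigidity of a circle: a closed curve which stays within `|c| - |d|` of the circle
`θ ↦ ρ (c, α θ)` and whose speed is at most `|α| |d|` is the circle `θ ↦ ρ (d, α θ)`. In the
rotating frame the curve has real part at least `d`, so that its imaginary part is nonincreasing. -/
theorem eq_polarMap_of_circle {α c d : ℝ} {V : ℝ → ℂ} (hα : α ≠ 0) (hcd : 0 ≤ c → 0 ≤ d)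
    (hcd' : c ≤ 0 → d ≤ 0) (hper : ∀ θ, V (θ + 2 * Real.pi / α) = V θ)
    (hlip : ∀ θ, ∀ K > |α| * |d|, ∀ᶠ η in 𝓝 θ, ‖V η - V θ‖ ≤ K * |η - θ|)
    (hclose : ∀ θ, ‖V θ - polarMap c (α * θ)‖ ≤ |c| - |d|) (θ : ℝ) :
    V θ = polarMap d (α * θ) := by
  wlog hα' : 0 < α generalizing α V θ
  · have hα'' : α < 0 := lt_of_le_of_ne (not_lt.1 hα') hα
    have := this (α := -α) (V := fun θ => V (-θ)) (neg_ne_zero.2 hα) (fun θ => ?_)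
      (fun θ K hK => ?_) (fun θ => ?_) (-θ) (neg_pos.2 hα'')
    · simpa using this
    · rw [div_neg, neg_add, neg_neg]
      exact hper (-θ)
    · rw [abs_neg] at hK
      have h1 := (continuous_neg.tendsto θ).eventually (hlip (-θ) K hK)
      filter_upwards [h1] with η hη
      rwa [neg_sub_neg, abs_sub_comm] at hη
    · have := hclose (-θ)
      rwa [show -α * θ = α * -θ by ring]
  wlog hc : 0 ≤ c generalizing c d V
  · have hc' : c ≤ 0 := (not_le.1 hc).le
    have := this (c := -c) (d := -d) (V := fun θ => -V θ) (fun _ => neg_nonneg.2 (hcd' hc'))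
      (fun h => absurd (neg_nonpos.1 h) hc) (fun θ => by rw [hper])
      (fun θ K hK => ?_) (fun θ => ?_) (neg_nonneg.2 hc')
    · rwa [polarMap_neg, neg_inj] at this
    · rw [abs_neg] at hK
      filter_upwards [hlip θ K hK] with η hη
      rwa [neg_sub_neg, norm_sub_rev]
    · rw [polarMap_neg, neg_sub_neg, norm_sub_rev, abs_neg, abs_neg]
      exact hclose θ
  rw [abs_of_pos hα', abs_of_nonneg (hcd hc)] at hlip
  rw [abs_of_nonneg hc, abs_of_nonneg (hcd hc)] at hclose
  exact eq_polarMap_of_circle_of_pos hα' hper hlip hclose θ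

namespace ClosedCover

variable {α R₁ R₂ M₁ M₂ : ℝ}

/-! ### Tightness of the radial map given by a transition -/

/-- The values of `u` along the ray of angle `θ`, extended by zero. -/
noncomputable def ray (u : ClosedCover α R₁ R₂ → ℂ) (θ r : ℝ) : ℂ :=
  open Classical in if hr : r ∈ Icc R₁ R₂ then u (ofPolar α r θ hr) else 0

theorem ray_eq (u : ClosedCover α R₁ R₂ → ℂ) (θ : ℝ) {r : ℝ} (hr : r ∈ Icc R₁ R₂) :
    ray u θ r = u (ofPolar α r θ hr) := dif_pos hr

theorem ray_periodic (u : ClosedCover α R₁ R₂ → ℂ) (θ r : ℝ) :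
    ray u (θ + 2 * Real.pi / α) r = ray u θ r := by
  have h : ((θ + 2 * Real.pi / α : ℝ) : AddCircle (2 * Real.pi / α)) = θ :=
    AddCircle.coe_add_period _ θ
  simp only [ray, ofPolar, h]

theorem IsLip.continuousOn_ray (hR₁ : 0 ≤ R₁) {u : ClosedCover α R₁ R₂ → ℂ} (hu : IsLip u)
    (θ : ℝ) : ContinuousOn (ray u θ) (Icc R₁ R₂) := by
  obtain ⟨K, -, hK⟩ := hu.exists_radial_bound hR₁
  refine (LipschitzOnWith.of_dist_le_mul (K := Real.toNNReal K) fun x hx y hy => ?_).continuousOn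
  rw [ray_eq u θ hx, ray_eq u θ hy, dist_eq_norm, Real.dist_eq]
  exact (hK x y θ hx hy).trans (by gcongr; exact Real.le_coe_toNNReal K)

/-- Integration of a bound for the local Lipschitz constant along a ray. -/
theorem IsLip.norm_ray_sub_le (hR₁ : 0 ≤ R₁) {u : ClosedCover α R₁ R₂ → ℂ} (hu : IsLip u) {s t : ℝ}
    (hs : R₁ ≤ s) (hst : s ≤ t) (ht : t ≤ R₂) {B B' : ℝ → ℝ} (hB : ContinuousOn B (Icc s t))
    (hB' : ∀ x ∈ Ioo s t, HasDerivAt B (B' x) x) (hB0 : ∀ x ∈ Ioo s t, 0 ≤ B' x)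
    (h : ∀ p : ClosedCover α R₁ R₂, p.radius ∈ Ioo s t →
      localLip u p ≤ ENNReal.ofReal (B' p.radius)) (θ : ℝ) :
    ‖ray u θ t - ray u θ s‖ ≤ B t - B s := by
  refine norm_sub_le_of_local_bound hst
    ((hu.continuousOn_ray hR₁ θ).mono (Icc_subset_Icc hs ht)) hB hB' fun x hx K hK => ?_
  have hxR : x ∈ Ioo R₁ R₂ := ⟨hs.trans_lt hx.1, hx.2.trans_le ht⟩
  have hK0 : 0 < K := (hB0 x hx).trans_lt hK
  obtain ⟨ε, hε, H⟩ := radial_bound_of_localLip_lt (θ := θ) hR₁ hxR hK0.le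
    ((h (ofPolar α x θ (Ioo_subset_Icc_self hxR)) hx).trans_lt
      ((ENNReal.ofReal_lt_ofReal_iff hK0).2 hK))
  filter_upwards [Ioo_mem_nhdsGT (show x < min (x + ε) t from lt_min (by linarith) hx.2)] with z hz
  have hz1 : z < x + ε := hz.2.trans_le (min_le_left _ _)
  have hz2 : z < t := hz.2.trans_le (min_le_right _ _)
  have hzR : z ∈ Ioo R₁ R₂ := ⟨hxR.1.trans hz.1, hz2.trans_le ht⟩
  rw [ray_eq u θ (Ioo_subset_Icc_self hxR), ray_eq u θ (Ioo_subset_Icc_self hzR)]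
  have := H z hzR (abs_lt.2 ⟨by linarith [hz.1], by linarith⟩) x hxR (by simpa using hε)
  rwa [abs_of_pos (sub_pos.2 hz.1)] at this

/-- A map whose local Lipschitz constant on a circle is at most the angular stretching of
`ρ (d, α θ)`, and which is within `|c| - |d|` of `ρ (c, α θ)`, is equal to `ρ (d, α θ)` there. -/
theorem ray_eq_polarMap_of_circle (hα : α ≠ 0) (hR₁ : 0 ≤ R₁) {u : ClosedCover α R₁ R₂ → ℂ}
    {r c d : ℝ} (hr : r ∈ Ioo R₁ R₂) (hcd : 0 ≤ c → 0 ≤ d) (hcd' : c ≤ 0 → d ≤ 0)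
    (h : ∀ p : ClosedCover α R₁ R₂, p.radius = r → localLip u p ≤ ENNReal.ofReal (|α| * |d| / r))
    (hclose : ∀ θ, ‖ray u θ r - polarMap c (α * θ)‖ ≤ |c| - |d|) (θ : ℝ) :
    ray u θ r = polarMap d (α * θ) := by
  have hr0 : 0 < r := hR₁.trans_lt hr.1
  have hr' := Ioo_subset_Icc_self hr
  refine eq_polarMap_of_circle (V := fun θ => ray u θ r) hα hcd hcd'
    (fun θ => ray_periodic u θ r) (fun θ K hK => ?_) hclose θ
  have hK0 : 0 < K := lt_of_le_of_lt (by positivity) hK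
  have hlt : |α| * |d| / r < K / r := by gcongr
  obtain ⟨ε, hε, H⟩ := circle_bound_of_localLip_lt (θ := θ) hR₁ hr (by positivity)
    ((h (ofPolar α r θ hr') rfl).trans_lt
      ((ENNReal.ofReal_lt_ofReal_iff (by positivity)).2 hlt))
  refine Metric.eventually_nhds_iff.2 ⟨ε, hε, fun η hη => ?_⟩
  have := H η hη
  rw [ray_eq u η hr', ray_eq u θ hr']
  refine this.trans (le_of_eq ?_)
  field_simp

/-- A competitor whose local Lipschitz constant near the inner circle is at most that of the inner
arc agrees with the inner arc. -/
theorem ray_eq_inner (hα : α ≠ 0) (hR₁ : 0 < R₁) {v : ClosedCover α R₁ R₂ → ℂ} (hv : IsLip v)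
    {b : ℝ} (hb₁ : R₁ ≤ b) (hb : b ≤ R₂) (hM : ∀ θ, ray v θ R₁ = polarMap M₁ (α * θ))
    (h : ∀ p : ClosedCover α R₁ R₂, p.radius ∈ Ioo R₁ b → localLip v p
      ≤ ENNReal.ofReal (|α| * |powerArc M₁ R₁ (-|α|) p.radius| / p.radius))
    {r : ℝ} (hr : r ∈ Icc R₁ b) (θ : ℝ) :
    ray v θ r = polarMap (powerArc M₁ R₁ (-|α|) r) (α * θ) := by
  set D := powerArc M₁ R₁ (-|α|) with hD
  rcases hb₁.eq_or_lt with hb₁ | hb₁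
  · rw [show r = R₁ from le_antisymm (hr.2.trans hb₁.ge) hr.1, hM, hD, powerArc_self hR₁]
  have hDc : ContinuousOn D (Icc R₁ b) := fun x hx =>
    (hasDerivAt_powerArc hR₁ (hR₁.trans_le hx.1)).continuousAt.continuousWithinAt
  have inner : ∀ x ∈ Ioo R₁ b, ∀ θ, ray v θ x = polarMap (D x) (α * θ) := by
    intro x hx
    refine ray_eq_polarMap_of_circle hα hR₁.le (c := M₁) ⟨hx.1, hx.2.trans_le hb⟩
      (fun h => powerArc_nonneg hR₁ h (hR₁.trans hx.1).le)
      (fun h => powerArc_nonpos hR₁ h (hR₁.trans hx.1).le) (fun p hp => ?_) fun θ => ?_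
    · have := h p (by rwa [hp])
      rwa [hp] at this
    · have := hv.norm_ray_sub_le hR₁.le le_rfl hx.1.le (hx.2.le.trans hb)
        (B := fun y => -powerArc |M₁| R₁ (-|α|) y) (B' := fun y => |α| * |D y| / y)
        (fun y hy => (hasDerivAt_powerArc hR₁
          (hR₁.trans_le hy.1)).continuousAt.neg.continuousWithinAt)
        (fun y hy => ?_) (fun y hy => ?_) (fun p hp => h p ⟨hp.1, hp.2.trans hx.2⟩) θ
      · rw [hM, powerArc_self hR₁, ← abs_powerArc hR₁ (hR₁.trans hx.1).le] at this
        linarith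
      · have hy0 : 0 < y := hR₁.trans hy.1
        refine (hasDerivAt_powerArc hR₁ hy0).fun_neg.congr_deriv ?_
        rw [← abs_powerArc hR₁ hy0.le]
        ring
      · have hy0 : 0 < y := hR₁.trans hy.1
        positivity
  have hcl : Icc R₁ b ⊆ closure (Ioo R₁ b) := (closure_Ioo hb₁.ne).ge
  have hpc : Continuous fun x : ℝ => polarMap x (α * θ) := by
    simp only [polarMap_eq]
    fun_prop
  exact EqOn.of_subset_closure (fun x hx => inner x hx θ)
    ((hv.continuousOn_ray hR₁.le θ).mono (Icc_subset_Icc_right hb)) (hpc.comp_continuousOn hDc)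
    Ioo_subset_Icc_self hcl hr

/-- A competitor whose local Lipschitz constant near the outer circle is at most that of the outer
arc agrees with the outer arc. -/
theorem ray_eq_outer (hα : α ≠ 0) (hR₁ : 0 < R₁) {v : ClosedCover α R₁ R₂ → ℂ} (hv : IsLip v)
    {b : ℝ} (hb₁ : R₁ ≤ b) (hb : b ≤ R₂) (hM : ∀ θ, ray v θ R₂ = polarMap M₂ (α * θ))
    (h : ∀ p : ClosedCover α R₁ R₂, p.radius ∈ Ioo b R₂ → localLip v p
      ≤ ENNReal.ofReal (|α| * |powerArc M₂ R₂ |α| p.radius| / p.radius))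
    {r : ℝ} (hr : r ∈ Icc b R₂) (θ : ℝ) :
    ray v θ r = polarMap (powerArc M₂ R₂ |α| r) (α * θ) := by
  have hb0 : 0 < b := hR₁.trans_le hb₁
  have hR₂ : 0 < R₂ := hb0.trans_le hb
  set U := powerArc M₂ R₂ |α| with hU
  rcases hb.eq_or_lt with hb | hb
  · rw [show r = R₂ from le_antisymm hr.2 (hb.ge.trans hr.1), hM, hU, powerArc_self hR₂]
  have hUc : ContinuousOn U (Icc b R₂) := fun x hx =>
    (hasDerivAt_powerArc hR₂ (hb0.trans_le hx.1)).continuousAt.continuousWithinAt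
  have inner : ∀ x ∈ Ioo b R₂, ∀ θ, ray v θ x = polarMap (U x) (α * θ) := by
    intro x hx
    have hx0 : 0 < x := hb0.trans hx.1
    refine ray_eq_polarMap_of_circle hα hR₁.le (c := M₂) ⟨hb₁.trans_lt hx.1, hx.2⟩
      (fun h => powerArc_nonneg hR₂ h hx0.le)
      (fun h => powerArc_nonpos hR₂ h hx0.le) (fun p hp => ?_) fun θ => ?_
    · have := h p (by rwa [hp])
      rwa [hp] at this
    · have := hv.norm_ray_sub_le hR₁.le (hb₁.trans hx.1.le) hx.2.le le_rfl
        (B := powerArc |M₂| R₂ |α|) (B' := fun y => |α| * |U y| / y)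
        (fun y hy => (hasDerivAt_powerArc hR₂
          (hx0.trans_le hy.1)).continuousAt.continuousWithinAt)
        (fun y hy => ?_) (fun y hy => ?_) (fun p hp => h p ⟨hx.1.trans hp.1, hp.2⟩) θ
      · rw [hM, powerArc_self hR₂, ← abs_powerArc hR₂ hx0.le, norm_sub_rev] at this
        exact this
      · have hy0 : 0 < y := hx0.trans hy.1
        refine (hasDerivAt_powerArc hR₂ hy0).congr_deriv ?_
        rw [← abs_powerArc hR₂ hy0.le]
      · have hy0 : 0 < y := hx0.trans hy.1
        positivity
  have hcl : Icc b R₂ ⊆ closure (Ioo b R₂) := (closure_Ioo hb.ne).ge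
  have hpc : Continuous fun x : ℝ => polarMap x (α * θ) := by
    simp only [polarMap_eq]
    fun_prop
  exact EqOn.of_subset_closure (fun x hx => inner x hx θ)
    ((hv.continuousOn_ray hR₁.le θ).mono (Icc_subset_Icc_left hb₁)) (hpc.comp_continuousOn hUc)
    Ioo_subset_Icc_self hcl hr

/-- If `v` were tighter than `u`, then at some `p` the constant of `u` would exceed that of `v` and
the supremum `S` over the points where `v` has the larger constant. Wherever `bound` is at least `S`
the constant of `v` is at most `bound`. If `p` lies on an arc, this covers the part of the arc from
the boundary circle to a little beyond `p`; if `p` lies on the segment, where `bound` is least, it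
covers all of `C`. Rigidity of circles, and then of segments, gives `v = u` near `p`, a contradiction. -/
theorem isTight_of_transition (hα : α ≠ 0) (hR₁ : 0 < R₁) (hR : R₁ < R₂)
    (T : Transition |α| M₁ M₂ R₁ R₂) {u : ClosedCover α R₁ R₂ → ℂ} (hu : HasProfile u T.profile) :
    IsTight u := by
  have ha : 0 < |α| := abs_pos.2 hα
  have hR₂ : 0 < R₂ := hR₁.trans hR
  have hb := T.hasSlopeBound ha hR₁ hR
  obtain ⟨K, hK, hK1, hK2⟩ := hb.exists_bound hR₁.le
  refine ⟨hu.isLip hR₁.le hK hK1 hK2, ?_⟩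
  rintro ⟨v, hv⟩
  have hvl := hv.lip_left
  have hlt := hv.sup_lt_sup
  set S := ⨆ p ∈ {p ∈ interiorPart α R₁ R₂ | localLip u p < localLip v p}, localLip v p with hS
  simp only [lt_iSup_iff] at hlt
  obtain ⟨p, ⟨hpi, hpvu⟩, hSp⟩ := hlt
  have hu_le : ∀ q ∈ interiorPart α R₁ R₂, localLip u q ≤ ENNReal.ofReal (T.bound q.radius) :=
    fun q hq => hu.localLip_le_of_hasSlopeBound hR₁.le le_rfl hb hq
  -- where `bound` is at least `S`, it bounds the local Lipschitz constant of the competitor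
  have hv_le : ∀ q ∈ interiorPart α R₁ R₂, S ≤ ENNReal.ofReal (T.bound q.radius) →
      localLip v q ≤ ENNReal.ofReal (T.bound q.radius) := by
    intro q hq hqS
    rcases lt_or_ge (localLip u q) (localLip v q) with h | h
    · exact (le_iSup₂ (f := fun p (_ : p ∈ {p ∈ interiorPart α R₁ R₂ |
        localLip u p < localLip v p}) => localLip v p) q ⟨hq, h⟩).trans hqS
    · exact h.trans (hu_le q hq)
  have hSb : S < ENNReal.ofReal (T.bound p.radius) := hSp.trans_le (hu_le p hpi)
  have hbdry : ∀ r (hr : r ∈ Icc R₁ R₂), r = R₁ ∨ r = R₂ → ∀ θ,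
      ray v θ r = polarMap (T.profile r) (α * θ) := by
    intro r hr hr' θ
    rw [ray_eq v θ hr, hv.eqOn_boundary hr', hu.apply_ofPolar]
  have hin : ∀ θ, ray v θ R₁ = polarMap M₁ (α * θ) := fun θ => by
    rw [hbdry R₁ ⟨le_rfl, hR.le⟩ (Or.inl rfl), T.profile_left T.le_s₁, powerArc_self hR₁]
  have hout : ∀ θ, ray v θ R₂ = polarMap M₂ (α * θ) := fun θ => by
    rw [hbdry R₂ ⟨hR.le, le_rfl⟩ (Or.inr rfl), T.profile_right T.s₂_le, powerArc_self hR₂]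
  -- it suffices that the competitor agrees with `u` near the circle through `p`
  suffices hloc : ∃ ε > 0, ∀ r ∈ Icc R₁ R₂, |r - p.radius| < ε → ∀ θ,
      ray v θ r = polarMap (T.profile r) (α * θ) by
    obtain ⟨ε, hε, H⟩ := hloc
    refine hpvu.ne (localLip_congr hR₁.le hε fun q hq => ?_)
    obtain ⟨θ, hθ⟩ := exists_eq_ofPolar q
    have h1 := H q.radius q.radius_mem hq θ
    rw [ray_eq v θ q.radius_mem] at h1
    rw [hθ, hu.apply_ofPolar, h1]
  have hev : ∃ ε > 0, ∀ y ∈ Icc R₁ R₂, |y - p.radius| < ε → S ≤ ENNReal.ofReal (T.bound y) := by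
    have h1 : ContinuousOn (fun y => ENNReal.ofReal (T.bound y)) (Icc R₁ R₂) :=
      ENNReal.continuous_ofReal.comp_continuousOn hb.continuousOn
    obtain ⟨ε, hε, H⟩ := Metric.mem_nhdsWithin_iff.1
      ((h1 p.radius p.radius_mem).eventually (lt_mem_nhds hSb))
    exact ⟨ε, hε, fun y hy hyε => le_of_lt (H ⟨hyε, hy⟩)⟩
  obtain ⟨ε, hε, hSε⟩ := hev
  rcases lt_or_ge p.radius T.s₁ with hps | hps
  · -- on the inner arc
    have hRs : R₁ < T.s₁ := hpi.1.trans hps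
    set b := min (p.radius + ε) T.s₁ with hbdef
    have hpb : p.radius < b := lt_min (by linarith) hps
    have hbs : b ≤ T.s₁ := min_le_right _ _
    have hbR : b ≤ R₂ := hbs.trans (T.s₁_le_s₂.trans T.s₂_le)
    have key := fun r (hr : r ∈ Icc R₁ b) θ => ray_eq_inner hα hR₁ hvl (hpi.1.trans hpb).le hbR hin
      (fun q hq => ?_) hr θ
    · refine ⟨b - p.radius, sub_pos.2 hpb, fun r hr hrε θ => ?_⟩
      have hrb : r ≤ b := by linarith [(abs_lt.1 hrε).2]
      rw [T.profile_left (hrb.trans hbs)]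
      exact key r ⟨hr.1, hrb⟩ θ
    · rw [← T.bound_left hR₁ hRs (hq.2.le.trans hbs)]
      refine hv_le q ⟨hq.1, hq.2.trans_le hbR⟩ ?_
      rcases le_total q.radius p.radius with h | h
      · refine hSb.le.trans (ENNReal.ofReal_le_ofReal ?_)
        have hq0 : 0 < q.radius := hR₁.trans hq.1
        rw [T.bound_left hR₁ hRs hps.le, T.bound_left hR₁ hRs (h.trans hps.le)]
        exact div_le_div₀ (by positivity) (mul_le_mul_of_nonneg_left
          (abs_powerArc_anti hR₁ (neg_nonpos.2 ha.le) hq0 h) ha.le) hq0 h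
      · refine hSε _ q.radius_mem (abs_lt.2 ⟨by linarith, ?_⟩)
        linarith [hq.2, min_le_left (p.radius + ε) T.s₁]
  rcases lt_or_ge T.s₂ p.radius with hps' | hps'
  · -- on the outer arc
    have hsR : T.s₂ < R₂ := hps'.trans hpi.2
    have hs₂ : 0 < T.s₂ := hR₁.trans_le (T.le_s₁.trans T.s₁_le_s₂)
    set b := max (p.radius - ε) T.s₂ with hbdef
    have hpb : b < p.radius := max_lt (by linarith) hps'
    have hbs : T.s₂ ≤ b := le_max_right _ _
    have hbR : R₁ ≤ b := (T.le_s₁.trans T.s₁_le_s₂).trans hbs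
    have key := fun r (hr : r ∈ Icc b R₂) θ => ray_eq_outer hα hR₁ hvl hbR (hpb.trans hpi.2).le hout
      (fun q hq => ?_) hr θ
    · refine ⟨p.radius - b, sub_pos.2 hpb, fun r hr hrε θ => ?_⟩
      have hrb : b ≤ r := by linarith [(abs_lt.1 hrε).1]
      rw [T.profile_right (hbs.trans hrb)]
      exact key r ⟨hrb, hr.2⟩ θ
    · rw [← T.bound_right hR₁ hsR (hbs.trans hq.1.le)]
      refine hv_le q ⟨hbR.trans_lt hq.1, hq.2⟩ ?_
      rcases le_total p.radius q.radius with h | h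
      · refine hSb.le.trans (ENNReal.ofReal_le_ofReal ?_)
        rw [T.bound_right hR₁ hsR hps'.le, T.bound_right hR₁ hsR (hps'.le.trans h), mul_div_assoc,
          mul_div_assoc]
        exact mul_le_mul_of_nonneg_left (abs_powerArc_div_mono hR₂ (T.one_lt hsR).le
          (hs₂.trans hps') h) ha.le
      · refine hSε _ q.radius_mem (abs_lt.2 ⟨?_, by linarith⟩)
        linarith [hq.1, le_max_left (p.radius - ε) T.s₂]
  · -- on the segment, `bound` is smallest, so that it bounds the competitor everywhere
    rw [T.bound_mid hps hps'] at hSb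
    have hvb : ∀ q ∈ interiorPart α R₁ R₂, localLip v q ≤ ENNReal.ofReal (T.bound q.radius) :=
      fun q hq => hv_le q hq (hSb.le.trans
        (ENNReal.ofReal_le_ofReal (T.slope_le_bound ha hR₁ q.radius_mem)))
    have hs₁R₂ : T.s₁ ≤ R₂ := T.s₁_le_s₂.trans T.s₂_le
    have hR₁s₂ : R₁ ≤ T.s₂ := T.le_s₁.trans T.s₁_le_s₂
    have left : ∀ r ∈ Icc R₁ T.s₁, ∀ θ, ray v θ r = polarMap (T.profile r) (α * θ) := by
      intro r hr θ
      rw [T.profile_left hr.2]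
      refine ray_eq_inner hα hR₁ hvl T.le_s₁ hs₁R₂ hin (fun q hq => ?_) hr θ
      rw [← T.bound_left hR₁ (hq.1.trans hq.2) hq.2.le]
      exact hvb q ⟨hq.1, hq.2.trans_le hs₁R₂⟩
    have right : ∀ r ∈ Icc T.s₂ R₂, ∀ θ, ray v θ r = polarMap (T.profile r) (α * θ) := by
      intro r hr θ
      rw [T.profile_right hr.1]
      refine ray_eq_outer hα hR₁ hvl hR₁s₂ T.s₂_le hout (fun q hq => ?_) hr θ
      rw [← T.bound_right hR₁ (hq.1.trans hq.2) hq.1.le]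
      exact hvb q ⟨hR₁s₂.trans_lt hq.1, hq.2⟩
    refine ⟨1, one_pos, fun r hr _ θ => ?_⟩
    rcases le_total r T.s₁ with h1 | h1
    · exact left r ⟨hr.1, h1⟩ θ
    rcases le_total T.s₂ r with h2 | h2
    · exact right r ⟨h2, hr.2⟩ θ
    have seg : ∀ s t, T.s₁ ≤ s → s ≤ t → t ≤ T.s₂ →
        ‖ray v θ t - ray v θ s‖ ≤ |T.slope * (t - s)| := by
      intro s t hs hst ht
      have := hvl.norm_ray_sub_le hR₁.le (T.le_s₁.trans hs) hst (ht.trans T.s₂_le)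
        (B := fun x => |T.slope| * x) (B' := fun _ => |T.slope|) (by fun_prop)
        (fun x _ => by simpa using (hasDerivAt_id x).const_mul |T.slope|)
        (fun _ _ => abs_nonneg _) (fun q hq => ?_) θ
      · rw [abs_mul, abs_of_nonneg (sub_nonneg.2 hst), mul_sub]
        exact this
      · have hq1 := hs.trans hq.1.le
        have hq2 := hq.2.le.trans ht
        rw [← T.bound_mid hq1 hq2]
        exact hvb q ⟨T.le_s₁.trans_lt (hs.trans_lt hq.1), (hq.2.trans_le ht).trans_le T.s₂_le⟩
    have e₁ := seg T.s₁ r le_rfl h1 h2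
    have e₂ := seg r T.s₂ h1 h2 le_rfl
    rw [left T.s₁ ⟨T.le_s₁, le_rfl⟩, T.profile_left le_rfl] at e₁
    rw [right T.s₂ ⟨le_rfl, T.s₂_le⟩, T.profile_right le_rfl, T.matching,
      show T.slope * (T.s₂ - T.s₁) = T.slope * (r - T.s₁) + T.slope * (T.s₂ - r) by ring] at e₂
    rw [T.profile_mid h1 h2]
    refine eq_polarMap_of_norm_le ?_ e₁ e₂
    rcases le_total 0 T.slope with hs | hs
    · exact Or.inl ⟨mul_nonneg hs (sub_nonneg.2 h1), mul_nonneg hs (sub_nonneg.2 h2)⟩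
    · exact Or.inr ⟨mul_nonpos_of_nonpos_of_nonneg hs (sub_nonneg.2 h1),
        mul_nonpos_of_nonpos_of_nonneg hs (sub_nonneg.2 h2)⟩

end ClosedCover

theorem mainTheorem8 (α R₁ R₂ M₁ M₂ : ℝ) (hα : α ≠ 0) (hR₁ : 0 < R₁) (hR₂ : R₁ < R₂)
    (g : ClosedCover.boundaryPart α R₁ R₂ → ℂ)
    (hg : ∀ (p : ClosedCover.boundaryPart α R₁ R₂) (θ : ℝ),
      (θ : AddCircle (2 * Real.pi / α)) = p.1.angle →
        (p.1.radius = R₁ → g p = polarMap M₁ (α * θ)) ∧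
        (p.1.radius = R₂ → g p = polarMap M₂ (α * θ))) :
    ∃! u : ClosedCover α R₁ R₂ → ℂ,
      ClosedCover.IsTight u ∧ (∀ p : ClosedCover.boundaryPart α R₁ R₂, u p.1 = g p) ∧
        ClosedCover.IsRadial u := by
  obtain ⟨T⟩ := Transition.nonempty (M₁ := M₁) (M₂ := M₂) (abs_pos.2 hα) hR₁ hR₂
  obtain ⟨u, hu⟩ := ClosedCover.exists_hasProfile (R₁ := R₁) (R₂ := R₂) hα T.profile
  refine ⟨u, ⟨ClosedCover.isTight_of_transition hα hR₁ hR₂ T hu, fun p => ?_, T.profile, hu⟩, ?_⟩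
  · obtain ⟨θ, hθ⟩ := ClosedCover.exists_angle p.1
    rw [hu p.1 θ hθ]
    rcases p.2 with h | h
    · rw [(hg p θ hθ).1 h, h, T.profile_left T.le_s₁, powerArc_self hR₁]
    · rw [(hg p θ hθ).2 h, h, T.profile_right T.s₂_le, powerArc_self (hR₁.trans hR₂)]
  · rintro w ⟨hw, hwg, ψ, hψ⟩
    have hψ' : ClosedCover.HasProfile w ψ := hψ
    have e₁ : ψ R₁ = M₁ := by
      let p : ClosedCover.boundaryPart α R₁ R₂ :=
        ⟨ClosedCover.ofPolar α R₁ 0 ⟨le_rfl, hR₂.le⟩, Or.inl rfl⟩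
      have h1 := hwg p
      rw [(hg p 0 rfl).1 rfl, hψ p.1 0 rfl] at h1
      exact polarMap_left_injective _ h1
    have e₂ : ψ R₂ = M₂ := by
      let p : ClosedCover.boundaryPart α R₁ R₂ :=
        ⟨ClosedCover.ofPolar α R₂ 0 ⟨hR₂.le, le_rfl⟩, Or.inr rfl⟩
      have h1 := hwg p
      rw [(hg p 0 rfl).2 rfl, hψ p.1 0 rfl] at h1
      exact polarMap_left_injective _ h1
    have ht : ClosedCover.IsTightProfile α R₁ R₂ ψ := ⟨w, hψ', hw⟩
    funext p
    exact hψ'.eq hu (ht.eq_profile hα hR₁ hR₂ e₁ e₂ T p.radius_mem)
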